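/- Let $d\ge 2$ and let $g$ be the Coulomb kernel on $\mathbf R^d$, $g(x)=c\,|x|^{2-d}$ if $d\ge 3$ and $g(x)=-c\log|x|$ if $d=2$, where $c>0$ is a constant. Let $V\in C^2(\mathbf R^d)$, $V\ge 0$, with $V(x)\to\infty$ (if $d\ge3$), respectively $V(x)-c\log|x|\to\infty$ (if $d=2$), as $|x|\to\infty$. For a probability measure $\mu$ put $$\mathcal I_V(\mu)=\frac12\iint g(x-y)\,d\mu(x)\,d\mu(y)+\int V\,d\mu ,$$ and let $\mu_V$ be the equilibrium measure, i.e. the minimizer of $\mathcal I_V$ over probability measures; assume that $\mu_V$ has compact support and a bounded density with respect to Lebesgue measure. For $N\ge 1$ and $\beta>0$ let $\mu_\beta$ be the thermal equilibrium measure, i.e. the minimizer of $\mathcal I_V(\mu)+\frac1{N\beta}\int\mu\log\mu$ over probability measures (with a measure and its density denoted by the same letter). In both minimizations, only measures for which every term of the functional is finite compete. For a finite signed measure $\sigma$ on $\mathbf R^d$ let $\|\sigma\|_{BL}=\sup\{\int f\,d\sigma:\ |f|\le 1,\ f \text{ Lipschitz with constant } 1\}$ and $$G(\sigma,\sigma)=\iint_{x\ne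 y} g(x-y)\,d\sigma(x)\,d\sigma(y).$$ Let $\mathcal P(\mathbf R^d)$ be the set of probability measures, $\mathcal S$ the set of absolutely continuous ones, $\mathcal P_N$ the set of measures $\frac1N\sum_{i=1}^N\delta_{x_i}$ with distinct $x_1,\dots,x_N\in\mathbf R^d$, and $B(\mu,r)=\{\nu\in\mathcal P(\mathbf R^d):\|\mu-\nu\|_{BL}<r\}$. For real $k_1$ and $k_2>0$ put $$A_N=\mathcal P(\mathbf R^d)\setminus B\Big(\mu_\beta,\frac{k_1}{N^{1/d}}\Big),\qquad B_N=\mathcal P(\mathbf R^d)\setminus B\Big(\mu_\beta,\frac{(k_1-k_2)_+}{N^{1/d}}\Big),\qquad (x)_+=\max(x,0).$$ Then there is an absolute constant $k_2>0$, and, for all $d\ge2$, $c>0$ and $M\ge0$, a constant $C>0$ depending only on $d$, $c$ and $M$, such that for all $V$ as above with $\|\mu_V\|_{L^\infty}\le M$, all $N\ge1$, $\beta>0$, all $\mu_\beta$ as above and all $k_1\in\mathbf R$: if $d\ge 3$, $$\inf_{\mu\in A_N\cap\mathcal P_N}G(\mu-\mu_\beta,\mu-\mu_\beta)\ \ge\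 \inf_{\mu\in B_N\cap\mathcal S}G(\mu-\mu_\beta,\mu-\mu_\beta)-\frac{C}{N^{2/d}},$$ and if $d=2$, $$\inf_{\mu\in A_N\cap\mathcal P_N}G(\mu-\mu_\beta,\mu-\mu_\beta)\ \ge\ \inf_{\mu\in B_N\cap\mathcal S}G(\mu-\mu_\beta,\mu-\mu_\beta)-\frac{C}{N}-\frac{c\log N}{2N}.$$ Here infima are taken in the extended reals ($\inf\emptyset=+\infty$), and measures $\mu$ for which the double integral defining $G(\mu-\mu_\beta,\mu-\mu_\beta)$ is undefined (positive and negative part both infinite) are left out of them. For $c=1$ the last error term is $\frac{\log N}{2N}$, and for $c\le1$, in particular for the normalization $c=\frac1{2\pi}$ with $-\Delta g=\delta_0$, it is at most $\frac{\log N}{2N}$. -/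

import Mathlib

open MeasureTheory Filter
open scoped ENNReal NNReal

noncomputable section

/-- Euclidean space `ℝ^d`. -/
abbrev Rd (d : ℕ) : Type := EuclideanSpace ℝ (Fin d)

/-- The Coulomb kernel `g` with constant `c > 0`: `g x = -c * log |x|` if `d = 2` and
`g x = c / |x|^(d-2)` if `d ≥ 3`. The value at `x = 0` is never used: the diagonal is either removed
(in `coulombG`) or required to be a null set (in `FiniteMeanField`). -/
def coulombKernel (d : ℕ) (c : ℝ) (x : Rd d) : ℝ :=
  if d = 2 then -c * Real.log ‖x‖ else c / ‖x‖ ^ (d - 2)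

/-- Assumptions on the confining potential: `V` is `C²`, nonnegative, and grows at infinity
(`V → ∞` if `d ≥ 3`, and `V - c log|x| → ∞` if `d = 2`). -/
structure IsConfining (d : ℕ) (c : ℝ) (V : Rd d → ℝ) : Prop where
  contDiff : ContDiff ℝ 2 V
  nonneg : ∀ x, 0 ≤ V x
  growth : 3 ≤ d → Tendsto V (cocompact (Rd d)) atTop
  growth_two : d = 2 → Tendsto (fun x => V x - c * Real.log ‖x‖) (cocompact (Rd d)) atTop

/-- `μ` is a probability measure for which both terms of the mean-field energy are finite. As
`g(0) = +∞` in the mean-field energy, the diagonal has to be a null set for `μ ⊗ μ`. -/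
structure FiniteMeanField (d : ℕ) (c : ℝ) (V : Rd d → ℝ) (μ : Measure (Rd d)) : Prop where
  prob : IsProbabilityMeasure μ
  diag : (μ.prod μ) (Set.diagonal (Rd d)) = 0
  kernel : Integrable (fun z : Rd d × Rd d => coulombKernel d c (z.1 - z.2)) (μ.prod μ)
  potential : Integrable V μ

/-- The mean-field energy `I_V(μ) = 1/2 ∬ g(x-y) dμ(x) dμ(y) + ∫ V dμ`
(meaningful if `FiniteMeanField d c V μ`). -/
def meanField (d : ℕ) (c : ℝ) (V : Rd d → ℝ) (μ : Measure (Rd d)) : ℝ :=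
  (1 / 2) * (∫ z : Rd d × Rd d, coulombKernel d c (z.1 - z.2) ∂(μ.prod μ)) + ∫ x, V x ∂μ

/-- `μ` is the equilibrium measure: it minimizes `I_V` over probability measures. (Measures with
infinite energy do not compete.) -/
def IsEquilibriumMeasure (d : ℕ) (c : ℝ) (V : Rd d → ℝ) (μ : Measure (Rd d)) : Prop :=
  FiniteMeanField d c V μ ∧
    ∀ ν : Measure (Rd d), FiniteMeanField d c V ν → meanField d c V μ ≤ meanField d c V ν

/-- The Lebesgue density of `μ`. -/
def density {d : ℕ} (μ : Measure (Rd d)) (x : Rd d) : ℝ := (μ.rnDeriv volume x).toReal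

/-- `μ` is a probability measure for which all terms of the free energy are finite; in particular
`μ` has a density `ρ`, and `ρ log ρ` is integrable. -/
structure FiniteFreeEnergy (d : ℕ) (c : ℝ) (V : Rd d → ℝ) (μ : Measure (Rd d)) : Prop where
  meanField : FiniteMeanField d c V μ
  ac : μ ≪ volume
  entropy : Integrable (fun x => density μ x * Real.log (density μ x)) volume

/-- The free energy `I_V(μ) + (1/θ) ∫ ρ log ρ` of `μ = ρ dx` at `θ = Nβ`. -/
def freeEnergy (d : ℕ) (c : ℝ) (V : Rd d → ℝ) (θ : ℝ) (μ : Measure (Rd d)) : ℝ :=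
  meanField d c V μ + (1 / θ) * ∫ x, density μ x * Real.log (density μ x)

/-- `μ` is the thermal equilibrium measure: it minimizes the free energy over probability
measures. -/
def IsThermalEquilibrium (d : ℕ) (c : ℝ) (V : Rd d → ℝ) (θ : ℝ) (μ : Measure (Rd d)) : Prop :=
  FiniteFreeEnergy d c V μ ∧
    ∀ ν : Measure (Rd d), FiniteFreeEnergy d c V ν → freeEnergy d c V θ μ ≤ freeEnergy d c V θ ν

/-- The bounded Lipschitz norm `‖μ - ν‖_BL`: the supremum of `∫ f d(μ - ν)` over the unit ball of
`W^{1,∞}(ℝ^d)`, that is, over the functions `f` bounded by `1` and Lipschitz with constant `1`. -/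
def blDist {d : ℕ} (μ ν : Measure (Rd d)) : ℝ :=
  sSup {r : ℝ | ∃ f : Rd d → ℝ, (∀ x, |f x| ≤ 1) ∧ LipschitzWith 1 f ∧
    r = (∫ x, f x ∂μ) - ∫ x, f x ∂ν}

/-- The set of probability measures on `ℝ^d`. -/
def probMeasures (d : ℕ) : Set (Measure (Rd d)) := {μ | IsProbabilityMeasure μ}

/-- The open ball `B(μ, r)` for the bounded Lipschitz norm, in the set of probability measures. -/
def blBall {d : ℕ} (μ : Measure (Rd d)) (r : ℝ) : Set (Measure (Rd d)) :=
  {ν | ν ∈ probMeasures d ∧ blDist μ ν < r}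

/-- The set `P_N` of measures consisting of `N` equally weighted point masses, at distinct points. -/
def empiricalMeasures (d N : ℕ) : Set (Measure (Rd d)) :=
  {μ | ∃ x : Fin N → Rd d, Function.Injective x ∧
    μ = (N : ℝ≥0∞)⁻¹ • ∑ i, Measure.dirac (x i)}

/-- The set `S` of absolutely continuous probability measures. -/
def acMeasures (d : ℕ) : Set (Measure (Rd d)) := {μ | μ ∈ probMeasures d ∧ μ ≪ volume}

/-- The integral of `g⁺` against the "positive" part `μ⊗μ + ν⊗ν` of `(μ-ν)⊗(μ-ν)` plus the integral
of `g⁻` against its "negative" part `μ⊗ν + ν⊗μ`, for a function `g` of `x - y`, off the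
diagonal. -/
def offDiagPos {d : ℕ} (g : Rd d → ℝ) (μ ν : Measure (Rd d)) : ℝ≥0∞ :=
  (∫⁻ z in (Set.diagonal (Rd d))ᶜ, ENNReal.ofReal (g (z.1 - z.2)) ∂(μ.prod μ + ν.prod ν)) +
    ∫⁻ z in (Set.diagonal (Rd d))ᶜ, ENNReal.ofReal (-g (z.1 - z.2)) ∂(μ.prod ν + ν.prod μ)

open scoped Classical in
/-- `G(μ - ν, μ - ν) = ∬_{x ≠ y} g(x-y) d(μ-ν)(x) d(μ-ν)(y)`, with `g` the Coulomb kernel, as an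
extended real: the difference of the integrals of the positive and the negative part. Where both
are infinite the double integral is undefined; the value `+∞` then removes the pair from
infima. -/
def coulombG (d : ℕ) (c : ℝ) (μ ν : Measure (Rd d)) : EReal :=
  if offDiagPos (coulombKernel d c) μ ν = ⊤ ∧ offDiagPos (fun x => -coulombKernel d c x) μ ν = ⊤
  then ⊤
  else (offDiagPos (coulombKernel d c) μ ν : EReal) -
    (offDiagPos (fun x => -coulombKernel d c x) μ ν : EReal)

end

/-! Each point charge of an empirical measure is smeared into a Gaussian of width `r ∼ N^{-1/d}`.
The smeared measure is absolutely continuous, so it competes on the right-hand side as soon as it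
stays far enough from `μ_β`, and its energy has to be compared with that of the point charges.

Everything rests on one identity: up to a constant in dimension two, `g` is `κ` times the time
integral of the heat kernel, so averaging `g` over the Gaussian at time `t` lowers it, away from the
origin, by exactly `κ ∫₀ᵗ heat` (`exists_integral_coulombKernel_heatMeasure`). Three consequences
follow for `t = r²`. Interactions between distinct charges do not increase. The `N`
self-interactions, each weighted by `N⁻²`, cost at most `N⁻¹ heatSelf`, which is of order `N⁻¹
r^{2-d} ∼ N^{-2/d}` for `d ≥ 3`, while for `d = 2` it contains `-c log r / N` and hence the term `c
log N / (2N)`. The interaction with `μ_β` drops by at most `κ L t` if `μ_β` has density at most `L`,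
because `∫₀ᵗ heat` has total integral `t`. These are combined in `coulombG_heatAt_le`. The bounded
Lipschitz distance changes by at most the mean displacement, which is at most `N^{-1/d}` by the
choice of `r`; hence `k₂ = 1`.

What remains is a bound on the density of `μ_β` uniform in `N`, `β` and `V`
(`IsThermalEquilibrium.density_le`: at most `M + 2`). Minimality makes `μ_β` a Gibbs density for its
own effective potential, while the effective potential of `μ_V` is at least a constant, with
equality where `μ_V` lives. With `u` the difference of the two Coulomb potentials, the density of
`μ_β` is therefore at most `D exp(θ u)`, with equality where `μ_V` has mass. If `u` exceeded a level
`k` with `D exp(θ k) > M` on a set of positive volume, `μ_β` would charge that set strictly more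
than `μ_V`. This contradicts a weak maximum principle (`measureReal_potential_gt_le`): on a set
where the potential of one measure exceeds that of the other by more than a positive level, the
first measure has at least as much mass. That principle is a Kato inequality proved with the heat
semigroup, so no distributional Laplacian is used. -/

theorem measurable_coulombKernel (d : ℕ) (c : ℝ) : Measurable (coulombKernel d c) := by
  unfold coulombKernel
  split_ifs <;> fun_prop

theorem coulombKernel_neg (d : ℕ) (c : ℝ) (x : Rd d) :
    coulombKernel d c (-x) = coulombKernel d c x := by
  simp [coulombKernel]

theorem coulombKernel_sub_comm (d : ℕ) (c : ℝ) (x y : Rd d) :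
    coulombKernel d c (x - y) = coulombKernel d c (y - x) := by
  rw [← coulombKernel_neg, neg_sub]

theorem measurable_coulombKernel_sub (d : ℕ) (c : ℝ) :
    Measurable fun z : Rd d × Rd d => coulombKernel d c (z.1 - z.2) :=
  (measurable_coulombKernel d c).comp (measurable_fst.sub measurable_snd)

/-! ### Splitting the kernel into a singular near part and a slowly varying far part -/

/-- The Coulomb kernel as a function of the distance. -/
noncomputable def kernelRadius (d : ℕ) (c R : ℝ) : ℝ :=
  if d = 2 then -c * Real.log R else c / R ^ (d - 2)

/-- The Coulomb kernel, truncated from above at its value at distance `R`. -/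
noncomputable def kernelFar (d : ℕ) (c R : ℝ) (x : Rd d) : ℝ :=
  min (coulombKernel d c x) (kernelRadius d c R)

/-- The part of the Coulomb kernel removed by the truncation at distance `R`. -/
noncomputable def kernelNear (d : ℕ) (c R : ℝ) (x : Rd d) : ℝ :=
  coulombKernel d c x - kernelFar d c R x

/-- A weight controlling the growth of the Coulomb kernel at infinity. -/
noncomputable def logWeight (d : ℕ) (c : ℝ) (x : Rd d) : ℝ :=
  if d = 2 then c * Real.log (1 + ‖x‖) else 0

/-- A bound for the oscillation of the truncated Coulomb kernel under translation by `y`. -/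
noncomputable def farOsc (d : ℕ) (c R : ℝ) (y : Rd d) : ℝ :=
  if d = 2 then c * Real.log (1 + ‖y‖ / R) else c / R ^ (d - 2)

theorem kernelNear_add_kernelFar (d : ℕ) (c R : ℝ) (x : Rd d) :
    kernelNear d c R x + kernelFar d c R x = coulombKernel d c x := by
  simp [kernelNear]

theorem kernelNear_nonneg (d : ℕ) (c R : ℝ) (x : Rd d) : 0 ≤ kernelNear d c R x :=
  sub_nonneg.2 (min_le_left _ _)

theorem measurable_kernelFar (d : ℕ) (c R : ℝ) : Measurable (kernelFar d c R) :=
  (measurable_coulombKernel d c).min measurable_const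

theorem measurable_kernelNear (d : ℕ) (c R : ℝ) : Measurable (kernelNear d c R) :=
  (measurable_coulombKernel d c).sub (measurable_kernelFar d c R)

theorem measurable_logWeight (d : ℕ) (c : ℝ) : Measurable (logWeight d c) := by
  unfold logWeight
  split_ifs <;> fun_prop

theorem measurable_farOsc (d : ℕ) (c R : ℝ) : Measurable (farOsc d c R) := by
  unfold farOsc
  split_ifs <;> fun_prop

theorem logWeight_nonneg {d : ℕ} {c : ℝ} (hc : 0 < c) (x : Rd d) : 0 ≤ logWeight d c x := by
  unfold logWeight
  split_ifs
  · exact mul_nonneg hc.le (Real.log_nonneg (by linarith [norm_nonneg x]))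
  · exact le_rfl

theorem farOsc_nonneg {d : ℕ} {c R : ℝ} (hc : 0 < c) (hR : 1 ≤ R) (x : Rd d) :
    0 ≤ farOsc d c R x := by
  have : 0 ≤ ‖x‖ / R := by positivity
  unfold farOsc
  split_ifs
  · exact mul_nonneg hc.le (Real.log_nonneg (by linarith))
  · positivity

theorem logWeight_neg (d : ℕ) (c : ℝ) (x : Rd d) : logWeight d c (-x) = logWeight d c x := by
  simp [logWeight]

theorem logWeight_add_le {d : ℕ} {c : ℝ} (hc : 0 < c) (x y : Rd d) :
    logWeight d c (x + y) ≤ logWeight d c x + logWeight d c y := by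
  unfold logWeight
  split_ifs
  · rw [← mul_add, ← Real.log_mul (by positivity) (by positivity)]
    gcongr
    nlinarith [norm_add_le x y, norm_nonneg x, norm_nonneg y,
      mul_nonneg (norm_nonneg x) (norm_nonneg y)]
  · simp

theorem logWeight_sub_le {d : ℕ} {c : ℝ} (hc : 0 < c) (x y : Rd d) :
    logWeight d c (x - y) ≤ logWeight d c x + logWeight d c y := by
  rw [sub_eq_add_neg, ← logWeight_neg d c y]
  exact logWeight_add_le hc x (-y)

theorem kernelNear_eq_zero {d : ℕ} {c R : ℝ} (hc : 0 < c) (hR : 0 < R) {x : Rd d}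
    (hx : R ≤ ‖x‖) : kernelNear d c R x = 0 := by
  have : coulombKernel d c x ≤ kernelRadius d c R := by
    unfold coulombKernel kernelRadius
    split_ifs
    · have := Real.log_le_log hR hx
      nlinarith
    · gcongr
  simp [kernelNear, kernelFar, this]

/-- In dimension two `log (R/|x|) ≤ R/|x|` trades the logarithm for a power. In every dimension the
singularity is thus controlled by a power `|x|^{-α}` with `0 < α < d`, which is integrable at the
origin. -/
theorem kernelNear_le {d : ℕ} (hd : 2 ≤ d) {c R : ℝ} (hc : 0 < c) (hR : 0 < R) {x : Rd d}
    (hx : x ≠ 0) :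
    kernelNear d c R x ≤
      (if d = 2 then c * R else c) * ‖x‖ ^ (-(if d = 2 then 1 else (d : ℝ) - 2)) := by
  have hx' : 0 < ‖x‖ := norm_pos_iff.2 hx
  rcases le_total R ‖x‖ with h | h
  · rw [kernelNear_eq_zero hc hR h]
    have : (0 : ℝ) ≤ if d = 2 then c * R else c := by split_ifs <;> positivity
    positivity
  rw [kernelNear, kernelFar]
  have key : coulombKernel d c x - kernelRadius d c R ≤
      (if d = 2 then c * R else c) * ‖x‖ ^ (-(if d = 2 then 1 else (d : ℝ) - 2)) := by
    unfold coulombKernel kernelRadius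
    split_ifs with h2
    · have h1 : Real.log (R / ‖x‖) ≤ R / ‖x‖ := by
        have := Real.log_le_sub_one_of_pos (div_pos hR hx')
        linarith
      rw [Real.log_div hR.ne' hx'.ne'] at h1
      rw [Real.rpow_neg_one, mul_assoc, ← div_eq_mul_inv]
      nlinarith
    · have : (0 : ℝ) ≤ c / R ^ (d - 2) := by positivity
      rw [Real.rpow_neg hx'.le, show (d : ℝ) - 2 = ((d - 2 : ℕ) : ℝ) by push_cast [hd]; ring,
        Real.rpow_natCast, ← div_eq_mul_inv]
      linarith
  have h0 : (0 : ℝ) ≤ (if d = 2 then c * R else c) * ‖x‖ ^ (-(if d = 2 then 1 else (d : ℝ) - 2)) := by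
    have : (0 : ℝ) ≤ if d = 2 then c * R else c := by split_ifs <;> positivity
    positivity
  rcases min_cases (coulombKernel d c x) (kernelRadius d c R) with h | h <;> rw [h.1] <;> linarith

theorem nontrivial_Rd {d : ℕ} (hd : 2 ≤ d) : Nontrivial (Rd d) :=
  have : Nonempty (Fin d) := ⟨⟨0, by omega⟩⟩
  inferInstance

theorem integrable_kernelNear {d : ℕ} (hd : 2 ≤ d) {c R : ℝ} (hc : 0 < c) (hR : 0 < R) :
    Integrable (kernelNear d c R) := by
  have := nontrivial_Rd hd
  have h1 : IntegrableOn (kernelNear d c R) (Metric.ball 0 R) := by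
    refine integrableOn_ball_of_norm_le_rpow (C := if d = 2 then c * R else c)
      (α := if d = 2 then 1 else (d : ℝ) - 2) ?_ ?_ ?_ (measurable_kernelNear d c R).aestronglyMeasurable
    · simp; omega
    · rw [finrank_euclideanSpace_fin]
      split_ifs with h
      · rw [h]; norm_num
      · linarith
    · refine ae_restrict_of_ae ?_
      filter_upwards [Measure.ae_ne volume (0 : Rd d)] with x hx
      rw [Real.norm_of_nonneg (kernelNear_nonneg _ _ _ _)]
      exact kernelNear_le hd hc hR hx
  rwa [integrableOn_iff_integrable_of_support_subset] at h1
  intro x hx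
  by_contra h
  exact hx (kernelNear_eq_zero hc hR (by simpa using h))

theorem kernelFar_two {c R : ℝ} (hc : 0 < c) (hR : 1 ≤ R) (x : Rd 2) :
    kernelFar 2 c R x = -c * Real.log (max ‖x‖ R) := by
  have : 0 ≤ Real.log R := Real.log_nonneg hR
  unfold kernelFar coulombKernel kernelRadius
  simp only [if_true]
  rcases le_total ‖x‖ R with h | h
  · rw [max_eq_right h, min_eq_right]
    -- At the origin the kernel has the default value `0`; `R ≥ 1` ensures that the truncation value
    -- `-c log R` is still the minimum.
    rcases eq_or_ne ‖x‖ 0 with h0 | h0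
    · rw [h0, Real.log_zero]; nlinarith
    · have := Real.log_le_log ((norm_nonneg x).lt_of_ne' h0) h
      nlinarith
  · rw [max_eq_left h, min_eq_left]
    have := Real.log_le_log (by linarith) h
    nlinarith

theorem kernelFar_of_ne_two {d : ℕ} {c R : ℝ} (h2 : d ≠ 2) (hc : 0 < c) (hR : 1 ≤ R) (x : Rd d) :
    0 ≤ kernelFar d c R x ∧ kernelFar d c R x ≤ c / R ^ (d - 2) := by
  unfold kernelFar coulombKernel kernelRadius
  simp only [if_neg h2]
  exact ⟨le_min (by positivity) (by positivity), min_le_right _ _⟩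

theorem abs_kernelFar_le {d : ℕ} {c R : ℝ} (hc : 0 < c) (hR : 1 ≤ R) (x : Rd d) :
    |kernelFar d c R x| ≤ |kernelRadius d c R| + logWeight d c x := by
  by_cases h2 : d = 2
  · subst h2
    have hl : 0 ≤ Real.log R := Real.log_nonneg hR
    have hl' : 0 ≤ Real.log (1 + ‖x‖) := Real.log_nonneg (by linarith [norm_nonneg x])
    have h3 : 0 ≤ Real.log (max ‖x‖ R) := Real.log_nonneg (hR.trans (le_max_right _ _))
    have h4 : Real.log (max ‖x‖ R) ≤ Real.log R + Real.log (1 + ‖x‖) := by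
      rw [← Real.log_mul (by positivity) (by positivity)]
      apply Real.log_le_log (by positivity)
      apply max_le <;> nlinarith [norm_nonneg x]
    rw [kernelFar_two hc hR]
    simp only [kernelRadius, logWeight, if_true, abs_mul, abs_neg, abs_of_pos hc, abs_of_nonneg hl,
      abs_of_nonneg h3]
    nlinarith
  · have := kernelFar_of_ne_two h2 hc hR x
    rw [abs_of_nonneg this.1]
    simp only [kernelRadius, logWeight, if_neg h2, add_zero]
    exact this.2.trans (le_abs_self _)

/-- For `d = 2`, `max |u| R ≤ max |v| R · (1 + |y|/R)` whenever `|u| ≤ |v| + |y|`; for `d ≥ 3` both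
values lie in `[0, c/R^{d-2}]`. The bound is uniform in `x` and vanishes as `R → ∞`, so far
potentials of probability measures hardly depend on the measure. -/
theorem abs_kernelFar_sub_le {d : ℕ} {c R : ℝ} (hc : 0 < c) (hR : 1 ≤ R) (x y : Rd d) :
    |kernelFar d c R (x - y) - kernelFar d c R x| ≤ farOsc d c R y := by
  have hR0 : 0 < R := by linarith
  by_cases h2 : d = 2
  · subst h2
    rw [kernelFar_two hc hR, kernelFar_two hc hR]
    simp only [farOsc, if_true]
    have key : ∀ u v : Rd 2, ‖u‖ ≤ ‖v‖ + ‖y‖ →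
        Real.log (max ‖u‖ R) ≤ Real.log (max ‖v‖ R) + Real.log (1 + ‖y‖ / R) := by
      intro u v h
      rw [← Real.log_mul (by positivity) (by positivity)]
      apply Real.log_le_log (by positivity)
      have h0 : 0 ≤ ‖y‖ / R := by positivity
      have h1 : ‖y‖ ≤ max ‖v‖ R * (‖y‖ / R) := by
        calc ‖y‖ = R * (‖y‖ / R) := by field_simp
          _ ≤ _ := by gcongr; exact le_max_right _ _
      rw [mul_add, mul_one]
      apply max_le
      · linarith [le_max_left ‖v‖ R]
      · linarith [le_max_right ‖v‖ R, norm_nonneg y]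
    have h1 := key (x - y) x (norm_sub_le x y)
    have h2 := key x (x - y) (by simpa using norm_add_le (x - y) y)
    rw [abs_le]
    constructor <;> nlinarith
  · have h1 := kernelFar_of_ne_two h2 hc hR x
    have h3 := kernelFar_of_ne_two h2 hc hR (x - y)
    simp only [farOsc, if_neg h2]
    rw [abs_le]
    constructor <;> linarith

theorem farOsc_le {d : ℕ} {c R : ℝ} (hc : 0 < c) (hR : 1 ≤ R) (y : Rd d) :
    farOsc d c R y ≤ c + logWeight d c y := by
  unfold farOsc logWeight
  split_ifs
  · have : ‖y‖ / R ≤ ‖y‖ := div_le_self (norm_nonneg _) hR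
    have : Real.log (1 + ‖y‖ / R) ≤ Real.log (1 + ‖y‖) :=
      Real.log_le_log (by positivity) (by linarith)
    nlinarith
  · rw [add_zero]
    exact div_le_self hc.le (one_le_pow₀ hR)

theorem tendsto_farOsc {d : ℕ} (hd : 2 ≤ d) (c : ℝ) (y : Rd d) :
    Tendsto (fun R => farOsc d c R y) atTop (nhds 0) := by
  unfold farOsc
  split_ifs with h
  · have h1 : Tendsto (fun R : ℝ => 1 + ‖y‖ / R) atTop (nhds (1 + 0)) :=
      tendsto_const_nhds.add (tendsto_const_nhds.div_atTop tendsto_id)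
    rw [add_zero] at h1
    simpa using (h1.log one_ne_zero).const_mul c
  · exact tendsto_const_nhds.div_atTop (tendsto_pow_atTop (by omega))

/-- Dominated convergence as `R → ∞`, with the majorant of `farOsc_le`, which does not depend on
`R`. -/
theorem exists_integral_farOsc_le {d : ℕ} (hd : 2 ≤ d) {c : ℝ} (hc : 0 < c) (μ : Measure (Rd d))
    [IsFiniteMeasure μ] (hμ : Integrable (logWeight d c) μ) {k : ℝ} (hk : 0 < k) :
    ∃ R, 1 ≤ R ∧ ∫ y, farOsc d c R y ∂μ ≤ k := by
  have h : Tendsto (fun R => ∫ y, farOsc d c R y ∂μ) atTop (nhds (∫ _, (0 : ℝ) ∂μ)) := by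
    refine tendsto_integral_filter_of_dominated_convergence (fun y => c + logWeight d c y) ?_ ?_
      ((integrable_const c).add hμ) ?_
    · exact Eventually.of_forall fun R => (measurable_farOsc d c R).aestronglyMeasurable
    · filter_upwards [eventually_ge_atTop 1] with R hR
      refine Eventually.of_forall fun y => ?_
      rw [Real.norm_of_nonneg (farOsc_nonneg hc hR y)]
      exact farOsc_le hc hR y
    · exact Eventually.of_forall fun y => tendsto_farOsc hd c y
  rw [integral_zero] at h
  obtain ⟨R, h1, h2⟩ := ((h.eventually_lt_const hk).and (eventually_ge_atTop 1)).exists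
  exact ⟨R, h2, h1.le⟩

theorem integrable_farOsc {d : ℕ} {c : ℝ} (hc : 0 < c) {μ : Measure (Rd d)}
    [IsFiniteMeasure μ] (hμ : Integrable (logWeight d c) μ) {R : ℝ} (hR : 1 ≤ R) :
    Integrable (farOsc d c R) μ := by
  refine ((integrable_const c).add hμ).mono' (measurable_farOsc d c R).aestronglyMeasurable ?_
  refine Eventually.of_forall fun y => ?_
  rw [Real.norm_of_nonneg (farOsc_nonneg hc hR y)]
  exact farOsc_le hc hR y

/-! ### Integrability of the kernel against products of measures -/

theorem integrable_comp_sub_prod_of_le {d : ℕ} {μ ν : Measure (Rd d)} [SFinite μ]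
    [IsFiniteMeasure ν] {f : Rd d → ℝ} (hf : Integrable f) (hfm : Measurable f)
    {L : ℝ≥0} (hL : μ ≤ L • (volume : Measure (Rd d))) :
    Integrable (fun z : Rd d × Rd d => f (z.1 - z.2)) (μ.prod ν) := by
  have hm : AEStronglyMeasurable (fun z : Rd d × Rd d => f (z.1 - z.2)) (μ.prod ν) :=
    (hfm.comp (measurable_fst.sub measurable_snd)).aestronglyMeasurable
  have hi : ∀ y, Integrable (fun x => f (x - y)) (L • (volume : Measure (Rd d))) := fun y =>
    (hf.comp_sub_right y).smul_measure_nnreal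
  rw [integrable_prod_iff' hm]
  refine ⟨Eventually.of_forall fun y => (hi y).mono_measure hL, ?_⟩
  refine (integrable_const (L * ∫ x, ‖f x‖)).mono' hm.norm.prod_swap.integral_prod_right'
    (Eventually.of_forall fun y => ?_)
  rw [Real.norm_of_nonneg (by positivity)]
  refine (integral_mono_measure hL (Eventually.of_forall fun _ => norm_nonneg _)
    (hi y).norm).trans (le_of_eq ?_)
  rw [integral_smul_nnreal_measure, integral_sub_right_eq_self (fun x => ‖f x‖) y]
  rfl

section Product

variable {d : ℕ} {c R : ℝ} {μ ν : Measure (Rd d)} [IsFiniteMeasure μ] [IsFiniteMeasure ν]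

theorem integrable_kernelFar_prod (hc : 0 < c) (hR : 1 ≤ R) (hμ : Integrable (logWeight d c) μ)
    (hν : Integrable (logWeight d c) ν) :
    Integrable (fun z : Rd d × Rd d => kernelFar d c R (z.1 - z.2)) (μ.prod ν) := by
  have h1 : Integrable (fun z : Rd d × Rd d =>
      |kernelRadius d c R| + (logWeight d c z.1 + logWeight d c z.2)) (μ.prod ν) :=
    (integrable_const _).add ((hμ.comp_fst ν).add (hν.comp_snd μ))
  refine h1.mono' ((measurable_kernelFar d c R).comp
    (measurable_fst.sub measurable_snd)).aestronglyMeasurable (Eventually.of_forall fun z => ?_)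
  exact (abs_kernelFar_le hc hR _).trans (by gcongr; exact logWeight_sub_le hc _ _)

theorem integrable_coulombKernel_prod (hd : 2 ≤ d) (hc : 0 < c) {L : ℝ≥0}
    (hL : μ ≤ L • (volume : Measure (Rd d))) (hμ : Integrable (logWeight d c) μ)
    (hν : Integrable (logWeight d c) ν) :
    Integrable (fun z : Rd d × Rd d => coulombKernel d c (z.1 - z.2)) (μ.prod ν) := by
  have := (integrable_comp_sub_prod_of_le (ν := ν) (integrable_kernelNear hd hc one_pos)
    (measurable_kernelNear d c 1) hL).add (integrable_kernelFar_prod hc le_rfl hμ hν)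
  refine this.congr (Eventually.of_forall fun z => ?_)
  exact kernelNear_add_kernelFar d c 1 _

end Product

/-- A probability measure of finite Coulomb energy integrates the logarithmic weight. -/
theorem integrable_logWeight {d : ℕ} {c : ℝ} (hc : 0 < c) {μ : Measure (Rd d)}
    [IsProbabilityMeasure μ]
    (h : Integrable (fun z : Rd d × Rd d => coulombKernel d c (z.1 - z.2)) (μ.prod μ)) :
    Integrable (logWeight d c) μ := by
  by_cases h2 : d = 2
  swap
  · have : logWeight d c = fun _ => 0 := by funext x; simp [logWeight, h2]
    rw [this]; exact integrable_zero _ _ _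
  subst h2
  -- By Fubini some slice `y ↦ g(x - y)` is integrable, and `log (1 + |y|) ≤ log (2 + |x|) + |log |x
  -- - y||` for that fixed `x`.
  obtain ⟨x, hx⟩ := h.prod_right_ae.exists
  refine ((integrable_const (c * Real.log (2 + ‖x‖))).add hx.norm).mono'
    (measurable_logWeight _ _).aestronglyMeasurable (Eventually.of_forall fun y => ?_)
  rw [Real.norm_of_nonneg (logWeight_nonneg hc y)]
  simp only [logWeight, coulombKernel, if_true, norm_mul, norm_neg, Real.norm_of_nonneg hc.le,
    Pi.add_apply]
  rw [← mul_add]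
  gcongr
  have hx0 : 0 ≤ Real.log (2 + ‖x‖) := Real.log_nonneg (by linarith [norm_nonneg x])
  have hy : ‖y‖ ≤ ‖x‖ + ‖x - y‖ := by
    simpa [norm_sub_rev] using norm_add_le x (y - x)
  rcases le_total ‖x - y‖ 1 with h1 | h1
  · calc Real.log (1 + ‖y‖) ≤ Real.log (2 + ‖x‖) := by
          apply Real.log_le_log (by positivity); linarith
      _ ≤ _ := by linarith [norm_nonneg (Real.log ‖x - y‖)]
  · rw [Real.norm_of_nonneg (Real.log_nonneg h1), ← Real.log_mul (by positivity) (by positivity)]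
    apply Real.log_le_log (by positivity)
    nlinarith [norm_nonneg x]

/-- The product result with a Dirac mass as second factor. The point is that a bounded density gives
a convergent potential at every `x`, in particular at the point charges, and not only almost
everywhere. -/
theorem integrable_coulombKernel_sub {d : ℕ} (hd : 2 ≤ d) {c : ℝ} (hc : 0 < c) {μ : Measure (Rd d)}
    [IsFiniteMeasure μ] {L : ℝ≥0} (hL : μ ≤ L • (volume : Measure (Rd d)))
    (hμ : Integrable (logWeight d c) μ) (x : Rd d) :
    Integrable (fun y => coulombKernel d c (x - y)) μ := by
  have h := integrable_coulombKernel_prod (ν := Measure.dirac x) hd hc hL hμ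
    (integrable_dirac (by finiteness))
  rw [Measure.prod_dirac, integrable_map_measure (measurable_coulombKernel_sub d c).aestronglyMeasurable
    (by fun_prop)] at h
  exact h.congr (Eventually.of_forall fun y => coulombKernel_sub_comm d c _ _)

/-! ### The heat kernel and Gaussian measures -/

/-- The heat kernel as a function of time and distance. -/
noncomputable def heatRadius (d : ℕ) (t r : ℝ) : ℝ :=
  (4 * Real.pi * t) ^ (-(d / 2 : ℝ)) * Real.exp (-r ^ 2 / (4 * t))

/-- The heat kernel. -/
noncomputable def heat (d : ℕ) (t : ℝ) (x : Rd d) : ℝ := heatRadius d t ‖x‖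

theorem heatRadius_pos (d : ℕ) {t : ℝ} (ht : 0 < t) (r : ℝ) : 0 < heatRadius d t r := by
  unfold heatRadius
  have := Real.pi_pos
  positivity

theorem heat_pos {d : ℕ} {t : ℝ} (ht : 0 < t) (x : Rd d) : 0 < heat d t x :=
  heatRadius_pos d ht _

theorem heat_le {d : ℕ} {t : ℝ} (ht : 0 < t) (x : Rd d) :
    heat d t x ≤ (4 * Real.pi * t) ^ (-(d / 2 : ℝ)) := by
  unfold heat heatRadius
  have := Real.pi_pos
  refine mul_le_of_le_one_right (by positivity) (Real.exp_le_one_iff.2 ?_)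
  rw [neg_div]
  exact neg_nonpos.2 (by positivity)

theorem measurable_heat (d : ℕ) (t : ℝ) : Measurable (heat d t) := by
  unfold heat heatRadius
  fun_prop

theorem measurable_heat_uncurry (d : ℕ) : Measurable fun p : ℝ × Rd d => heat d p.1 p.2 := by
  unfold heat heatRadius
  fun_prop

theorem measurable_heatRadius (d : ℕ) (r : ℝ) : Measurable fun t => heatRadius d t r := by
  unfold heatRadius
  fun_prop

theorem integral_exp_neg_mul_sq_norm {d : ℕ} {b : ℝ} (hb : 0 < b) :
    ∫ z : Rd d, Real.exp (-b * ‖z‖ ^ 2) = (Real.pi / b) ^ (d / 2 : ℝ) := by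
  simpa using GaussianFourier.integral_rexp_neg_mul_sq_norm (V := Rd d) hb

theorem integral_heat {d : ℕ} {t : ℝ} (ht : 0 < t) : ∫ x : Rd d, heat d t x = 1 := by
  have hp := Real.pi_pos
  have h : ∀ x : Rd d, heat d t x =
      (4 * Real.pi * t) ^ (-(d / 2 : ℝ)) * Real.exp (-(1 / (4 * t)) * ‖x‖ ^ 2) := by
    intro x
    unfold heat heatRadius
    congr 2
    ring
  simp_rw [h]
  rw [integral_const_mul, integral_exp_neg_mul_sq_norm (by positivity),
    show Real.pi / (1 / (4 * t)) = 4 * Real.pi * t by field_simp,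
    ← Real.rpow_add (by positivity)]
  simp

theorem integrable_heat {d : ℕ} {t : ℝ} (ht : 0 < t) : Integrable (heat d t) :=
  Integrable.of_integral_ne_zero (by rw [integral_heat ht]; exact one_ne_zero)

/-- Completing the square in `z`. The second factor on the right has integral one in `z`, so this is
the semigroup law before integration. -/
theorem heat_mul_heat {d : ℕ} {s t : ℝ} (hs : 0 < s) (ht : 0 < t) (x z : Rd d) :
    heat d s (x - z) * heat d t z =
      heat d (s + t) x * heat d (s * t / (s + t)) (z - (t / (s + t)) • x) := by
  have hp := Real.pi_pos
  unfold heat heatRadius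
  have h1 : (4 * Real.pi * s) ^ (-(d / 2 : ℝ)) * (4 * Real.pi * t) ^ (-(d / 2 : ℝ)) =
      (4 * Real.pi * (s + t)) ^ (-(d / 2 : ℝ)) *
        (4 * Real.pi * (s * t / (s + t))) ^ (-(d / 2 : ℝ)) := by
    rw [← Real.mul_rpow (by positivity) (by positivity),
      ← Real.mul_rpow (by positivity) (by positivity)]
    congr 1
    field_simp
  have h2 : Real.exp (-‖x - z‖ ^ 2 / (4 * s)) * Real.exp (-‖z‖ ^ 2 / (4 * t)) =
      Real.exp (-‖x‖ ^ 2 / (4 * (s + t))) *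
        Real.exp (-‖z - (t / (s + t)) • x‖ ^ 2 / (4 * (s * t / (s + t)))) := by
    rw [← Real.exp_add, ← Real.exp_add, norm_sub_sq_real, norm_sub_sq_real, norm_smul,
      inner_smul_right, real_inner_comm z x, Real.norm_of_nonneg (by positivity)]
    congr 1
    field_simp
    ring
  rw [mul_mul_mul_comm, h1, h2, mul_mul_mul_comm]

/-- The Gaussian measure with the heat kernel at time `t` as its density. -/
noncomputable def heatMeasure (d : ℕ) (t : ℝ) : Measure (Rd d) :=
  volume.withDensity fun x => ENNReal.ofReal (heat d t x)

theorem integral_heatMeasure {d : ℕ} {t : ℝ} (ht : 0 < t) (f : Rd d → ℝ) :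
    ∫ z, f z ∂heatMeasure d t = ∫ z, heat d t z * f z := by
  unfold heatMeasure
  rw [integral_withDensity_eq_integral_toReal_smul (measurable_heat d t).ennreal_ofReal
    (Eventually.of_forall fun _ => ENNReal.ofReal_lt_top)]
  simp [ENNReal.toReal_ofReal (heat_pos ht _).le]

theorem integrable_heatMeasure_iff {d : ℕ} {t : ℝ} (ht : 0 < t) {f : Rd d → ℝ} :
    Integrable f (heatMeasure d t) ↔ Integrable fun z => heat d t z * f z := by
  unfold heatMeasure
  rw [integrable_withDensity_iff_integrable_smul' (measurable_heat d t).ennreal_ofReal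
    (Eventually.of_forall fun _ => ENNReal.ofReal_lt_top)]
  simp [ENNReal.toReal_ofReal (heat_pos ht _).le]

theorem isProbabilityMeasure_heatMeasure {d : ℕ} {t : ℝ} (ht : 0 < t) :
    IsProbabilityMeasure (heatMeasure d t) := by
  refine ⟨?_⟩
  unfold heatMeasure
  rw [withDensity_apply _ MeasurableSet.univ, Measure.restrict_univ,
    ← ofReal_integral_eq_lintegral_ofReal (integrable_heat ht)
      (Eventually.of_forall fun x => (heat_pos ht x).le), integral_heat ht, ENNReal.ofReal_one]

theorem heatMeasure_le {d : ℕ} {t : ℝ} (ht : 0 < t) :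
    heatMeasure d t ≤ ((4 * Real.pi * t) ^ (-(d / 2 : ℝ))).toNNReal • (volume : Measure (Rd d)) := by
  refine (withDensity_mono (Eventually.of_forall fun x =>
    ENNReal.ofReal_le_ofReal (heat_le ht x))).trans ?_
  rw [withDensity_const]
  rfl

theorem heatMeasure_absolutelyContinuous (d : ℕ) (t : ℝ) : heatMeasure d t ≪ volume :=
  withDensity_absolutelyContinuous _ _

theorem heat_smul {d : ℕ} {r : ℝ} (hr : 0 < r) (x : Rd d) :
    heat d (r ^ 2) (r • x) = (r ^ d)⁻¹ * heat d 1 x := by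
  have hp := Real.pi_pos
  unfold heat heatRadius
  rw [norm_smul, Real.norm_of_nonneg hr.le, Real.mul_rpow (by positivity) (by positivity), mul_one,
    ← Real.rpow_natCast r 2, ← Real.rpow_mul hr.le,
    show ((2 : ℕ) : ℝ) * -(d / 2 : ℝ) = -(d : ℝ) by push_cast; ring, Real.rpow_neg hr.le,
    Real.rpow_natCast, Real.rpow_natCast]
  have : -(r * ‖x‖) ^ 2 / (4 * r ^ 2) = -‖x‖ ^ 2 / (4 * 1) := by field_simp
  rw [this]
  ring

theorem integral_heatMeasure_scale {d : ℕ} {r : ℝ} (hr : 0 < r) (f : Rd d → ℝ) :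
    ∫ z, f z ∂heatMeasure d (r ^ 2) = ∫ z, f (r • z) ∂heatMeasure d 1 := by
  rw [integral_heatMeasure (by positivity), integral_heatMeasure one_pos]
  have h := Measure.integral_comp_smul_of_nonneg (volume : Measure (Rd d))
    (fun z => heat d (r ^ 2) z * f z) r (hR := hr.le)
  simp only [finrank_euclideanSpace_fin, smul_eq_mul, heat_smul hr] at h
  have h' : (r ^ d) ≠ 0 := by positivity
  calc _ = r ^ d * ((r ^ d)⁻¹ * ∫ x, heat d (r ^ 2) x * f x) := by field_simp
    _ = _ := by
      rw [← h, ← integral_const_mul]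
      congr 1; ext z; field_simp

theorem integrable_heatMeasure_scale {d : ℕ} {r : ℝ} (hr : 0 < r) {f : Rd d → ℝ} :
    Integrable f (heatMeasure d (r ^ 2)) ↔ Integrable (fun z => f (r • z)) (heatMeasure d 1) := by
  rw [integrable_heatMeasure_iff (by positivity), integrable_heatMeasure_iff one_pos,
    ← integrable_comp_smul_iff volume _ hr.ne']
  simp only [heat_smul hr, mul_assoc]
  rw [integrable_const_mul_iff (IsUnit.mk0 _ (by positivity))]

theorem integral_heat_sub_heatMeasure {d : ℕ} {s t : ℝ} (hs : 0 < s) (ht : 0 < t) (x : Rd d) :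
    ∫ z, heat d s (x - z) ∂heatMeasure d t = heat d (s + t) x := by
  rw [integral_heatMeasure ht]
  simp_rw [mul_comm (heat d t _), heat_mul_heat hs ht]
  rw [integral_const_mul, integral_sub_right_eq_self (fun z => heat d (s * t / (s + t)) z),
    integral_heat (by positivity), mul_one]

theorem integrable_norm_heatMeasure (d : ℕ) : Integrable (fun z => ‖z‖) (heatMeasure d 1) := by
  -- The heat kernel at time `2` absorbs the first moment: `|z| exp(-|z|²/4) ≤ 4 exp(-|z|²/8)`.
  have h2 : Integrable (fun z : Rd d => (4 * 2 ^ (d / 2 : ℝ)) * heat d 2 z) :=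
    (integrable_heat two_pos).const_mul _
  rw [integrable_heatMeasure_iff one_pos]
  refine h2.mono' ((measurable_heat d 1).mul measurable_norm).aestronglyMeasurable
    (Eventually.of_forall fun z => ?_)
  have hp := Real.pi_pos
  rw [Real.norm_of_nonneg (mul_nonneg (heat_pos one_pos z).le (norm_nonneg z))]
  unfold heat heatRadius
  have h3 : ‖z‖ ≤ 4 * Real.exp (‖z‖ ^ 2 / 8) := by
    have := Real.add_one_le_exp (‖z‖ ^ 2 / 8)
    nlinarith [sq_nonneg (‖z‖ - 2)]
  have h4 : (4 * Real.pi * 2) ^ (-(d / 2 : ℝ)) =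
      (4 * Real.pi * 1) ^ (-(d / 2 : ℝ)) * (2 ^ (d / 2 : ℝ))⁻¹ := by
    rw [mul_one, Real.mul_rpow (by positivity) (by positivity), Real.rpow_neg two_pos.le]
  have h5 : Real.exp (-‖z‖ ^ 2 / (4 * 1)) * Real.exp (‖z‖ ^ 2 / 8) =
      Real.exp (-‖z‖ ^ 2 / (4 * 2)) := by
    rw [← Real.exp_add]; ring_nf
  rw [h4, ← h5]
  have h6 : (2 : ℝ) ^ (d / 2 : ℝ) ≠ 0 := by positivity
  have : ∀ A B C D : ℝ, D ≠ 0 → 4 * D * (A * D⁻¹ * (B * C)) = A * B * (4 * C) := by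
    intro A B C D hD; field_simp
  rw [this _ _ _ _ h6]
  gcongr

theorem integrable_logWeight_heatMeasure {d : ℕ} {c t : ℝ} (hc : 0 < c) (ht : 0 < t) :
    Integrable (logWeight d c) (heatMeasure d t) := by
  have h1 : Integrable (fun z => c * ‖z‖) (heatMeasure d t) := by
    rw [← Real.sq_sqrt ht.le, integrable_heatMeasure_scale (Real.sqrt_pos.2 ht)]
    simp only [norm_smul]
    exact ((integrable_norm_heatMeasure d).const_mul _).const_mul _
  refine h1.mono' (measurable_logWeight d c).aestronglyMeasurable (Eventually.of_forall fun z => ?_)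
  rw [Real.norm_of_nonneg (logWeight_nonneg hc z)]
  unfold logWeight
  split_ifs
  · have := Real.log_le_sub_one_of_pos (show 0 < 1 + ‖z‖ by positivity)
    gcongr; linarith
  · positivity

theorem integrable_coulombKernel_sub_heatMeasure {d : ℕ} (hd : 2 ≤ d) {c t : ℝ} (hc : 0 < c)
    (ht : 0 < t) (x : Rd d) :
    Integrable (fun z => coulombKernel d c (x - z)) (heatMeasure d t) :=
  have := isProbabilityMeasure_heatMeasure (d := d) ht
  integrable_coulombKernel_sub hd hc (heatMeasure_le ht) (integrable_logWeight_heatMeasure hc ht) x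

/-! ### The Coulomb kernel as a time integral of heat kernels -/

/-- With `k = π r²` and `y = 1/(4πs)` the heat kernel is `y^{d/2} exp(-k y)`. Replacing `y` by `1 +
y` costs a factor `exp k` and allows `y^{d/2} ≤ (1 + y)^d`, which the exponential series dominates.
The bound is uniform in `s`, so nothing blows up as `s → 0` away from the origin. -/
theorem heatRadius_le {d : ℕ} {s r : ℝ} (hs : 0 < s) (hr : 0 < r) :
    heatRadius d s r ≤ d.factorial * Real.exp (Real.pi * r ^ 2) / (Real.pi * r ^ 2) ^ d := by
  have hp := Real.pi_pos
  set k := Real.pi * r ^ 2 with hk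
  have hk0 : 0 < k := by positivity
  set y := (4 * Real.pi * s)⁻¹ with hy
  have hy0 : 0 < y := by positivity
  have h1 : (4 * Real.pi * s) ^ (-(d / 2 : ℝ)) ≤ (1 + y) ^ d := by
    rw [Real.rpow_neg (by positivity), ← Real.inv_rpow (by positivity), ← Real.rpow_natCast]
    calc y ^ (d / 2 : ℝ) ≤ (1 + y) ^ (d / 2 : ℝ) :=
          Real.rpow_le_rpow hy0.le (by linarith) (by positivity)
      _ ≤ _ := Real.rpow_le_rpow_of_exponent_le (by linarith) (by
          have : (0 : ℝ) ≤ d := Nat.cast_nonneg d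
          linarith)
  have h2 : -r ^ 2 / (4 * s) = k - k * (1 + y) := by
    rw [hk, hy]; field_simp; ring
  have h3 := Real.pow_div_factorial_le_exp (k * (1 + y)) (by positivity) d
  unfold heatRadius
  rw [h2, Real.exp_sub, le_div_iff₀ (by positivity)]
  have h4 : (0 : ℝ) < d.factorial := by exact_mod_cast d.factorial_pos
  rw [div_le_iff₀ h4, mul_pow] at h3
  calc (4 * Real.pi * s) ^ (-(d / 2 : ℝ)) * (Real.exp k / Real.exp (k * (1 + y))) * k ^ d
      ≤ (1 + y) ^ d * (Real.exp k / Real.exp (k * (1 + y))) * k ^ d := by gcongr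
    _ = Real.exp k / Real.exp (k * (1 + y)) * (k ^ d * (1 + y) ^ d) := by ring
    _ ≤ Real.exp k / Real.exp (k * (1 + y)) * (Real.exp (k * (1 + y)) * d.factorial) := by gcongr
    _ = _ := by field_simp

theorem integrableOn_heatRadius {d : ℕ} {r : ℝ} (hr : 0 < r) {a b : ℝ} (ha : 0 ≤ a) :
    IntegrableOn (fun s => heatRadius d s r) (Set.Ioc a b) := by
  refine Measure.integrableOn_of_bounded
    (M := d.factorial * Real.exp (Real.pi * r ^ 2) / (Real.pi * r ^ 2) ^ d)
    measure_Ioc_lt_top.ne (measurable_heatRadius d r).aestronglyMeasurable ?_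
  refine (ae_restrict_iff' measurableSet_Ioc).2 (Eventually.of_forall fun s hs => ?_)
  have hs0 : 0 < s := ha.trans_lt hs.1
  rw [Real.norm_of_nonneg (heatRadius_pos d hs0 r).le]
  exact heatRadius_le hs0 hr

/-- The heat kernel, renormalized in dimension two so as to be integrable in time. -/
noncomputable def heatDiff (d : ℕ) (s r : ℝ) : ℝ :=
  heatRadius d s r - if d = 2 then heatRadius d s 1 else 0

theorem measurable_heatDiff (d : ℕ) : Measurable fun p : ℝ × ℝ => heatDiff d p.1 p.2 := by
  unfold heatDiff heatRadius
  split_ifs <;> fun_prop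

/-- Small times are harmless since the heat kernel is bounded there at a fixed positive distance. At
large times the decay `s^{-d/2}` suffices for `d ≥ 3`; for `d = 2` it is the borderline `1/s`, and
subtracting the value at distance `1` cancels this leading term and leaves `s^{-2}`. -/
theorem integrableOn_heatDiff {d : ℕ} (hd : 2 ≤ d) {r : ℝ} (hr : 0 < r) :
    IntegrableOn (fun s => heatDiff d s r) (Set.Ioi 0) := by
  have hp := Real.pi_pos
  have hm : Measurable fun s => heatDiff d s r :=
    (measurable_heatDiff d).comp (measurable_id.prodMk measurable_const)
  rw [← Set.Ioc_union_Ioi_eq_Ioi (zero_le_one' ℝ)]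
  refine IntegrableOn.union ?_ ?_
  · refine (integrableOn_heatRadius hr le_rfl).sub ?_
    split_ifs
    · exact integrableOn_heatRadius one_pos le_rfl
    · exact integrableOn_zero
  · by_cases h2 : d = 2
    · subst h2
      have hi : IntegrableOn (fun s : ℝ => |r ^ 2 - 1| * s ^ (-2 : ℝ)) (Set.Ioi 1) :=
        (integrableOn_Ioi_rpow_of_lt (by norm_num) one_pos).const_mul _
      refine hi.mono' hm.aestronglyMeasurable ?_
      refine (ae_restrict_iff' measurableSet_Ioi).2 (Eventually.of_forall fun s hs => ?_)
      have hs0 : (0 : ℝ) < s := one_pos.trans hs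
      have h1 : |Real.exp (-r ^ 2 / (4 * s)) - Real.exp (-1 ^ 2 / (4 * s))| ≤
          |r ^ 2 - 1| / (4 * s) := by
        have key : ∀ a b : ℝ, 0 ≤ a → a ≤ b → |Real.exp (-a) - Real.exp (-b)| ≤ |a - b| := by
          intro a b ha hab
          rw [abs_of_nonneg (by simpa using hab), abs_of_nonpos (by linarith)]
          have h2 : Real.exp (-b) = Real.exp (-a) * Real.exp (a - b) := by
            rw [← Real.exp_add]; ring_nf
          have h3 := Real.add_one_le_exp (a - b)
          have h4 : Real.exp (-a) ≤ 1 := Real.exp_le_one_iff.2 (by linarith)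
          have h5 := Real.exp_pos (-a)
          rw [h2]
          nlinarith
        have e1 : -r ^ 2 / (4 * s) = -(r ^ 2 / (4 * s)) := by ring
        have e2 : -1 ^ 2 / (4 * s) = -(1 / (4 * s)) := by ring
        have e3 : |r ^ 2 - 1| / (4 * s) = |r ^ 2 / (4 * s) - 1 / (4 * s)| := by
          rw [← sub_div, abs_div, abs_of_pos (show 0 < 4 * s by positivity)]
        rw [e1, e2, e3]
        rcases le_total (r ^ 2 / (4 * s)) (1 / (4 * s)) with h | h
        · exact key _ _ (by positivity) h
        · rw [abs_sub_comm, abs_sub_comm (r ^ 2 / (4 * s))]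
          exact key _ _ (by positivity) h
      simp only [heatDiff, heatRadius, if_true]
      rw [← mul_sub, norm_mul, Real.norm_of_nonneg (by positivity)]
      have h3 : (4 * Real.pi * s) ^ (-(((2 : ℕ) : ℝ) / 2)) = (4 * Real.pi * s)⁻¹ := by
        norm_num [Real.rpow_neg_one]
      have h4 : s ^ (-2 : ℝ) = (s ^ 2)⁻¹ := by
        rw [Real.rpow_neg hs0.le]; norm_cast
      rw [h3, h4]
      calc _ ≤ (4 * Real.pi * s)⁻¹ * (|r ^ 2 - 1| / (4 * s)) := by gcongr; exact h1
        _ = (|r ^ 2 - 1| * (s ^ 2)⁻¹) * (16 * Real.pi)⁻¹ := by field_simp; ring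
        _ ≤ _ := mul_le_of_le_one_right (by positivity) (inv_le_one_of_one_le₀ (by
            nlinarith [Real.pi_gt_three]))
    · have hd3 : (3 : ℝ) ≤ d := by exact_mod_cast (show 3 ≤ d by omega)
      have hi : IntegrableOn (fun s : ℝ => (4 * Real.pi) ^ (-(d / 2 : ℝ)) * s ^ (-(d / 2 : ℝ)))
          (Set.Ioi 1) :=
        (integrableOn_Ioi_rpow_of_lt (by linarith) one_pos).const_mul _
      refine hi.mono' hm.aestronglyMeasurable ?_
      refine (ae_restrict_iff' measurableSet_Ioi).2 (Eventually.of_forall fun s hs => ?_)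
      have hs0 : (0 : ℝ) < s := one_pos.trans hs
      simp only [heatDiff, if_neg h2, sub_zero]
      rw [Real.norm_of_nonneg (heatRadius_pos d hs0 r).le, heatRadius,
        Real.mul_rpow (by positivity) hs0.le]
      refine mul_le_of_le_one_right (by positivity) (Real.exp_le_one_iff.2 ?_)
      rw [neg_div]
      exact neg_nonpos.2 (by positivity)

theorem heatRadius_scale {d : ℕ} {r s : ℝ} (hr : 0 < r) (hs : 0 < s) :
    heatRadius d (r ^ 2 * s) r = (r ^ d)⁻¹ * heatRadius d s 1 := by
  have hp := Real.pi_pos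
  unfold heatRadius
  rw [show 4 * Real.pi * (r ^ 2 * s) = r ^ 2 * (4 * Real.pi * s) by ring,
    Real.mul_rpow (by positivity) (by positivity), ← Real.rpow_natCast r 2, ← Real.rpow_mul hr.le,
    show ((2 : ℕ) : ℝ) * -(d / 2 : ℝ) = -(d : ℝ) by push_cast; ring, Real.rpow_neg hr.le,
    Real.rpow_natCast, Real.rpow_natCast]
  have : -r ^ 2 / (4 * (r ^ 2 * s)) = -1 ^ 2 / (4 * s) := by field_simp
  rw [this]
  ring

/-- A Frullani integral: `s` times the planar heat kernel is a function `f` of `s/r²` that increases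
from `0` to `1/(4π)`, so the integral is `(1/(4π)) log (1/r²)`. -/
theorem integral_heatDiff_two {r : ℝ} (hr : 0 < r) :
    ∫ s in Set.Ioi 0, heatDiff 2 s r = -(2 * Real.pi)⁻¹ * Real.log r := by
  have hp := Real.pi_pos
  let f : ℝ → ℝ := fun x => (4 * Real.pi)⁻¹ * Real.exp (-(4 * x)⁻¹)
  have hf : ∀ s ∈ Set.Ioi (0 : ℝ), s⁻¹ • (f ((r ^ 2)⁻¹ * s) - f (1 * s)) = heatDiff 2 s r := by
    intro s hs
    have hs0 : (0 : ℝ) < s := hs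
    simp only [f, heatDiff, heatRadius, if_true, smul_eq_mul]
    have h3 : (4 * Real.pi * s) ^ (-(((2 : ℕ) : ℝ) / 2)) = (4 * Real.pi * s)⁻¹ := by
      norm_num [Real.rpow_neg_one]
    rw [h3]
    have e1 : -(4 * ((r ^ 2)⁻¹ * s))⁻¹ = -r ^ 2 / (4 * s) := by field_simp
    have e2 : -(4 * (1 * s))⁻¹ = -1 ^ 2 / (4 * s) := by field_simp
    rw [e1, e2, mul_inv (4 * Real.pi) s]
    ring
  have hc : LocallyIntegrableOn f (Set.Ioi 0) := by
    refine ContinuousOn.locallyIntegrableOn ?_ measurableSet_Ioi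
    intro x hx
    have hx0 : (0 : ℝ) < x := hx
    apply ContinuousAt.continuousWithinAt
    have : 4 * x ≠ 0 := by positivity
    fun_prop (disch := assumption)
  have hL : Tendsto f (nhdsWithin 0 (Set.Ioi 0)) (nhds 0) := by
    have h1 : Tendsto (fun x : ℝ => (4 * x)⁻¹) (nhdsWithin 0 (Set.Ioi 0)) atTop := by
      simp_rw [mul_inv]
      exact tendsto_inv_nhdsGT_zero.const_mul_atTop (by norm_num)
    simpa [f] using (Real.tendsto_exp_neg_atTop_nhds_zero.comp h1).const_mul (4 * Real.pi)⁻¹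
  have hR : Tendsto f atTop (nhds (4 * Real.pi)⁻¹) := by
    have h1 : Tendsto (fun x : ℝ => (4 * x)⁻¹) atTop (nhds 0) :=
      (tendsto_id.const_mul_atTop (by norm_num : (0 : ℝ) < 4)).inv_tendsto_atTop
    have h2 := (Real.continuous_exp.tendsto _).comp h1.neg
    simpa [f, Function.comp_def] using h2.const_mul (4 * Real.pi)⁻¹
  have h := Frullani.integral_Ioi_eq hc (a := (r ^ 2)⁻¹) (b := 1) (by positivity) one_pos hL hR
    ((integrableOn_congr_fun hf measurableSet_Ioi).2 (integrableOn_heatDiff le_rfl hr))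
  rw [setIntegral_congr_fun measurableSet_Ioi hf] at h
  rw [h, one_div, inv_inv, Real.log_pow, smul_eq_mul]
  push_cast
  field_simp
  ring

/-- For `d ≥ 3` the substitution `s ↦ r² s` shows that the time integral is homogeneous of degree `2
- d` in `r`, so it suffices to match at `r = 1`. Only positivity of `κ` and its independence of `r`
matter later. -/
theorem exists_kernelRadius_eq_integral {d : ℕ} (hd : 2 ≤ d) {c : ℝ} (hc : 0 < c) :
    ∃ κ : ℝ, 0 < κ ∧ ∀ r, 0 < r →
      kernelRadius d c r = κ * ∫ s in Set.Ioi 0, heatDiff d s r := by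
  have hp := Real.pi_pos
  by_cases h2 : d = 2
  · subst h2
    refine ⟨2 * Real.pi * c, by positivity, fun r hr => ?_⟩
    rw [integral_heatDiff_two hr]
    simp only [kernelRadius, if_true]
    field_simp
  · set A := ∫ s in Set.Ioi 0, heatDiff d s 1 with hA
    have hA0 : 0 < A := by
      rw [hA, setIntegral_pos_iff_support_of_nonneg_ae]
      · refine (by simp : (0 : ℝ≥0∞) < volume (Set.Ioi (0 : ℝ))).trans_le (measure_mono ?_)
        intro s hs
        refine ⟨?_, hs⟩
        simp only [heatDiff, if_neg h2, sub_zero, Function.mem_support]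
        exact (heatRadius_pos d hs 1).ne'
      · refine (ae_restrict_iff' measurableSet_Ioi).2 (Eventually.of_forall fun s hs => ?_)
        simp only [heatDiff, if_neg h2, sub_zero]
        exact (heatRadius_pos d hs 1).le
      · exact integrableOn_heatDiff hd one_pos
    refine ⟨c / A, by positivity, fun r hr => ?_⟩
    have h := integral_comp_mul_left_Ioi (fun s => heatDiff d s r) 0 (show 0 < r ^ 2 by positivity)
    rw [mul_zero, setIntegral_congr_fun (g := fun s => (r ^ d)⁻¹ * heatDiff d s 1) measurableSet_Ioi
      (fun s hs => by simp only [heatDiff, if_neg h2, sub_zero]; exact heatRadius_scale hr hs),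
      integral_const_mul, ← hA, smul_eq_mul, eq_comm, inv_mul_eq_iff_eq_mul₀ (by positivity)] at h
    rw [h, kernelRadius, if_neg h2, show r ^ d = r ^ 2 * r ^ (d - 2) by rw [← pow_add]; congr; omega]
    field_simp

theorem heatRadius_antitone {d : ℕ} {s : ℝ} (hs : 0 < s) {r r' : ℝ} (hr : 0 ≤ r) (h : r ≤ r') :
    heatRadius d s r' ≤ heatRadius d s r := by
  have hp := Real.pi_pos
  unfold heatRadius
  gcongr

/-- For fixed `r` the integrand has a constant sign in `s`, by monotonicity of the heat kernel in
the distance. Integrability of `g` in space therefore already gives the joint integrability that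
Fubini needs. -/
theorem integral_norm_heatDiff (d : ℕ) {r : ℝ} (hr : 0 < r) :
    ∫ s in Set.Ioi 0, ‖heatDiff d s r‖ = ‖∫ s in Set.Ioi 0, heatDiff d s r‖ := by
  by_cases h : d = 2 ∧ 1 ≤ r
  · have hs : ∀ s ∈ Set.Ioi (0 : ℝ), heatDiff d s r ≤ 0 := by
      intro s hs
      simp only [heatDiff, if_pos h.1]
      linarith [heatRadius_antitone (d := d) hs zero_le_one h.2]
    rw [Real.norm_of_nonpos (setIntegral_nonpos measurableSet_Ioi hs), ← integral_neg]
    exact setIntegral_congr_fun measurableSet_Ioi fun s h' => Real.norm_of_nonpos (hs s h')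
  · have hs : ∀ s ∈ Set.Ioi (0 : ℝ), 0 ≤ heatDiff d s r := by
      intro s hs
      unfold heatDiff
      split_ifs with h2
      · have : r ≤ 1 := by by_contra h'; exact h ⟨h2, by linarith⟩
        linarith [heatRadius_antitone (d := d) hs hr.le this]
      · linarith [heatRadius_pos d hs r]
    rw [Real.norm_of_nonneg (setIntegral_nonneg measurableSet_Ioi hs)]
    exact setIntegral_congr_fun measurableSet_Ioi fun s h' => Real.norm_of_nonneg (hs s h')

/-- Telescoping: over `(0, T)` the integral equals that of the heat kernel over `(0, t)` minus that
over `(T, T + t)`, and the latter vanishes as `T → ∞` by decay in time. -/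
theorem integral_heatRadius_sub_shift {d : ℕ} (hd : 2 ≤ d) {r t : ℝ} (hr : 0 < r) (ht : 0 < t)
    (hi : IntegrableOn (fun s => heatRadius d s r - heatRadius d (s + t) r) (Set.Ioi 0)) :
    ∫ s in Set.Ioi 0, (heatRadius d s r - heatRadius d (s + t) r) =
      ∫ s in Set.Ioc 0 t, heatRadius d s r := by
  have hp := Real.pi_pos
  have hii : ∀ a b : ℝ, 0 ≤ a → a ≤ b → IntervalIntegrable (fun s => heatRadius d s r) volume a b :=
    fun a b ha hab => (intervalIntegrable_iff_integrableOn_Ioc_of_le hab).2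
      (integrableOn_heatRadius hr ha)
  have h1 := intervalIntegral_tendsto_integral_Ioi 0 hi tendsto_id
  refine tendsto_nhds_unique h1 ?_
  have h2 : ∀ T : ℝ, 0 < T → ∫ s in (0 : ℝ)..T, (heatRadius d s r - heatRadius d (s + t) r) =
      (∫ s in Set.Ioc 0 t, heatRadius d s r) - ∫ s in T..(T + t), heatRadius d s r := by
    intro T hT
    rw [intervalIntegral.integral_sub (hii 0 T le_rfl hT.le) ((by
        simpa using (hii (0 + t) (T + t) (by linarith) (by linarith)).comp_add_right t)),
      intervalIntegral.integral_comp_add_right (fun s => heatRadius d s r), zero_add,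
      ← intervalIntegral.integral_of_le ht.le,
      intervalIntegral.integral_interval_sub_interval_comm (hii 0 T le_rfl hT.le)
        (hii t (T + t) ht.le (by linarith)) (hii 0 t le_rfl ht.le)]
  have h3 : Tendsto (fun T : ℝ => ∫ s in T..(T + t), heatRadius d s r) atTop (nhds 0) := by
    have h4 : Tendsto (fun T : ℝ => (4 * Real.pi * T) ^ (-(d / 2 : ℝ)) * t) atTop (nhds 0) := by
      have : Tendsto (fun T : ℝ => 4 * Real.pi * T) atTop atTop :=
        tendsto_id.const_mul_atTop (by positivity)
      have hd' : (0 : ℝ) < d / 2 := by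
        have : (0 : ℝ) < d := by exact_mod_cast (by omega : 0 < d)
        positivity
      simpa using ((tendsto_rpow_neg_atTop hd').comp this).mul_const t
    refine squeeze_zero_norm' ?_ h4
    filter_upwards [eventually_gt_atTop 0] with T hT
    have := intervalIntegral.norm_integral_le_of_norm_le_const (a := T) (b := T + t)
      (f := fun s => heatRadius d s r) (C := (4 * Real.pi * T) ^ (-(d / 2 : ℝ))) (by
        intro s hs
        rw [Set.uIoc_of_le (by linarith)] at hs
        have hs0 : 0 < s := hT.trans hs.1
        rw [Real.norm_of_nonneg (heatRadius_pos d hs0 r).le]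
        calc heatRadius d s r ≤ (4 * Real.pi * s) ^ (-(d / 2 : ℝ)) := by
              unfold heatRadius
              refine mul_le_of_le_one_right (by positivity) (Real.exp_le_one_iff.2 ?_)
              rw [neg_div]
              exact neg_nonpos.2 (by positivity)
          _ ≤ _ := Real.rpow_le_rpow_of_nonpos (by positivity) (by have := hs.1.le; gcongr)
              (neg_nonpos.2 (by positivity)))
    simpa [abs_of_pos ht] using this
  have h5 := (tendsto_const_nhds (x := ∫ s in Set.Ioc 0 t, heatRadius d s r)).sub h3
  rw [sub_zero] at h5
  refine h5.congr' ?_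
  filter_upwards [eventually_gt_atTop 0] with T hT
  exact (h2 T hT).symm

/-- Averaging the Coulomb kernel over a Gaussian lowers it, by a time integral of heat kernels. -/
theorem exists_integral_coulombKernel_heatMeasure {d : ℕ} (hd : 2 ≤ d) {c : ℝ} (hc : 0 < c) :
    ∃ κ : ℝ, 0 < κ ∧ ∀ t, 0 < t → ∀ x : Rd d, x ≠ 0 →
      ∫ z, coulombKernel d c (x - z) ∂heatMeasure d t =
        coulombKernel d c x - κ * ∫ s in Set.Ioc 0 t, heat d s x := by
  obtain ⟨κ, hκ, hk⟩ := exists_kernelRadius_eq_integral hd hc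
  refine ⟨κ, hκ, fun t ht x hx => ?_⟩
  have := nontrivial_Rd hd
  have hprob := isProbabilityMeasure_heatMeasure (d := d) ht
  have hx0 : 0 < ‖x‖ := norm_pos_iff.2 hx
  have hg : ∀ y : Rd d, y ≠ 0 →
      coulombKernel d c y = κ * ∫ s in Set.Ioi 0, heatDiff d s ‖y‖ := fun y hy =>
    hk ‖y‖ (norm_pos_iff.2 hy)
  have hae : ∀ᵐ z ∂heatMeasure d t, x - z ≠ 0 := by
    refine (heatMeasure_absolutelyContinuous d t).ae_le ?_
    filter_upwards [Measure.ae_ne volume x] with z hz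
    exact sub_ne_zero.2 hz.symm
  have hF : Integrable (fun p : Rd d × ℝ => heatDiff d p.2 ‖x - p.1‖)
      ((heatMeasure d t).prod (volume.restrict (Set.Ioi 0))) := by
    have hm : Measurable fun p : Rd d × ℝ => heatDiff d p.2 ‖x - p.1‖ :=
      (measurable_heatDiff d).comp (measurable_snd.prodMk (measurable_const.sub measurable_fst).norm)
    rw [integrable_prod_iff hm.aestronglyMeasurable]
    constructor
    · filter_upwards [hae] with z hz
      exact integrableOn_heatDiff hd (norm_pos_iff.2 hz)
    · refine ((integrable_coulombKernel_sub_heatMeasure hd hc ht x).norm.const_mul κ⁻¹).congr ?_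
      filter_upwards [hae] with z hz
      rw [integral_norm_heatDiff d (norm_pos_iff.2 hz), hg _ hz, norm_mul, Real.norm_of_nonneg hκ.le,
        inv_mul_cancel_left₀ hκ.ne']
  have hswap := integral_integral_swap (f := fun z s => heatDiff d s ‖x - z‖) hF
  have h1 : ∫ z, coulombKernel d c (x - z) ∂heatMeasure d t =
      κ * ∫ z, (∫ s in Set.Ioi 0, heatDiff d s ‖x - z‖) ∂heatMeasure d t := by
    rw [← integral_const_mul]
    refine integral_congr_ae ?_
    filter_upwards [hae] with z hz using hg _ hz
  -- By the semigroup law, averaging shifts time from `s` to `s + t`; the planar renormalization is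
  -- constant in space and later cancels in the difference.
  have h2 : ∀ s ∈ Set.Ioi (0 : ℝ), ∫ z, heatDiff d s ‖x - z‖ ∂heatMeasure d t =
      heatRadius d (s + t) ‖x‖ - if d = 2 then heatRadius d s 1 else 0 := by
    intro s hs
    have hi : Integrable (fun z => heat d s (x - z)) (heatMeasure d t) := by
      refine (integrable_const ((4 * Real.pi * s) ^ (-(d / 2 : ℝ)))).mono'
        ((measurable_heat d s).comp (measurable_const.sub measurable_id)).aestronglyMeasurable
        (Eventually.of_forall fun z => ?_)
      rw [Real.norm_of_nonneg (heat_pos hs _).le]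
      exact heat_le hs _
    have := integral_heat_sub_heatMeasure (d := d) hs ht x
    unfold heat at hi this
    unfold heatDiff
    rw [integral_sub hi (integrable_const _), integral_const, probReal_univ, one_smul, this]
  have h3 : IntegrableOn (fun s => heatRadius d (s + t) ‖x‖ - if d = 2 then heatRadius d s 1 else 0)
      (Set.Ioi 0) :=
    (integrableOn_congr_fun h2 measurableSet_Ioi).1 hF.integral_prod_right
  have h4 : ∀ s, heatDiff d s ‖x‖ -
      (heatRadius d (s + t) ‖x‖ - if d = 2 then heatRadius d s 1 else 0) =
      heatRadius d s ‖x‖ - heatRadius d (s + t) ‖x‖ := by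
    intro s; unfold heatDiff; ring
  have h5 := integral_sub (integrableOn_heatDiff hd hx0) h3
  have h6 := (integrableOn_heatDiff hd hx0).sub h3
  simp only [h4] at h5
  rw [integral_heatRadius_sub_shift hd hx0 ht (h6.congr (Eventually.of_forall h4))] at h5
  rw [h1, hswap, setIntegral_congr_fun measurableSet_Ioi h2, hg x hx]
  unfold heat
  rw [h5]
  ring

/-! ### Gaussian smoothing of absolutely continuous measures at small times -/

theorem continuous_integral_indicator_add {d : ℕ} {φ : Rd d → ℝ} (hφ : Continuous φ)
    (hs : HasCompactSupport φ) {O : Set (Rd d)} (hO : MeasurableSet O) :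
    Continuous fun z => ∫ y, O.indicator 1 (y + z) * φ y := by
  have h1 : LocallyIntegrable (O.indicator (1 : Rd d → ℝ)) :=
    (locallyIntegrable_const (1 : ℝ)).indicator hO
  have h2 : HasCompactSupport fun w => φ (-w) := hs.comp_homeomorph (Homeomorph.neg _)
  have h3 := h2.continuous_convolution_right (ContinuousLinearMap.mul ℝ ℝ) h1
    (hφ.comp continuous_neg)
  refine h3.congr fun z => ?_
  simp only [convolution, ContinuousLinearMap.mul_apply']
  rw [← integral_add_right_eq_self _ z]
  congr 1; ext y
  congr 2
  abel

/-- Translation is continuous on absolutely continuous finite measures. -/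
theorem tendsto_measureReal_translate {d : ℕ} {μ : Measure (Rd d)} [IsFiniteMeasure μ]
    (hμ : μ ≪ volume) {O : Set (Rd d)} (hO : MeasurableSet O) :
    Tendsto (fun z => μ.real {y | y + z ∈ O}) (nhds 0) (nhds (μ.real O)) := by
  set f : Rd d → ℝ := fun x => (μ.rnDeriv volume x).toReal with hf
  have hfi : Integrable f := Measure.integrable_toReal_rnDeriv
  have hm : ∀ z, MeasurableSet {y : Rd d | y + z ∈ O} := fun z =>
    (measurable_id.add_const z) hO
  have hT : ∀ z, μ.real {y | y + z ∈ O} = ∫ y, O.indicator 1 (y + z) * f y := by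
    intro z
    rw [← Measure.setIntegral_toReal_rnDeriv hμ, ← integral_indicator (hm z)]
    congr 1; ext y
    by_cases h : y + z ∈ O <;> simp [h, Set.indicator, hf]
  have h0 : μ.real O = μ.real {y | y + 0 ∈ O} := by simp
  rw [h0, Metric.tendsto_nhds]
  intro ε hε
  -- An `L¹` approximation of the density gives an error that is uniform in the translation `z`,
  -- because the indicator is at most one.
  obtain ⟨φ, hφs, hφi, hφc, hφint⟩ := hfi.exists_hasCompactSupport_integral_sub_le
    (show 0 < ε / 4 by positivity)
  have hi : ∀ (g : Rd d → ℝ), Integrable g → ∀ z, Integrable fun y => O.indicator 1 (y + z) * g y := by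
    intro g hg z
    refine hg.norm.mono' ((((measurable_const.indicator hO).comp
      (measurable_id.add_const z)).aestronglyMeasurable).mul hg.1) (Eventually.of_forall fun y => ?_)
    by_cases h : y + z ∈ O <;> simp [h]
  have hb : ∀ z, |(∫ y, O.indicator 1 (y + z) * f y) - ∫ y, O.indicator 1 (y + z) * φ y| ≤ ε / 4 := by
    intro z
    rw [← integral_sub (hi f hfi z) (hi φ hφint z)]
    refine (abs_integral_le_integral_abs).trans (le_trans (integral_mono_of_nonneg
      (Eventually.of_forall fun _ => abs_nonneg _) (hfi.sub hφint).norm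
      (Eventually.of_forall fun y => ?_)) hφi)
    by_cases h : y + z ∈ O <;> simp [h]
  have hc := (continuous_integral_indicator_add hφc hφs hO).tendsto 0
  rw [Metric.tendsto_nhds] at hc
  filter_upwards [hc (ε / 4) (by positivity)] with z hz
  rw [Real.dist_eq] at hz ⊢
  rw [hT, hT]
  have h1 := abs_le.1 (hb z)
  have h2 := abs_le.1 (hb 0)
  have h3 := abs_lt.1 hz
  rw [abs_lt]
  constructor <;> linarith

/-- The mass that the Gaussian of variance parameter `s` centred at `y` gives to `O`. -/
noncomputable def heatMass (d : ℕ) (O : Set (Rd d)) (s : ℝ) (y : Rd d) : ℝ :=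
  ∫ x in O, heat d s (x - y)

theorem measurable_heatMass {d : ℕ} (O : Set (Rd d)) :
    Measurable fun p : ℝ × Rd d => heatMass d O p.1 p.2 := by
  have h : StronglyMeasurable fun q : (ℝ × Rd d) × Rd d => heat d q.1.1 (q.2 - q.1.2) :=
    ((measurable_heat_uncurry d).comp (by fun_prop : Measurable fun q : (ℝ × Rd d) × Rd d =>
      (q.1.1, q.2 - q.1.2))).stronglyMeasurable
  exact (h.integral_prod_right' (ν := volume.restrict O)).measurable

/-- Rescaling moves `s` from the measure into a translation by `√s z` under a fixed Gaussian, so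
that `s → 0` becomes continuity of translations plus dominated convergence. -/
theorem heatMass_eq {d : ℕ} {O : Set (Rd d)} (hO : MeasurableSet O) {s : ℝ} (hs : 0 < s)
    (y : Rd d) : heatMass d O s y = ∫ z, O.indicator 1 (y + Real.sqrt s • z) ∂heatMeasure d 1 := by
  have h1 := integral_heatMeasure_scale (d := d) (Real.sqrt_pos.2 hs)
    (fun z => O.indicator (1 : Rd d → ℝ) (y + z))
  rw [Real.sq_sqrt hs.le, integral_heatMeasure hs] at h1
  rw [← h1, heatMass, ← integral_indicator hO, ← integral_add_left_eq_self _ y]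
  congr 1; ext z
  by_cases h : y + z ∈ O <;> simp [h]

theorem heatMass_nonneg {d : ℕ} (O : Set (Rd d)) {s : ℝ} (hs : 0 < s) (y : Rd d) :
    0 ≤ heatMass d O s y := integral_nonneg fun _ => (heat_pos hs _).le

theorem heatMass_le_one {d : ℕ} (O : Set (Rd d)) {s : ℝ} (hs : 0 < s) (y : Rd d) :
    heatMass d O s y ≤ 1 := by
  rw [heatMass, ← integral_heat (d := d) hs,
    ← integral_sub_right_eq_self (fun x => heat d s x) y]
  exact setIntegral_le_integral ((integrable_heat hs).comp_sub_right y)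
    (Eventually.of_forall fun _ => (heat_pos hs _).le)

theorem tendsto_integral_heatMass {d : ℕ} {μ : Measure (Rd d)} [IsFiniteMeasure μ]
    (hμ : μ ≪ volume) {O : Set (Rd d)} (hO : MeasurableSet O) :
    Tendsto (fun s => ∫ y, heatMass d O s y ∂μ) (nhdsWithin 0 (Set.Ioi 0)) (nhds (μ.real O)) := by
  have hp := isProbabilityMeasure_heatMeasure (d := d) one_pos
  have hm : ∀ z, MeasurableSet {y : Rd d | y + z ∈ O} := fun z =>
    (measurable_id.add_const z) hO
  have h1 : ∀ s ∈ Set.Ioi (0 : ℝ), ∫ z, μ.real {y | y + Real.sqrt s • z ∈ O} ∂heatMeasure d 1 =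
      ∫ y, heatMass d O s y ∂μ := by
    intro s hs
    simp_rw [heatMass_eq hO hs]
    have hi : Integrable (fun p : Rd d × Rd d => O.indicator (1 : Rd d → ℝ) (p.1 + Real.sqrt s • p.2))
        (μ.prod (heatMeasure d 1)) := by
      refine (integrable_const (1 : ℝ)).mono' ((measurable_const.indicator hO).comp
        (by fun_prop)).aestronglyMeasurable (Eventually.of_forall fun p => ?_)
      by_cases h : p.1 + Real.sqrt s • p.2 ∈ O <;> simp [h]
    rw [integral_integral_swap (f := fun y z => O.indicator (1 : Rd d → ℝ) (y + Real.sqrt s • z)) hi]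
    congr 1; ext z
    rw [← integral_indicator_one (hm _)]
    rfl
  have h2 : Tendsto (fun s => ∫ z, μ.real {y | y + Real.sqrt s • z ∈ O} ∂heatMeasure d 1)
      (nhdsWithin 0 (Set.Ioi 0)) (nhds (∫ _, μ.real O ∂heatMeasure d 1)) := by
    refine tendsto_integral_filter_of_dominated_convergence (fun _ => μ.real Set.univ) ?_ ?_
      (integrable_const _) ?_
    · refine Eventually.of_forall fun s => Measurable.aestronglyMeasurable ?_
      have : MeasurableSet {p : Rd d × Rd d | p.2 + Real.sqrt s • p.1 ∈ O} :=
        (by fun_prop : Measurable fun p : Rd d × Rd d => p.2 + Real.sqrt s • p.1) hO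
      exact (measurable_measure_prodMk_left this).ennreal_toReal
    · refine Eventually.of_forall fun s => Eventually.of_forall fun z => ?_
      rw [Real.norm_of_nonneg measureReal_nonneg]
      exact measureReal_mono (Set.subset_univ _)
    · refine Eventually.of_forall fun z => (tendsto_measureReal_translate hμ hO).comp ?_
      have : Continuous fun s : ℝ => Real.sqrt s • z := by fun_prop
      have h := this.tendsto 0
      rw [Real.sqrt_zero, zero_smul] at h
      exact h.mono_left nhdsWithin_le_nhds
  rw [integral_const, probReal_univ, one_smul] at h2
  exact h2.congr' (eventually_nhdsWithin_of_forall h1)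

/-! ### The time-integrated heat kernel -/

/-- The defect of the Gaussian average of a fundamental solution. -/
noncomputable def heatTime (d : ℕ) (t : ℝ) (x : Rd d) : ℝ := ∫ s in Set.Ioc 0 t, heat d s x

theorem measurable_heatTime (d : ℕ) (t : ℝ) : Measurable (heatTime d t) := by
  have h : StronglyMeasurable fun q : Rd d × ℝ => heat d q.2 q.1 :=
    ((measurable_heat_uncurry d).comp (by fun_prop : Measurable fun q : Rd d × ℝ =>
      (q.2, q.1))).stronglyMeasurable
  exact (h.integral_prod_right' (ν := volume.restrict (Set.Ioc 0 t))).measurable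

theorem heatTime_nonneg (d : ℕ) (t : ℝ) (x : Rd d) : 0 ≤ heatTime d t x :=
  setIntegral_nonneg measurableSet_Ioc fun _ hs => (heat_pos hs.1 _).le

theorem integrable_heat_prod (d : ℕ) (t : ℝ) :
    Integrable (fun p : ℝ × Rd d => heat d p.1 p.2) ((volume.restrict (Set.Ioc 0 t)).prod volume) := by
  rw [integrable_prod_iff (measurable_heat_uncurry d).aestronglyMeasurable]
  have h0 : ∀ᵐ s ∂(volume.restrict (Set.Ioc 0 t)), 0 < s :=
    (ae_restrict_iff' measurableSet_Ioc).2 (Eventually.of_forall fun s hs => hs.1)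
  constructor
  · filter_upwards [h0] with s hs using integrable_heat hs
  · refine (integrable_const (1 : ℝ)).congr ?_
    filter_upwards [h0] with s hs
    rw [← integral_heat (d := d) hs]
    congr 1; ext x
    rw [Real.norm_of_nonneg (heat_pos hs _).le]

theorem integrable_heatTime (d : ℕ) (t : ℝ) : Integrable (heatTime d t) :=
  (integrable_heat_prod d t).integral_prod_right

theorem integral_heatTime {d : ℕ} {t : ℝ} (ht : 0 < t) : ∫ x, heatTime d t x = t := by
  unfold heatTime
  rw [← integral_integral_swap (f := fun s x => heat d s x) (integrable_heat_prod d t),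
    setIntegral_congr_fun (g := fun _ => (1 : ℝ)) measurableSet_Ioc
      (fun s hs => integral_heat hs.1)]
  simp [ht.le]

theorem setIntegral_heatTime {d : ℕ} {t : ℝ} {O : Set (Rd d)} (y : Rd d) :
    ∫ x in O, heatTime d t (x - y) = ∫ s in Set.Ioc 0 t, heatMass d O s y := by
  unfold heatTime heatMass
  refine (integral_integral_swap (f := fun s x => heat d s (x - y)) ?_).symm
  have h : Integrable (fun p : ℝ × Rd d => heat d p.1 (p.2 - y))
      ((volume.restrict (Set.Ioc 0 t)).prod volume) := by
    have hmp : MeasurePreserving (Prod.map id fun x : Rd d => x - y)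
        ((volume.restrict (Set.Ioc 0 t)).prod volume) ((volume.restrict (Set.Ioc 0 t)).prod volume) :=
      (MeasurePreserving.id _).prod (measurePreserving_sub_right volume y)
    exact (hmp.integrable_comp (measurable_heat_uncurry d).aestronglyMeasurable).2
      (integrable_heat_prod d t)
  exact h.mono_measure (Measure.prod_mono le_rfl Measure.restrict_le_self)

/-- The defect of the averaged potential, integrated over `O`, becomes a time integral of smoothed
masses of `O`, whose limit as `s → 0` is known. -/
theorem integral_setIntegral_heatTime {d : ℕ} {t : ℝ} {μ : Measure (Rd d)} [IsFiniteMeasure μ]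
    (O : Set (Rd d)) :
    ∫ x in O, (∫ y, heatTime d t (x - y) ∂μ) =
      ∫ s in Set.Ioc 0 t, (∫ y, heatMass d O s y ∂μ) := by
  have h : Integrable (fun p : Rd d × Rd d => heatTime d t (p.1 - p.2))
      ((volume.restrict O).prod μ) :=
    integrable_comp_sub_prod_of_le (L := 1) (integrable_heatTime d t) (measurable_heatTime d t)
      (by rw [one_smul]; exact Measure.restrict_le_self)
  rw [integral_integral_swap (f := fun x y => heatTime d t (x - y)) h]
  simp_rw [setIntegral_heatTime]
  refine integral_integral_swap (f := fun y s => heatMass d O s y) ?_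
  refine (integrable_const (1 : ℝ)).mono' ((measurable_heatMass O).comp
    measurable_swap).aestronglyMeasurable ?_
  have h0 : ∀ᵐ s ∂(volume.restrict (Set.Ioc 0 t)), 0 < s :=
    (ae_restrict_iff' measurableSet_Ioc).2 (Eventually.of_forall fun s hs => hs.1)
  filter_upwards [Measure.quasiMeasurePreserving_snd.ae h0] with p hp
  rw [Function.uncurry, Real.norm_of_nonneg (heatMass_nonneg O hp _)]
  exact heatMass_le_one O hp _

/-! ### Coulomb potentials and the weak maximum principle -/

/-- The Coulomb potential of a measure. -/
noncomputable def potential (d : ℕ) (c : ℝ) (μ : Measure (Rd d)) (x : Rd d) : ℝ :=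
  ∫ y, coulombKernel d c (x - y) ∂μ

theorem measurable_potential (d : ℕ) (c : ℝ) (μ : Measure (Rd d)) [SFinite μ] :
    Measurable (potential d c μ) :=
  ((measurable_coulombKernel_sub d c).stronglyMeasurable.integral_prod_right' (ν := μ)).measurable

section Potential

variable {d : ℕ} {c : ℝ} {μ ν : Measure (Rd d)}

theorem integrable_kernelNear_prod (hd : 2 ≤ d) (hc : 0 < c) {R : ℝ} (hR : 0 < R)
    [IsFiniteMeasure μ] :
    Integrable (fun p : Rd d × Rd d => kernelNear d c R (p.1 - p.2)) (volume.prod μ) :=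
  integrable_comp_sub_prod_of_le (L := 1) (integrable_kernelNear hd hc hR)
    (measurable_kernelNear d c R) (by rw [one_smul])

theorem integrable_kernelFar_sub (hc : 0 < c) {R : ℝ} (hR : 1 ≤ R) [IsFiniteMeasure μ]
    (hμ : Integrable (logWeight d c) μ) (x : Rd d) :
    Integrable (fun y => kernelFar d c R (x - y)) μ := by
  refine ((integrable_const (|kernelRadius d c R| + logWeight d c x)).add hμ).mono'
    ((measurable_kernelFar d c R).comp (measurable_const.sub measurable_id)).aestronglyMeasurable
    (Eventually.of_forall fun y => ?_)
  refine (abs_kernelFar_le hc hR _).trans ?_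
  simp only [Pi.add_apply]
  linarith [logWeight_sub_le hc x y]

theorem ae_integrable_coulombKernel_sub (hd : 2 ≤ d) (hc : 0 < c) [IsFiniteMeasure μ]
    (hμ : Integrable (logWeight d c) μ) :
    ∀ᵐ x, Integrable (fun y => coulombKernel d c (x - y)) μ := by
  filter_upwards [(integrable_kernelNear_prod (μ := μ) hd hc one_pos).prod_right_ae] with x hx
  refine (hx.add (integrable_kernelFar_sub hc le_rfl hμ x)).congr (Eventually.of_forall fun y => ?_)
  exact kernelNear_add_kernelFar d c 1 _

/-- The potentials of two probability measures differ by at most a constant outside an integrable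
function. -/
theorem exists_integrable_potential_sub_le (hd : 2 ≤ d) (hc : 0 < c) [IsProbabilityMeasure μ]
    [IsProbabilityMeasure ν] (hμ : Integrable (logWeight d c) μ)
    (hν : Integrable (logWeight d c) ν) {k : ℝ} (hk : 0 < k) :
    ∃ f : Rd d → ℝ, Integrable f ∧ (∀ x, 0 ≤ f x) ∧
      ∀ᵐ x, potential d c μ x - potential d c ν x ≤ f x + k := by
  have hlim : Integrable (logWeight d c) (μ + ν) := hμ.add_measure hν
  obtain ⟨R, hR, hRk⟩ := exists_integral_farOsc_le hd hc (μ + ν) hlim hk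
  have hR0 : 0 < R := by linarith
  rw [integral_add_measure (integrable_farOsc hc hμ hR) (integrable_farOsc hc hν hR)] at hRk
  have hnear := integrable_kernelNear_prod (μ := μ) hd hc hR0
  have hnear' := integrable_kernelNear_prod (μ := ν) hd hc hR0
  -- The near part of the potential of `μ` is the integrable function; that of `ν` is nonnegative
  -- and is dropped. Both measures having mass one, each far potential is compared with the same
  -- `kernelFar d c R x`, and the two errors add up to at most `k`.
  refine ⟨fun x => ∫ y, kernelNear d c R (x - y) ∂μ, hnear.integral_prod_left,
    fun x => integral_nonneg fun y => kernelNear_nonneg _ _ _ _, ?_⟩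
  have key : ∀ (m : Measure (Rd d)) [IsProbabilityMeasure m], Integrable (logWeight d c) m → ∀ x,
      |(∫ y, kernelFar d c R (x - y) ∂m) - kernelFar d c R x| ≤ ∫ y, farOsc d c R y ∂m := by
    intro m _ hm x
    have h1 := integrable_kernelFar_sub hc hR hm x
    have h2 : (∫ y, kernelFar d c R (x - y) ∂m) - kernelFar d c R x =
        ∫ y, (kernelFar d c R (x - y) - kernelFar d c R x) ∂m := by
      rw [integral_sub h1 (integrable_const _), integral_const, probReal_univ, one_smul]
    rw [h2]
    refine abs_integral_le_integral_abs.trans (integral_mono (h1.sub (integrable_const _)).abs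
      (integrable_farOsc hc hm hR) fun y => abs_kernelFar_sub_le hc hR x y)
  have split : ∀ (m : Measure (Rd d)) [IsProbabilityMeasure m], Integrable (logWeight d c) m → ∀ x,
      Integrable (fun y => kernelNear d c R (x - y)) m → potential d c m x =
        (∫ y, kernelNear d c R (x - y) ∂m) + ∫ y, kernelFar d c R (x - y) ∂m := by
    intro m _ hm x hx
    rw [← integral_add hx (integrable_kernelFar_sub hc hR hm x)]
    simp_rw [kernelNear_add_kernelFar]
    rfl
  filter_upwards [hnear.prod_right_ae, hnear'.prod_right_ae] with x h1 h2
  rw [split μ hμ x h1, split ν hν x h2]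
  have h3 := abs_le.1 (key μ hμ x)
  have h4 := abs_le.1 (key ν hν x)
  have h5 : 0 ≤ ∫ y, kernelNear d c R (x - y) ∂ν := integral_nonneg fun y => kernelNear_nonneg _ _ _ _
  linarith

theorem integrable_coulombKernel_sub_sub (hd : 2 ≤ d) (hc : 0 < c) [IsFiniteMeasure μ]
    (hμ : Integrable (logWeight d c) μ) {t : ℝ} (ht : 0 < t) (x : Rd d) :
    Integrable (fun p : Rd d × Rd d => coulombKernel d c (x - p.1 - p.2))
      ((heatMeasure d t).prod μ) := by
  have := isProbabilityMeasure_heatMeasure (d := d) ht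
  have hm : Measurable fun y : Rd d => x - y := by fun_prop
  have hw : Integrable (logWeight d c) (μ.map fun y => x - y) := by
    rw [integrable_map_measure (measurable_logWeight d c).aestronglyMeasurable hm.aemeasurable]
    refine ((integrable_const (logWeight d c x)).add hμ).mono'
      ((measurable_logWeight d c).comp hm).aestronglyMeasurable (Eventually.of_forall fun y => ?_)
    rw [Function.comp_apply, Real.norm_of_nonneg (logWeight_nonneg hc _)]
    exact logWeight_sub_le hc x y
  have h := integrable_coulombKernel_prod (ν := μ.map fun y => x - y) hd hc (heatMeasure_le ht)
    (integrable_logWeight_heatMeasure hc ht) hw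
  have e : (heatMeasure d t).prod (μ.map fun y => x - y) =
      ((heatMeasure d t).prod μ).map (Prod.map id fun y => x - y) := by
    rw [← Measure.map_prod_map _ _ measurable_id hm, Measure.map_id]
  rw [e, integrable_map_measure (measurable_coulombKernel_sub d c).aestronglyMeasurable
    (measurable_id.prodMap hm).aemeasurable] at h
  refine h.congr (Eventually.of_forall fun p => ?_)
  simp only [Function.comp_apply, Prod.map_fst, Prod.map_snd, id]
  rw [coulombKernel_sub_comm]
  congr 1
  abel

theorem integrable_potential_heatMeasure (hd : 2 ≤ d) (hc : 0 < c) [IsFiniteMeasure μ]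
    (hμ : Integrable (logWeight d c) μ) {t : ℝ} (ht : 0 < t) (x : Rd d) :
    Integrable (fun z => potential d c μ (x - z)) (heatMeasure d t) :=
  have := isProbabilityMeasure_heatMeasure (d := d) ht
  (integrable_coulombKernel_sub_sub hd hc hμ ht x).integral_prod_left

/-- The Gaussian average of a Coulomb potential. -/
theorem integral_potential_heatMeasure (hd : 2 ≤ d) (hc : 0 < c) {κ t : ℝ} (hκ : 0 < κ) (ht : 0 < t)
    (hκt : ∀ x : Rd d, x ≠ 0 → ∫ z, coulombKernel d c (x - z) ∂heatMeasure d t =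
      coulombKernel d c x - κ * heatTime d t x)
    [IsFiniteMeasure μ] (hμ : Integrable (logWeight d c) μ) (hac : μ ≪ volume) {x : Rd d}
    (hx : Integrable (fun y => coulombKernel d c (x - y)) μ) :
    Integrable (fun y => heatTime d t (x - y)) μ ∧
    ∫ z, potential d c μ (x - z) ∂heatMeasure d t =
      potential d c μ x - κ * ∫ y, heatTime d t (x - y) ∂μ := by
  have := isProbabilityMeasure_heatMeasure (d := d) ht
  have := nontrivial_Rd hd
  have hF := integrable_coulombKernel_sub_sub hd hc hμ ht x
  have h1 : ∫ z, potential d c μ (x - z) ∂heatMeasure d t =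
      ∫ y, (∫ z, coulombKernel d c (x - z - y) ∂heatMeasure d t) ∂μ :=
    integral_integral_swap (f := fun z y => coulombKernel d c (x - z - y)) hF
  have h2 : ∀ᵐ y ∂μ, ∫ z, coulombKernel d c (x - z - y) ∂heatMeasure d t =
      coulombKernel d c (x - y) - κ * heatTime d t (x - y) := by
    refine hac.ae_le ?_
    filter_upwards [Measure.ae_ne volume x] with y hy
    rw [← hκt (x - y) (sub_ne_zero.2 hy.symm)]
    congr 1; ext z; congr 1; abel
  have h3 : Integrable (fun y => heatTime d t (x - y)) μ := by
    have h4 := (hx.sub (hF.integral_prod_right.congr h2)).const_mul κ⁻¹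
    refine h4.congr (Eventually.of_forall fun y => ?_)
    simp only [Pi.sub_apply, sub_sub_cancel]
    field_simp
  refine ⟨h3, ?_⟩
  rw [h1, integral_congr_ae h2, integral_sub hx (h3.const_mul κ), integral_const_mul]
  rfl

theorem integrableOn_integral_heatMass [IsFiniteMeasure μ] (O : Set (Rd d)) (t : ℝ) :
    IntegrableOn (fun s => ∫ y, heatMass d O s y ∂μ) (Set.Ioc 0 t) := by
  refine Measure.integrableOn_of_bounded (M := μ.real Set.univ) measure_Ioc_lt_top.ne
    ((measurable_heatMass O).stronglyMeasurable.integral_prod_right').aestronglyMeasurable ?_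
  refine (ae_restrict_iff' measurableSet_Ioc).2 (Eventually.of_forall fun s hs => ?_)
  have := norm_integral_le_of_norm_le_const (μ := μ) (f := fun y => heatMass d O s y) (C := 1)
    (Eventually.of_forall fun y => by
      rw [Real.norm_of_nonneg (heatMass_nonneg O hs.1 y)]; exact heatMass_le_one O hs.1 y)
  simpa using this

/-- Among two absolutely continuous probability measures, the one with the larger potential on a
set `{u > k}`, `k > 0`, charges that set at least as much as the other. -/
theorem measureReal_potential_gt_le (hd : 2 ≤ d) (hc : 0 < c) [IsProbabilityMeasure μ]
    [IsProbabilityMeasure ν] (hμ : Integrable (logWeight d c) μ) (hν : Integrable (logWeight d c) ν)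
    (hμac : μ ≪ volume) (hνac : ν ≪ volume) {k : ℝ} (hk : 0 < k) :
    ν.real {x | k < potential d c μ x - potential d c ν x} ≤
      μ.real {x | k < potential d c μ x - potential d c ν x} := by
  obtain ⟨κ, hκ, hκt⟩ := exists_integral_coulombKernel_heatMeasure hd hc
  set u : Rd d → ℝ := fun x => potential d c μ x - potential d c ν x with hu
  have hum : Measurable u := (measurable_potential d c μ).sub (measurable_potential d c ν)
  set O : Set (Rd d) := {x | k < u x} with hO
  have hOm : MeasurableSet O := measurableSet_lt measurable_const hum
  -- Truncating at a positive level makes `f` integrable, so that the Gaussian average preserves its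
  -- integral.
  set f : Rd d → ℝ := fun x => max (u x - k) 0 with hf
  have hfm : Measurable f := (hum.sub_const k).max measurable_const
  have hfi : Integrable f := by
    obtain ⟨F, hF, hF0, hFu⟩ := exists_integrable_potential_sub_le hd hc hμ hν hk
    refine hF.mono' hfm.aestronglyMeasurable ?_
    filter_upwards [hFu] with x hx
    rw [Real.norm_of_nonneg (le_max_right _ _)]
    exact max_le (by linarith) (hF0 x)
  have key : ∀ t, 0 < t → 0 ≤ ∫ s in Set.Ioc 0 t,
      ((∫ y, heatMass d O s y ∂μ) - ∫ y, heatMass d O s y ∂ν) := by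
    intro t ht
    have hp := isProbabilityMeasure_heatMeasure (d := d) ht
    set Q : Rd d → ℝ := fun x => (∫ y, heatTime d t (x - y) ∂μ) - ∫ y, heatTime d t (x - y) ∂ν with hQ
    have hprod : ∀ (m : Measure (Rd d)) [IsFiniteMeasure m],
        Integrable (fun x => ∫ y, heatTime d t (x - y) ∂m) := fun m _ =>
      (integrable_comp_sub_prod_of_le (μ := volume) (ν := m) (L := 1) (integrable_heatTime d t)
        (measurable_heatTime d t) (by rw [one_smul])).integral_prod_left
    have hff : Integrable (fun p : Rd d × Rd d => f (p.1 - p.2)) (volume.prod (heatMeasure d t)) :=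
      integrable_comp_sub_prod_of_le (L := 1) hfi hfm (by rw [one_smul])
    have hPf : ∫ x, (∫ z, f (x - z) ∂heatMeasure d t) = ∫ x, f x := by
      rw [integral_integral_swap (f := fun x z => f (x - z)) hff]
      simp_rw [integral_sub_right_eq_self f]
      rw [integral_const, probReal_univ, one_smul]
    -- A Kato inequality for the heat semigroup: on `O` the average of `f` is at least that of `u -
    -- k`, and the defect of `u` is `κ * Q`; off `O`, `f` vanishes and its average is nonnegative.
    -- The left side integrates to zero, whence `∫_O Q ≥ 0`.
    have hpt : ∀ᵐ x, f x - ∫ z, f (x - z) ∂heatMeasure d t ≤ O.indicator (fun x => κ * Q x) x := by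
      filter_upwards [ae_integrable_coulombKernel_sub hd hc hμ, ae_integrable_coulombKernel_sub hd hc hν,
        hff.prod_right_ae] with x hx hx' hfx
      by_cases hxO : x ∈ O
      · rw [Set.indicator_of_mem hxO]
        have e1 := (integral_potential_heatMeasure hd hc hκ ht (hκt t ht) hμ hμac hx).2
        have e2 := (integral_potential_heatMeasure hd hc hκ ht (hκt t ht) hν hνac hx').2
        have i1 := integrable_potential_heatMeasure hd hc hμ ht x
        have i2 := integrable_potential_heatMeasure hd hc hν ht x
        have i3 : Integrable (fun z => u (x - z)) (heatMeasure d t) := i1.sub i2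
        have e3 : ∫ z, (u (x - z) - k) ∂heatMeasure d t ≤ ∫ z, f (x - z) ∂heatMeasure d t :=
          integral_mono (i3.sub (integrable_const k)) hfx fun z => le_max_left _ _
        have e4 : ∫ z, (u (x - z) - k) ∂heatMeasure d t =
            (∫ z, potential d c μ (x - z) ∂heatMeasure d t) -
              (∫ z, potential d c ν (x - z) ∂heatMeasure d t) - k := by
          rw [integral_sub i3 (integrable_const k), integral_const, probReal_univ, one_smul]
          congr 1
          exact integral_sub i1 i2
        have e5 : f x = potential d c μ x - potential d c ν x - k :=
          max_eq_left (by have : k < u x := hxO; linarith)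
        rw [e5]
        simp only [hQ]
        linarith
      · rw [Set.indicator_of_notMem hxO]
        have e5 : f x = 0 := max_eq_right (by have : ¬ k < u x := hxO; linarith)
        have e6 : 0 ≤ ∫ z, f (x - z) ∂heatMeasure d t := integral_nonneg fun z => le_max_right _ _
        linarith
    have hQi : Integrable Q := (hprod μ).sub (hprod ν)
    have h1 : ∫ x, (f x - ∫ z, f (x - z) ∂heatMeasure d t) = 0 := by
      rw [integral_sub hfi hff.integral_prod_left, hPf, sub_self]
    have h2 : 0 ≤ ∫ x, O.indicator (fun x => κ * Q x) x := by
      rw [← h1]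
      exact integral_mono_ae (hfi.sub hff.integral_prod_left) ((hQi.const_mul κ).indicator hOm) hpt
    rw [integral_indicator hOm, integral_const_mul] at h2
    have h3 := nonneg_of_mul_nonneg_right h2 hκ
    rw [integral_sub (integrableOn_integral_heatMass O t) (integrableOn_integral_heatMass O t), ← integral_setIntegral_heatTime, ← integral_setIntegral_heatTime,
      ← integral_sub (hprod μ).integrableOn (hprod ν).integrableOn]
    exact h3
  -- Were `ν` to charge `O` more, the integrand in `key` would be below a negative constant at all
  -- small times.
  by_contra! hlt
  have hlim := (tendsto_integral_heatMass hμac hOm).sub (tendsto_integral_heatMass hνac hOm)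
  set δ := ν.real O - μ.real O with hδ
  have hδ0 : 0 < δ := sub_pos.2 hlt
  have hev := hlim.eventually_lt_const (show μ.real O - ν.real O < -(δ / 2) by linarith)
  rw [eventually_nhdsWithin_iff, Metric.eventually_nhds_iff] at hev
  obtain ⟨ε, hε, hεs⟩ := hev
  have ht : 0 < ε / 2 := by positivity
  have h1 := key (ε / 2) ht
  have h2 : ∫ s in Set.Ioc 0 (ε / 2), ((∫ y, heatMass d O s y ∂μ) - ∫ y, heatMass d O s y ∂ν) ≤
      ∫ s in Set.Ioc 0 (ε / 2), -(δ / 2) := by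
    refine setIntegral_mono_on_ae ?_ ?_ measurableSet_Ioc (Eventually.of_forall fun s hs => ?_)
    · exact (integrableOn_integral_heatMass O _).sub (integrableOn_integral_heatMass O _)
    · exact integrableOn_const measure_Ioc_lt_top.ne
    · exact (hεs (by rw [Real.dist_eq, sub_zero, abs_of_pos hs.1]; linarith [hs.2]) hs.1).le
  rw [setIntegral_const] at h2
  simp only [Real.volume_real_Ioc_of_le ht.le, smul_eq_mul] at h2
  nlinarith

end Potential

/-! ### Mutual energy and the first variation of the mean-field energy -/

/-- The mutual Coulomb energy of two measures. -/
noncomputable def mutualEnergy (d : ℕ) (c : ℝ) (μ ν : Measure (Rd d)) : ℝ :=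
  ∫ z : Rd d × Rd d, coulombKernel d c (z.1 - z.2) ∂(μ.prod ν)

section Energy

variable {d : ℕ} {c : ℝ} {μ ν : Measure (Rd d)}

theorem mutualEnergy_comm [SFinite μ] [SFinite ν] : mutualEnergy d c μ ν = mutualEnergy d c ν μ := by
  unfold mutualEnergy
  rw [← integral_prod_swap]
  congr 1; ext
  exact coulombKernel_sub_comm d c _ _

theorem integrable_coulombKernel_prod_comm [SFinite μ] [SFinite ν]
    (h : Integrable (fun z : Rd d × Rd d => coulombKernel d c (z.1 - z.2)) (μ.prod ν)) :
    Integrable (fun z : Rd d × Rd d => coulombKernel d c (z.1 - z.2)) (ν.prod μ) :=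
  h.swap.congr (Eventually.of_forall fun _ => coulombKernel_sub_comm d c _ _)

theorem mutualEnergy_eq_integral_potential [SFinite μ] [SFinite ν]
    (h : Integrable (fun z : Rd d × Rd d => coulombKernel d c (z.1 - z.2)) (μ.prod ν)) :
    mutualEnergy d c μ ν = ∫ x, potential d c μ x ∂ν := by
  rw [mutualEnergy_comm]
  exact integral_prod _ (integrable_coulombKernel_prod_comm h)

theorem integrable_potential_of_prod [SFinite μ] [SFinite ν]
    (h : Integrable (fun z : Rd d × Rd d => coulombKernel d c (z.1 - z.2)) (μ.prod ν)) :
    Integrable (potential d c μ) ν :=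
  (integrable_coulombKernel_prod_comm h).integral_prod_left

theorem prod_diagonal_eq_zero (hd : 2 ≤ d) [SFinite μ] [SFinite ν] (hν : ν ≪ volume) :
    (μ.prod ν) (Set.diagonal (Rd d)) = 0 := by
  have := nontrivial_Rd hd
  rw [Measure.measure_prod_null isClosed_diagonal.measurableSet]
  refine Eventually.of_forall fun x => ?_
  have : Prod.mk x ⁻¹' Set.diagonal (Rd d) = {x} := by
    ext y; simp [eq_comm]
  simp only [this, Pi.zero_apply]
  exact hν (measure_singleton x)

theorem mix_prod [SFinite μ] [SFinite ν] (a b : ℝ≥0) :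
    (a • μ + b • ν).prod (a • μ + b • ν) =
      (a * a) • μ.prod μ + (a * b) • μ.prod ν + ((a * b) • ν.prod μ + (b * b) • ν.prod ν) := by
  rw [Measure.add_prod, Measure.prod_add, Measure.prod_add, Measure.prod_smul_left,
    Measure.prod_smul_left, Measure.prod_smul_left, Measure.prod_smul_left, Measure.prod_smul_right,
    Measure.prod_smul_right, Measure.prod_smul_right, Measure.prod_smul_right,
    smul_smul, smul_smul, smul_smul, smul_smul, mul_comm b a]

variable {V : Rd d → ℝ}

theorem FiniteMeanField.mix (hd : 2 ≤ d) (hμ : FiniteMeanField d c V μ) (hν : FiniteMeanField d c V ν)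
    (hμac : μ ≪ volume) (hνac : ν ≪ volume)
    (hi : Integrable (fun z : Rd d × Rd d => coulombKernel d c (z.1 - z.2)) (μ.prod ν))
    {a b : ℝ≥0} (hab : a + b = 1) :
    FiniteMeanField d c V (a • μ + b • ν) ∧
      meanField d c V (a • μ + b • ν) =
        (1 / 2) * (a * a * mutualEnergy d c μ μ + 2 * (a * b) * mutualEnergy d c μ ν +
          b * b * mutualEnergy d c ν ν) + a * (∫ x, V x ∂μ) + b * ∫ x, V x ∂ν := by
  have := hμ.prob
  have := hν.prob
  have hi' := integrable_coulombKernel_prod_comm hi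
  have hac : (a • μ + b • ν) ≪ volume := Measure.AbsolutelyContinuous.add_left
    (hμac.smul_left a) (hνac.smul_left b)
  have i1 : Integrable (fun z : Rd d × Rd d => coulombKernel d c (z.1 - z.2))
      ((a * a) • μ.prod μ + (a * b) • μ.prod ν) :=
    (hμ.kernel.smul_measure_nnreal).add_measure (hi.smul_measure_nnreal)
  have i2 : Integrable (fun z : Rd d × Rd d => coulombKernel d c (z.1 - z.2))
      ((a * b) • ν.prod μ + (b * b) • ν.prod ν) :=
    (hi'.smul_measure_nnreal).add_measure (hν.kernel.smul_measure_nnreal)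
  refine ⟨⟨⟨?_⟩, prod_diagonal_eq_zero hd hac, ?_, ?_⟩, ?_⟩
  · simp only [Measure.add_apply, Measure.smul_apply, measure_univ]
    rw [ENNReal.smul_def, ENNReal.smul_def, smul_eq_mul, smul_eq_mul, mul_one, mul_one,
      ← ENNReal.coe_add, hab, ENNReal.coe_one]
  · rw [mix_prod]
    exact i1.add_measure i2
  · exact hμ.potential.smul_measure_nnreal.add_measure hν.potential.smul_measure_nnreal
  · unfold meanField
    rw [mix_prod, integral_add_measure i1 i2,
      integral_add_measure hμ.kernel.smul_measure_nnreal hi.smul_measure_nnreal,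
      integral_add_measure hi'.smul_measure_nnreal hν.kernel.smul_measure_nnreal,
      integral_add_measure hμ.potential.smul_measure_nnreal hν.potential.smul_measure_nnreal]
    simp only [integral_smul_nnreal_measure, NNReal.smul_def, smul_eq_mul, NNReal.coe_mul]
    have := mutualEnergy_comm (d := d) (c := c) (μ := ν) (ν := μ)
    unfold mutualEnergy at this ⊢
    rw [this]
    ring

theorem nonneg_of_forall_mul_add_sq {b e : ℝ} (h : ∀ s, 0 < s → s < 1 → 0 ≤ s * b + s ^ 2 * e) :
    0 ≤ b := by
  by_contra! hb
  have he : 0 < |e| + 1 := by positivity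
  set s := min (1 / 2) (-b / (2 * (|e| + 1))) with hs
  have hs0 : 0 < s := lt_min (by norm_num) (div_pos (by linarith) (by positivity))
  have hs1 : s < 1 := (min_le_left _ _).trans_lt (by norm_num)
  have hs2 : s * (2 * (|e| + 1)) ≤ -b := by
    rw [← le_div_iff₀ (by positivity)]
    exact min_le_right _ _
  have h1 := h s hs0 hs1
  have h2 : 0 ≤ b + s * e := by
    by_contra! h3
    nlinarith
  nlinarith [le_abs_self e]

/-- Along the segment from `μ` to `ν` the energy is a quadratic polynomial in `b`, whose linear
coefficient is the difference of the integrals of `potential + V`. The slack `D` makes room for the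
entropy; it is `0` for the equilibrium measure. -/
theorem linearize_of_le (hd : 2 ≤ d) (hμ : FiniteMeanField d c V μ) (hν : FiniteMeanField d c V ν)
    (hμac : μ ≪ volume) (hνac : ν ≪ volume)
    (hi : Integrable (fun z : Rd d × Rd d => coulombKernel d c (z.1 - z.2)) (μ.prod ν)) {D : ℝ}
    (h : ∀ a b : ℝ≥0, a + b = 1 → 0 < b →
      meanField d c V μ ≤ meanField d c V (a • μ + b • ν) + b * D) :
    (∫ x, (potential d c μ x + V x) ∂μ) ≤ (∫ x, (potential d c μ x + V x) ∂ν) + D := by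
  have := hμ.prob
  have := hν.prob
  rw [integral_add (integrable_potential_of_prod hμ.kernel) hμ.potential,
    integral_add (integrable_potential_of_prod hi) hν.potential,
    ← mutualEnergy_eq_integral_potential hμ.kernel, ← mutualEnergy_eq_integral_potential hi]
  have key := nonneg_of_forall_mul_add_sq
    (b := (mutualEnergy d c μ ν + (∫ x, V x ∂ν) + D) - (mutualEnergy d c μ μ + ∫ x, V x ∂μ))
    (e := (1 / 2) * (mutualEnergy d c μ μ - 2 * mutualEnergy d c μ ν + mutualEnergy d c ν ν)) ?_
  · linarith
  intro s hs0 hs1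
  obtain ⟨a, ha⟩ : ∃ a : ℝ≥0, (a : ℝ) = 1 - s := ⟨⟨1 - s, by linarith⟩, rfl⟩
  obtain ⟨b, hb⟩ : ∃ b : ℝ≥0, (b : ℝ) = s := ⟨⟨s, hs0.le⟩, rfl⟩
  have hab : a + b = 1 := by
    rw [← NNReal.coe_inj, NNReal.coe_add, ha, hb, NNReal.coe_one, sub_add_cancel]
  have h1 := h a b hab (by rw [← NNReal.coe_pos, hb]; exact hs0)
  rw [(hμ.mix hd hν hμac hνac hi hab).2, ha, hb] at h1
  unfold meanField at h1
  change 1 / 2 * mutualEnergy d c μ μ + _ ≤ _ at h1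
  nlinarith

end Energy

/-! ### The Euler–Lagrange conditions for the equilibrium measure -/

section Equilibrium

variable {d : ℕ} {c : ℝ} {V : Rd d → ℝ}

/-- Measures with bounded density and bounded support. -/
def BoundedDensity (μ : Measure (Rd d)) : Prop :=
  ∃ (L : ℝ≥0) (R : ℝ), μ ≤ L • (volume.restrict (Metric.ball 0 R))

theorem BoundedDensity.le_volume {μ : Measure (Rd d)} (h : BoundedDensity μ) :
    ∃ L : ℝ≥0, μ ≤ L • (volume : Measure (Rd d)) := by
  obtain ⟨L, R, h⟩ := h
  exact ⟨L, h.trans (by gcongr; exact Measure.restrict_le_self)⟩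

theorem BoundedDensity.absolutelyContinuous {μ : Measure (Rd d)} (h : BoundedDensity μ) :
    μ ≪ volume := by
  obtain ⟨L, h⟩ := h.le_volume
  exact (Measure.absolutelyContinuous_of_le h).trans (Measure.AbsolutelyContinuous.rfl.smul_left L)

theorem BoundedDensity.isFiniteMeasure {μ : Measure (Rd d)} (h : BoundedDensity μ) :
    IsFiniteMeasure μ := by
  obtain ⟨L, R, h⟩ := h
  have : IsFiniteMeasure (volume.restrict (Metric.ball (0 : Rd d) R)) :=
    ⟨by simpa using measure_ball_lt_top⟩
  exact isFiniteMeasure_of_le _ h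

theorem BoundedDensity.integrable_of_continuous {μ : Measure (Rd d)} (h : BoundedDensity μ)
    {f : Rd d → ℝ} (hf : Continuous f) : Integrable f μ := by
  obtain ⟨L, R, h⟩ := h
  have h1 : IntegrableOn f (Metric.ball 0 R) :=
    (hf.continuousOn.integrableOn_compact (isCompact_closedBall 0 R)).mono_set
      Metric.ball_subset_closedBall
  exact (h1.smul_measure_nnreal (c := L)).mono_measure h

theorem BoundedDensity.integrable_logWeight {μ : Measure (Rd d)} (h : BoundedDensity μ) :
    Integrable (logWeight d c) μ := by
  refine h.integrable_of_continuous ?_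
  unfold logWeight
  split_ifs
  · have : ∀ x : Rd d, 1 + ‖x‖ ≠ 0 := fun x => by positivity
    fun_prop (disch := assumption)
  · exact continuous_const

theorem BoundedDensity.integrable_kernel {μ ν : Measure (Rd d)} (hd : 2 ≤ d) (hc : 0 < c)
    (h : BoundedDensity μ) [IsFiniteMeasure ν] (hν : Integrable (logWeight d c) ν) :
    Integrable (fun z : Rd d × Rd d => coulombKernel d c (z.1 - z.2)) (μ.prod ν) := by
  have := h.isFiniteMeasure
  obtain ⟨L, hL⟩ := h.le_volume
  exact integrable_coulombKernel_prod hd hc hL h.integrable_logWeight hν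

theorem BoundedDensity.finiteMeanField {μ : Measure (Rd d)} (hd : 2 ≤ d) (hc : 0 < c)
    (hV : Continuous V) (h : BoundedDensity μ) (hp : IsProbabilityMeasure μ) :
    FiniteMeanField d c V μ :=
  ⟨hp, prod_diagonal_eq_zero hd h.absolutelyContinuous,
    h.integrable_kernel hd hc h.integrable_logWeight, h.integrable_of_continuous hV⟩

/-- The Euler–Lagrange inequality for the equilibrium measure, and equality on its support. -/
theorem IsEquilibriumMeasure.eulerLagrange (hd : 2 ≤ d) (hc : 0 < c) (hV : Continuous V)
    {μ : Measure (Rd d)} (h : IsEquilibriumMeasure d c V μ) (hac : μ ≪ volume) :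
    ∃ C : ℝ, (∀ᵐ x, C ≤ potential d c μ x + V x) ∧ ∀ᵐ x ∂μ, potential d c μ x + V x = C := by
  have hp := h.1.prob
  have hlw := integrable_logWeight hc h.1.kernel
  set W : Rd d → ℝ := fun x => potential d c μ x + V x with hW
  have hWm : Measurable W := (measurable_potential d c μ).add hV.measurable
  set C := ∫ x, W x ∂μ with hC
  have h1 : ∀ᵐ x, C ≤ W x := by
    by_contra hcon
    have hpos : volume {x | W x < C} ≠ 0 := by
      intro h0
      apply hcon
      rw [ae_iff]
      simpa using h0
    have hU : {x | W x < C} = ⋃ n : ℕ, {x | W x < C} ∩ Metric.ball 0 n := by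
      rw [← Set.inter_iUnion, Metric.iUnion_ball_nat, Set.inter_univ]
    rw [hU] at hpos
    obtain ⟨n, hn⟩ : ∃ n : ℕ, volume ({x | W x < C} ∩ Metric.ball 0 n) ≠ 0 := by
      by_contra! h0
      exact hpos (measure_iUnion_null h0)
    set E := {x | W x < C} ∩ Metric.ball 0 (n : ℝ) with hE
    have hEm : MeasurableSet E :=
      (measurableSet_lt hWm measurable_const).inter Metric.isOpen_ball.measurableSet
    have hEfin : volume E ≠ ⊤ :=
      ((measure_mono Set.inter_subset_right).trans_lt measure_ball_lt_top).ne
    set r : ℝ≥0 := (volume E).toNNReal⁻¹ with hr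
    have hEr : (r : ℝ≥0∞) * volume E = 1 := by
      rw [hr, ENNReal.coe_inv (by simp [ENNReal.toNNReal_eq_zero_iff, hn, hEfin]),
        ENNReal.coe_toNNReal hEfin, ENNReal.inv_mul_cancel hn hEfin]
    have hbd : BoundedDensity (r • volume.restrict E) :=
      ⟨r, n, by gcongr; exact Set.inter_subset_right⟩
    have hpr : IsProbabilityMeasure (r • volume.restrict E) :=
      ⟨by rw [Measure.smul_apply, Measure.restrict_apply_univ]; exact hEr⟩
    have hν := hbd.finiteMeanField hd hc hV hpr
    have hi := integrable_coulombKernel_prod_comm (hbd.integrable_kernel hd hc hlw)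
    have hle := linearize_of_le hd h.1 hν hac hbd.absolutelyContinuous hi (D := 0) (fun a b hab _ => by
      rw [mul_zero, add_zero]
      exact h.2 _ (h.1.mix hd hν hac hbd.absolutelyContinuous hi hab).1)
    rw [add_zero] at hle
    have hWi : Integrable W (r • volume.restrict E) :=
      (integrable_potential_of_prod hi).add hν.potential
    have hr0 : r ≠ 0 := by
      intro h0
      rw [h0] at hEr
      simp at hEr
    have hae : ∀ᵐ x ∂(r • volume.restrict E), W x < C :=
      (Measure.AbsolutelyContinuous.rfl.smul_left r).ae_le
        ((ae_restrict_iff' hEm).2 (Eventually.of_forall fun x hx => hx.1))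
    have hlt : ∫ x, W x ∂(r • volume.restrict E) < ∫ _, C ∂(r • volume.restrict E) := by
      rw [← sub_pos, ← integral_sub (integrable_const _) hWi,
        integral_pos_iff_support_of_nonneg_ae]
      · rw [pos_iff_ne_zero]
        intro h0
        have h2 : ∀ᵐ x ∂(r • volume.restrict E), C - W x = 0 := by
          rw [ae_iff]; exact h0
        obtain ⟨x, hx1, hx2⟩ := (hae.and h2).exists
        linarith
      · filter_upwards [hae] with x hx
        simp only [Pi.zero_apply]
        linarith
      · exact (integrable_const _).sub hWi
    rw [integral_const, probReal_univ, one_smul] at hlt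
    exact absurd hle (not_le.2 hlt)
  refine ⟨C, h1, ?_⟩
  have hWi : Integrable W μ := (integrable_potential_of_prod h.1.kernel).add h.1.potential
  -- `C` is the `μ`-mean of `W` and also an almost everywhere lower bound, so equality holds
  -- `μ`-almost everywhere.
  have h2 : ∫ x, (W x - C) ∂μ = 0 := by
    rw [integral_sub hWi (integrable_const _), integral_const, probReal_univ, one_smul, hC, sub_self]
  have h3 : ∀ᵐ x ∂μ, C ≤ W x := hac.ae_le h1
  rw [integral_eq_zero_iff_of_nonneg_ae (h3.mono fun x hx => sub_nonneg.2 hx)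
    (hWi.sub (integrable_const _))] at h2
  filter_upwards [h2] with x hx
  exact sub_eq_zero.1 hx

end Equilibrium

/-! ### Entropy of mixtures and competitors for the free energy -/

section Entropy

/-- Monotonicity of the logarithm. Convexity bounds the entropy density of a mixture only from
above; this, with `le_mul_log_mul`, supplies the lower bound needed for integrability on infinite
volume. -/
theorem add_mul_log_add_ge {x y : ℝ} (hx : 0 ≤ x) (hy : 0 ≤ y) :
    x * Real.log x + y * Real.log y ≤ (x + y) * Real.log (x + y) := by
  rcases hx.eq_or_lt with rfl | hx
  · simp
  rcases hy.eq_or_lt with rfl | hy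
  · simp
  have h1 := Real.log_le_log hx (by linarith : x ≤ x + y)
  have h2 := Real.log_le_log hy (by linarith : y ≤ x + y)
  nlinarith

theorem mul_log_mix_le {x y a b : ℝ} (hx : 0 ≤ x) (hy : 0 ≤ y) (ha : 0 ≤ a) (hb : 0 ≤ b)
    (hab : a + b = 1) :
    (a * x + b * y) * Real.log (a * x + b * y) ≤ a * (x * Real.log x) + b * (y * Real.log y) :=
  Real.convexOn_mul_log.2 hx hy ha hb hab

theorem le_mul_log_mul {x a : ℝ} (hx : 0 ≤ x) (ha : 0 ≤ a) (ha1 : a ≤ 1) :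
    -|x * Real.log x| - x ≤ (a * x) * Real.log (a * x) := by
  rcases hx.eq_or_lt with rfl | hx
  · simp
  rcases ha.eq_or_lt with rfl | ha
  · have := abs_nonneg (x * Real.log x)
    simp only [zero_mul]
    linarith
  rw [Real.log_mul ha.ne' hx.ne']
  have h1 := Real.self_sub_one_le_mul_log ha.le
  have h2 : -|x * Real.log x| ≤ a * (x * Real.log x) := by
    have h3 := neg_abs_le (x * Real.log x)
    have h4 := abs_nonneg (x * Real.log x)
    nlinarith
  nlinarith

variable {d : ℕ} {c : ℝ} {V : Rd d → ℝ} {μ ν : Measure (Rd d)}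

theorem measurable_density (μ : Measure (Rd d)) : Measurable (density μ) :=
  (Measure.measurable_rnDeriv μ volume).ennreal_toReal

theorem density_nonneg (μ : Measure (Rd d)) (x : Rd d) : 0 ≤ density μ x := ENNReal.toReal_nonneg

theorem integrable_density (μ : Measure (Rd d)) [IsFiniteMeasure μ] : Integrable (density μ) :=
  Measure.integrable_toReal_rnDeriv

theorem density_add [IsFiniteMeasure μ] [IsFiniteMeasure ν] :
    ∀ᵐ x, density (μ + ν) x = density μ x + density ν x := by
  filter_upwards [Measure.rnDeriv_add μ ν volume, Measure.rnDeriv_lt_top μ volume,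
    Measure.rnDeriv_lt_top ν volume] with x h1 h2 h3
  simp only [density]
  rw [h1, Pi.add_apply, ENNReal.toReal_add h2.ne h3.ne]

theorem density_smul [IsFiniteMeasure μ] (a : ℝ≥0) : ∀ᵐ x, density (a • μ) x = a * density μ x := by
  filter_upwards [Measure.rnDeriv_smul_left μ volume a] with x h
  simp only [density]
  rw [h, Pi.smul_apply, ENNReal.smul_def, smul_eq_mul, ENNReal.toReal_mul]
  rfl

theorem density_mix [IsFiniteMeasure μ] [IsFiniteMeasure ν] (a b : ℝ≥0) :
    ∀ᵐ x, density (a • μ + b • ν) x = a * density μ x + b * density ν x := by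
  filter_upwards [density_add (μ := a • μ) (ν := b • ν), density_smul (μ := μ) a,
    density_smul (μ := ν) b] with x h1 h2 h3
  rw [h1, h2, h3]

theorem entropy_mix [IsFiniteMeasure μ] [IsFiniteMeasure ν]
    (hμ : Integrable fun x => density μ x * Real.log (density μ x))
    (hν : Integrable fun x => density ν x * Real.log (density ν x)) {a b : ℝ≥0} (hab : a + b = 1) :
    (Integrable fun x => density (a • μ + b • ν) x * Real.log (density (a • μ + b • ν) x)) ∧
      ∫ x, density (a • μ + b • ν) x * Real.log (density (a • μ + b • ν) x) ≤
        a * (∫ x, density μ x * Real.log (density μ x)) +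
          b * ∫ x, density ν x * Real.log (density ν x) := by
  have hab' : (a : ℝ) + b = 1 := by exact_mod_cast hab
  have ha0 : (0 : ℝ) ≤ a := a.2
  have hb0 : (0 : ℝ) ≤ b := b.2
  have hup : ∀ᵐ x, density (a • μ + b • ν) x * Real.log (density (a • μ + b • ν) x) ≤
      a * (density μ x * Real.log (density μ x)) + b * (density ν x * Real.log (density ν x)) := by
    filter_upwards [density_mix (μ := μ) (ν := ν) a b] with x hx
    rw [hx]
    exact mul_log_mix_le (density_nonneg μ x) (density_nonneg ν x) ha0 hb0 hab'
  have hi : Integrable fun x => density (a • μ + b • ν) x * Real.log (density (a • μ + b • ν) x) := by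
    refine ((hμ.abs.add (integrable_density μ)).add (hν.abs.add (integrable_density ν))).mono'
      ((measurable_density _).mul (measurable_density _).log).aestronglyMeasurable ?_
    filter_upwards [density_mix (μ := μ) (ν := ν) a b, hup] with x hx hx2
    simp only [Pi.add_apply]
    have h1 := add_mul_log_add_ge (mul_nonneg ha0 (density_nonneg μ x))
      (mul_nonneg hb0 (density_nonneg ν x))
    have h2 := le_mul_log_mul (density_nonneg μ x) ha0 (by linarith)
    have h3 := le_mul_log_mul (density_nonneg ν x) hb0 (by linarith)
    rw [← hx] at h1
    have h4 := density_nonneg μ x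
    have h5 := density_nonneg ν x
    have h6 : ∀ (r s : ℝ), 0 ≤ r → r ≤ 1 → r * s ≤ |s| := fun r s hr hr1 => by
      nlinarith [le_abs_self s, abs_nonneg s]
    have h7 := h6 a (density μ x * Real.log (density μ x)) ha0 (by linarith)
    have h8 := h6 b (density ν x * Real.log (density ν x)) hb0 (by linarith)
    rw [Real.norm_eq_abs, abs_le]
    constructor <;> linarith
  refine ⟨hi, ?_⟩
  rw [← integral_const_mul, ← integral_const_mul, ← integral_add (hμ.const_mul _) (hν.const_mul _)]
  exact integral_mono_ae hi ((hμ.const_mul _).add (hν.const_mul _)) hup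

/-- Convexity bounds the entropy increment along a segment by `b` times the difference at the
endpoints, so only the quadratic energy has to be differentiated and the entropy never is. -/
theorem IsThermalEquilibrium.linearize (hd : 2 ≤ d) {θ : ℝ} (hθ : 0 < θ)
    (h : IsThermalEquilibrium d c V θ μ) (hν : FiniteFreeEnergy d c V ν)
    (hi : Integrable (fun z : Rd d × Rd d => coulombKernel d c (z.1 - z.2)) (μ.prod ν)) :
    θ * (∫ x, (potential d c μ x + V x) ∂μ) + (∫ x, density μ x * Real.log (density μ x)) ≤
      θ * (∫ x, (potential d c μ x + V x) ∂ν) + ∫ x, density ν x * Real.log (density ν x) := by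
  have := h.1.meanField.prob
  have := hν.meanField.prob
  have hle := linearize_of_le hd h.1.meanField hν.meanField h.1.ac hν.ac hi
    (D := (1 / θ) * ((∫ x, density ν x * Real.log (density ν x)) -
      ∫ x, density μ x * Real.log (density μ x))) ?_
  · have h1 := mul_le_mul_of_nonneg_left hle hθ.le
    rw [mul_add, ← mul_assoc, mul_one_div_cancel hθ.ne', one_mul] at h1
    linarith
  intro a b hab hb
  have hent := entropy_mix h.1.entropy hν.entropy hab
  have hmf := h.1.meanField.mix hd hν.meanField h.1.ac hν.ac hi hab
  have hmin := h.2 (a • μ + b • ν) ⟨hmf.1, Measure.AbsolutelyContinuous.add_left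
    (h.1.ac.smul_left a) (hν.ac.smul_left b), hent.1⟩
  unfold freeEnergy at hmin
  have h2 := mul_le_mul_of_nonneg_left hent.2 (one_div_nonneg.2 hθ.le)
  have ha : (a : ℝ) = 1 - b := by
    have : (a : ℝ) + b = 1 := by exact_mod_cast hab
    linarith
  rw [ha] at h2
  nlinarith

theorem setIntegral_density_mul [IsFiniteMeasure μ] (hac : μ ≪ volume) (f : Rd d → ℝ)
    {A : Set (Rd d)} (hA : MeasurableSet A) :
    ∫ x in A, density μ x * f x = ∫ x in A, f x ∂μ := by
  have := setIntegral_rnDeriv_smul (f := f) hac hA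
  simpa [density] using this

theorem integrable_density_mul_iff [IsFiniteMeasure μ] (hac : μ ≪ volume) {f : Rd d → ℝ} :
    Integrable (fun x => density μ x * f x) ↔ Integrable f μ := by
  have := integrable_rnDeriv_smul_iff (f := f) hac
  simpa [density] using this

/-- Replacing the density of `μ` on a bounded set `A` by a bounded density of the same mass. -/
theorem exists_replace_density (hd : 2 ≤ d) (hc : 0 < c) (hV : Continuous V)
    (h : FiniteFreeEnergy d c V μ) {A : Set (Rd d)} (hA : MeasurableSet A) {R : ℝ}
    (hAR : A ⊆ Metric.ball 0 R) {b : Rd d → ℝ} (hbm : Measurable b) {K : ℝ}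
    (hb0 : ∀ x ∈ A, 0 ≤ b x) (hbK : ∀ x ∈ A, b x ≤ K) (hmass : ∫ x in A, b x = μ.real A) :
    ∃ ν : Measure (Rd d), FiniteFreeEnergy d c V ν ∧
      Integrable (fun z : Rd d × Rd d => coulombKernel d c (z.1 - z.2)) (μ.prod ν) ∧
      (∀ f : Rd d → ℝ, Integrable f μ → Integrable f ν →
        ∫ x, f x ∂ν = (∫ x in Aᶜ, f x ∂μ) + ∫ x in A, b x * f x) ∧
      ∫ x, density ν x * Real.log (density ν x) =
        (∫ x in Aᶜ, density μ x * Real.log (density μ x)) + ∫ x in A, b x * Real.log (b x) := by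
  have := h.meanField.prob
  have hlw := integrable_logWeight hc h.meanField.kernel
  have hAfin : volume A ≠ ⊤ := ((measure_mono hAR).trans_lt measure_ball_lt_top).ne
  set β : Rd d → ℝ≥0∞ := fun x => ENNReal.ofReal (b x) with hβ
  have hβm : Measurable β := hbm.ennreal_ofReal
  set η := (volume.restrict A).withDensity β with hη
  have hηbd : BoundedDensity η := by
    refine ⟨K.toNNReal, R, ?_⟩
    calc η ≤ (volume.restrict A).withDensity fun _ => (K.toNNReal : ℝ≥0∞) := by
          refine withDensity_mono ((ae_restrict_iff' hA).2 (Eventually.of_forall fun x hx => ?_))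
          exact ENNReal.ofReal_le_ofReal (hbK x hx)
      _ = K.toNNReal • volume.restrict A := by rw [withDensity_const]; rfl
      _ ≤ _ := by gcongr
  have hηfin := hηbd.isFiniteMeasure
  have hbi : IntegrableOn b A := by
    refine Measure.integrableOn_of_bounded (M := K) hAfin hbm.aestronglyMeasurable ?_
    refine (ae_restrict_iff' hA).2 (Eventually.of_forall fun x hx => ?_)
    rw [Real.norm_of_nonneg (hb0 x hx)]
    exact hbK x hx
  have hηmass : η Set.univ = μ A := by
    rw [hη, withDensity_apply _ MeasurableSet.univ, Measure.restrict_univ,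
      ← ofReal_integral_eq_lintegral_ofReal hbi ((ae_restrict_iff' hA).2 (Eventually.of_forall hb0)),
      hmass, ofReal_measureReal]
  set ν := μ.restrict Aᶜ + η with hν
  have hres : μ.restrict Aᶜ ≤ μ := Measure.restrict_le_self
  have hνp : IsProbabilityMeasure ν := by
    refine ⟨?_⟩
    rw [hν, Measure.add_apply, hηmass, Measure.restrict_apply_univ, add_comm,
      measure_add_measure_compl hA, measure_univ]
  have hνac : ν ≪ volume := Measure.AbsolutelyContinuous.add_left
    ((Measure.absolutelyContinuous_of_le hres).trans h.ac) hηbd.absolutelyContinuous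
  have iμη : Integrable (fun z : Rd d × Rd d => coulombKernel d c (z.1 - z.2)) (μ.prod η) :=
    integrable_coulombKernel_prod_comm (hηbd.integrable_kernel hd hc hlw)
  have iμν : Integrable (fun z : Rd d × Rd d => coulombKernel d c (z.1 - z.2)) (μ.prod ν) := by
    rw [hν, Measure.prod_add]
    exact (h.meanField.kernel.mono_measure (Measure.prod_mono le_rfl hres)).add_measure iμη
  have iνν : Integrable (fun z : Rd d × Rd d => coulombKernel d c (z.1 - z.2)) (ν.prod ν) := by
    have e : ν.prod ν = (μ.restrict Aᶜ).prod ν + η.prod ν := by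
      conv_lhs => rw [hν, Measure.add_prod]
    rw [e]
    refine (iμν.mono_measure (Measure.prod_mono hres le_rfl)).add_measure
      (hηbd.integrable_kernel hd hc ?_)
    exact (hlw.mono_measure hres).add_measure hηbd.integrable_logWeight
  have hdens : ∀ᵐ x, density ν x = Aᶜ.indicator (density μ) x + A.indicator b x := by
    have e : η = volume.withDensity (A.indicator β) := (withDensity_indicator hA β).symm
    have e1 : η.rnDeriv volume =ᵐ[volume] A.indicator β := by
      rw [e]
      exact Measure.rnDeriv_withDensity _ (hβm.indicator hA)
    filter_upwards [density_add (μ := μ.restrict Aᶜ) (ν := η),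
      Measure.rnDeriv_restrict μ volume hA.compl, e1] with x h1 h2 h3
    rw [hν, h1]
    simp only [density]
    rw [h2, h3]
    by_cases hx : x ∈ A
    · simp [hx, hβ, ENNReal.toReal_ofReal (hb0 x hx)]
    · simp [hx, density]
  have hblog : IntegrableOn (fun x => b x * Real.log (b x)) A := by
    refine Measure.integrableOn_of_bounded (M := 1 + |K * Real.log K| + K) hAfin
      (hbm.mul hbm.log).aestronglyMeasurable ?_
    refine (ae_restrict_iff' hA).2 (Eventually.of_forall fun x hx => ?_)
    have h0 := hb0 x hx
    have hK := hbK x hx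
    have h1 := Real.self_sub_one_le_mul_log h0
    have h2 : b x * Real.log (b x) ≤ |K * Real.log K| := by
      rcases le_or_gt (b x) 1 with hb1 | hb1
      · have := Real.log_nonpos h0 hb1
        nlinarith [abs_nonneg (K * Real.log K)]
      · have h3 := Real.log_le_log (by linarith) hK
        have h4 := Real.log_nonneg hb1.le
        refine le_trans ?_ (le_abs_self _)
        nlinarith
    rw [Real.norm_eq_abs, abs_le]
    have := abs_nonneg (K * Real.log K)
    constructor <;> linarith
  have hent : (fun x => density ν x * Real.log (density ν x)) =ᵐ[volume]
      fun x => Aᶜ.indicator (fun x => density μ x * Real.log (density μ x)) x +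
        A.indicator (fun x => b x * Real.log (b x)) x := by
    filter_upwards [hdens] with x hx
    rw [hx]
    by_cases hxA : x ∈ A <;> simp [hxA]
  have i1 := h.entropy.indicator hA.compl
  have i2 := hblog.integrable_indicator hA
  refine ⟨ν, ⟨⟨hνp, prod_diagonal_eq_zero hd hνac, iνν, ?_⟩, hνac, (i1.add i2).congr hent.symm⟩,
    iμν, fun f hf hfν => ?_, ?_⟩
  · exact (h.meanField.potential.mono_measure hres).add_measure (hηbd.integrable_of_continuous hV)
  · have hfη : Integrable f η := hfν.mono_measure (by rw [hν]; exact Measure.le_add_left le_rfl)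
    rw [hν, integral_add_measure (hf.mono_measure hres) hfη]
    congr 1
    rw [hη, integral_withDensity_eq_integral_toReal_smul hβm
      (Eventually.of_forall fun _ => ENNReal.ofReal_lt_top)]
    refine setIntegral_congr_fun hA fun x hx => ?_
    simp [hβ, ENNReal.toReal_ofReal (hb0 x hx)]
  · rw [integral_congr_ae hent, integral_add i1 i2, integral_indicator hA.compl, integral_indicator hA]

end Entropy

/-! ### The thermal equilibrium measure: Gibbs form and density bound -/

section Thermal

variable {d : ℕ} {c : ℝ} {V : Rd d → ℝ} {μ : Measure (Rd d)}

/-- On bounded sets where the effective potential is bounded, the thermal equilibrium density is a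
Gibbs density. -/
theorem IsThermalEquilibrium.gibbs_on (hd : 2 ≤ d) (hc : 0 < c) (hV : Continuous V) {θ : ℝ}
    (hθ : 0 < θ) (h : IsThermalEquilibrium d c V θ μ) {A : Set (Rd d)} (hA : MeasurableSet A)
    {R n : ℝ} (hAR : A ⊆ Metric.ball 0 R) (hAn : ∀ x ∈ A, |potential d c μ x + V x| ≤ n)
    (hμA : μ A ≠ 0) :
    ∃ κ : ℝ, 0 < κ ∧ ∀ᵐ x, x ∈ A →
      density μ x = κ * Real.exp (-θ * (potential d c μ x + V x)) := by
  have hp := h.1.meanField.prob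
  have hac := h.1.ac
  set W : Rd d → ℝ := fun x => potential d c μ x + V x with hW
  have hWm : Measurable W := (measurable_potential d c μ).add hV.measurable
  have hAfin : volume A ≠ ⊤ := ((measure_mono hAR).trans_lt measure_ball_lt_top).ne
  have hA0 : volume A ≠ 0 := fun h0 => hμA (hac h0)
  set w : Rd d → ℝ := fun x => Real.exp (-θ * W x) with hw
  have hwm : Measurable w := (hWm.const_mul _).exp
  have hwle : ∀ x ∈ A, w x ≤ Real.exp (θ * n) := by
    intro x hx
    apply Real.exp_le_exp.2
    have := (abs_le.1 (hAn x hx)).1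
    nlinarith
  have hwi : IntegrableOn w A := by
    refine Measure.integrableOn_of_bounded (M := Real.exp (θ * n)) hAfin hwm.aestronglyMeasurable ?_
    refine (ae_restrict_iff' hA).2 (Eventually.of_forall fun x hx => ?_)
    rw [Real.norm_of_nonneg (Real.exp_pos _).le]
    exact hwle x hx
  have hZ : 0 < ∫ x in A, w x := by
    rw [setIntegral_pos_iff_support_of_nonneg_ae (Eventually.of_forall fun _ => (Real.exp_pos _).le)
      hwi]
    have : Function.support w = Set.univ := by
      ext x; simp [hw, (Real.exp_pos _).ne']
    rw [this, Set.univ_inter]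
    exact pos_iff_ne_zero.2 hA0
  -- The normalization gives the Gibbs density the mass of `μ` on `A`, so that it can replace `μ`
  -- there.
  set κ := μ.real A / ∫ x in A, w x with hκ
  have hκ0 : 0 < κ := div_pos (ENNReal.toReal_pos hμA (measure_ne_top _ _)) hZ
  set b : Rd d → ℝ := fun x => κ * w x with hb
  have hbm : Measurable b := hwm.const_mul κ
  have hbpos : ∀ x, 0 < b x := fun x => mul_pos hκ0 (Real.exp_pos _)
  have hbi : IntegrableOn b A := hwi.const_mul κ
  have hmass : ∫ x in A, b x = μ.real A := by
    rw [hb, integral_const_mul, hκ, div_mul_cancel₀ _ hZ.ne']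
  obtain ⟨ν, hν, hi, hνint, hνent⟩ := exists_replace_density hd hc hV h.1 hA hAR hbm
    (fun x _ => (hbpos x).le) (fun x hx => mul_le_mul_of_nonneg_left (hwle x hx) hκ0.le) hmass
  have := hν.meanField.prob
  refine ⟨κ, hκ0, ?_⟩
  have hle := h.linearize hd hθ hν hi
  have hWμ : Integrable W μ :=
    (integrable_potential_of_prod h.1.meanField.kernel).add h.1.meanField.potential
  have hWν : Integrable W ν := (integrable_potential_of_prod hi).add hν.meanField.potential
  change θ * (∫ x, W x ∂μ) + _ ≤ θ * (∫ x, W x ∂ν) + _ at hle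
  rw [hνint W hWμ hWν, hνent, ← integral_add_compl hA hWμ, ← integral_add_compl hA h.1.entropy,
    ← setIntegral_density_mul hac W hA] at hle
  have hρW : IntegrableOn (fun x => density μ x * W x) A :=
    ((integrable_density_mul_iff hac).2 hWμ).integrableOn
  have hρ : IntegrableOn (density μ) A := (integrable_density μ).integrableOn
  have hρmass : ∫ x in A, density μ x = μ.real A := by
    have := setIntegral_density_mul hac (fun _ => (1 : ℝ)) hA
    simpa using this
  have hφ : IntegrableOn (fun x => density μ x * Real.log (density μ x)) A := h.1.entropy.integrableOn
  have hlogb : ∀ x, Real.log (b x) = Real.log κ - θ * W x := by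
    intro x
    rw [hb, Real.log_mul hκ0.ne' (Real.exp_pos _).ne', Real.log_exp]
    ring
  have hbW : IntegrableOn (fun x => b x * W x) A := by
    refine Measure.integrableOn_of_bounded (M := κ * Real.exp (θ * n) * n) hAfin
      (hbm.mul hWm).aestronglyMeasurable ?_
    refine (ae_restrict_iff' hA).2 (Eventually.of_forall fun x hx => ?_)
    rw [norm_mul, Real.norm_of_nonneg (hbpos x).le]
    exact mul_le_mul (mul_le_mul_of_nonneg_left (hwle x hx) hκ0.le) (hAn x hx) (norm_nonneg _)
      (by positivity)
  have e1 : ∫ x in A, b x * Real.log (b x) = Real.log κ * μ.real A - θ * ∫ x in A, b x * W x := by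
    rw [← hmass, ← integral_const_mul, ← integral_const_mul,
      ← integral_sub (hbi.const_mul _) (hbW.const_mul _)]
    congr 1; ext x
    rw [hlogb]; ring
  -- The nonnegative integrand of the relative entropy of `μ` with respect to `b` on `A`. Comparison
  -- with the replaced measure gives it a nonpositive integral, so it vanishes and `density μ = b`
  -- almost everywhere on `A`.
  set F : Rd d → ℝ := fun x => b x * InformationTheory.klFun (density μ x / b x) with hF
  have hFnn : ∀ x, 0 ≤ F x := fun x => mul_nonneg (hbpos x).le
    (InformationTheory.klFun_nonneg (div_nonneg (density_nonneg μ x) (hbpos x).le))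
  have hFeq : ∀ x, F x = density μ x * Real.log (density μ x) - Real.log κ * density μ x +
      θ * (density μ x * W x) + b x - density μ x := by
    intro x
    have hbx := (hbpos x).ne'
    simp only [hF, InformationTheory.klFun_apply]
    rcases (density_nonneg μ x).eq_or_lt with h0 | h0
    · rw [← h0]; simp
    · rw [Real.log_div h0.ne' hbx, hlogb]
      field_simp
      ring
  have j1 : IntegrableOn (fun x => density μ x * Real.log (density μ x) -
      Real.log κ * density μ x) A := hφ.sub (hρ.const_mul (Real.log κ))
  have j2 : IntegrableOn (fun x => density μ x * Real.log (density μ x) -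
      Real.log κ * density μ x + θ * (density μ x * W x)) A := j1.add (hρW.const_mul θ)
  have j3 : IntegrableOn (fun x => density μ x * Real.log (density μ x) -
      Real.log κ * density μ x + θ * (density μ x * W x) + b x) A := j2.add hbi
  have hFi : IntegrableOn F A := (j3.sub hρ).congr (Eventually.of_forall fun x => (hFeq x).symm)
  have hF0 : ∫ x in A, F x = (∫ x in A, density μ x * Real.log (density μ x)) -
      Real.log κ * μ.real A + θ * ∫ x in A, density μ x * W x := by
    simp_rw [hFeq]
    rw [integral_sub j3 hρ, integral_add j2 hbi, integral_add j1 (hρW.const_mul θ),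
      integral_sub hφ (hρ.const_mul _), integral_const_mul, integral_const_mul, hmass, hρmass]
    ring
  have hFz : ∫ x in A, F x = 0 := by
    refine le_antisymm ?_ (integral_nonneg hFnn)
    rw [hF0]
    rw [e1] at hle
    linarith
  rw [integral_eq_zero_iff_of_nonneg hFnn hFi, EventuallyEq, ae_restrict_iff' hA] at hFz
  filter_upwards [hFz] with x hx hxA
  have h1 : InformationTheory.klFun (density μ x / b x) = 0 :=
    (mul_eq_zero.1 (hx hxA)).resolve_left (hbpos x).ne'
  rw [InformationTheory.klFun_eq_zero_iff (div_nonneg (density_nonneg μ x) (hbpos x).le),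
    div_eq_one_iff_eq (hbpos x).ne'] at h1
  exact h1

/-- The Euler–Lagrange equation of the thermal equilibrium measure. -/
theorem IsThermalEquilibrium.gibbs (hd : 2 ≤ d) (hc : 0 < c) (hV : Continuous V) {θ : ℝ}
    (hθ : 0 < θ) (h : IsThermalEquilibrium d c V θ μ) :
    ∃ κ : ℝ, 0 < κ ∧ ∀ᵐ x, density μ x = κ * Real.exp (-θ * (potential d c μ x + V x)) := by
  have hp := h.1.meanField.prob
  set W : Rd d → ℝ := fun x => potential d c μ x + V x with hW
  have hWm : Measurable W := (measurable_potential d c μ).add hV.measurable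
  set A : ℕ → Set (Rd d) := fun n => {x | |W x| ≤ n} ∩ Metric.ball 0 n with hA
  have hAm : ∀ n, MeasurableSet (A n) := fun n =>
    (measurableSet_le hWm.abs measurable_const).inter Metric.isOpen_ball.measurableSet
  have hmono : Monotone A := by
    intro m n hmn x hx
    have hmn' : (m : ℝ) ≤ n := by exact_mod_cast hmn
    exact ⟨le_trans (show |W x| ≤ m from hx.1) hmn', Metric.ball_subset_ball hmn' hx.2⟩
  have hmem : ∀ x, ∃ n, x ∈ A n := by
    intro x
    obtain ⟨n, hn⟩ := exists_nat_gt (max |W x| ‖x‖)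
    exact ⟨n, ((le_max_left _ _).trans_lt hn).le,
      by rw [mem_ball_zero_iff]; exact (le_max_right _ _).trans_lt hn⟩
  have hU : ⋃ n, A n = Set.univ := Set.eq_univ_of_forall fun x => Set.mem_iUnion.2 (hmem x)
  obtain ⟨n₀, hn₀⟩ : ∃ n, μ (A n) ≠ 0 := by
    by_contra! h0
    have h1 := measure_iUnion_null h0
    rw [hU, measure_univ] at h1
    exact one_ne_zero h1
  have hn : ∀ n, n₀ ≤ n → μ (A n) ≠ 0 := fun n hn h0 => hn₀ (measure_mono_null (hmono hn) h0)
  have key : ∀ n, n₀ ≤ n → ∃ κ : ℝ, 0 < κ ∧ ∀ᵐ x, x ∈ A n →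
      density μ x = κ * Real.exp (-θ * W x) := fun n hnn =>
    h.gibbs_on hd hc hV hθ (hAm n) Set.inter_subset_right (fun x hx => hx.1) (hn n hnn)
  obtain ⟨κ, hκ, hκ'⟩ := key n₀ le_rfl
  refine ⟨κ, hκ, ?_⟩
  have hall : ∀ n, ∀ᵐ x, x ∈ A (max n n₀) → density μ x = κ * Real.exp (-θ * W x) := by
    intro n
    obtain ⟨κ₁, hκ₁, hκ₁'⟩ := key (max n n₀) (le_max_right _ _)
    have hvol : volume (A n₀) ≠ 0 := fun h0 => hn₀ (h.1.ac h0)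
    -- The Gibbs constants of nested sets agree because both formulas hold on `A n₀`, which has
    -- positive volume.
    have : κ₁ = κ := by
      by_contra hne
      apply hvol
      refine measure_mono_null (t := {x | ¬((x ∈ A n₀ → density μ x = κ * Real.exp (-θ * W x)) ∧
        (x ∈ A (max n n₀) → density μ x = κ₁ * Real.exp (-θ * W x)))}) ?_
        (ae_iff.1 (hκ'.and hκ₁'))
      rintro x hx ⟨h1, h2⟩
      have h3 := (h2 (hmono (le_max_right _ _) hx)).symm.trans (h1 hx)
      exact hne (mul_right_cancel₀ (Real.exp_pos _).ne' h3)
    rwa [← this]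
  filter_upwards [ae_all_iff.2 hall] with x hx
  obtain ⟨n, hn⟩ := hmem x
  exact hx n (hmono (le_max_left _ _) hn)

/-- The density of the thermal equilibrium measure is bounded in terms of that of the equilibrium
measure. -/
theorem IsThermalEquilibrium.density_le (hd : 2 ≤ d) (hc : 0 < c) (hV : Continuous V) {θ : ℝ}
    (hθ : 0 < θ) (h : IsThermalEquilibrium d c V θ μ) {μV : Measure (Rd d)}
    (hμV : IsEquilibriumMeasure d c V μV) (hac : μV ≪ volume) {M : ℝ} (hM0 : 0 ≤ M)
    (hM : ∀ᵐ x, density μV x ≤ M) : ∀ᵐ x, density μ x ≤ M + 2 := by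
  have hp := h.1.meanField.prob
  have hp' := hμV.1.prob
  have hlw := integrable_logWeight hc h.1.meanField.kernel
  have hlw' := integrable_logWeight hc hμV.1.kernel
  obtain ⟨κ, hκ, hgibbs⟩ := h.gibbs hd hc hV hθ
  obtain ⟨C, hC, hCeq⟩ := hμV.eulerLagrange hd hc hV hac
  set u : Rd d → ℝ := fun x => potential d c μV x - potential d c μ x with hu
  have hum : Measurable u := (measurable_potential d c μV).sub (measurable_potential d c μ)
  have hup : ∀ᵐ x, density μ x ≤ κ * Real.exp (-θ * C) * Real.exp (θ * u x) := by
    filter_upwards [hgibbs, hC] with x h1 h2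
    rw [h1, mul_assoc, ← Real.exp_add]
    gcongr
    simp only [hu]
    nlinarith
  have hCeq' : ∀ᵐ x, density μV x ≠ 0 → potential d c μV x + V x = C := by
    have : μV = volume.withDensity (μV.rnDeriv volume) := (Measure.withDensity_rnDeriv_eq _ _ hac).symm
    rw [this, ae_withDensity_iff (Measure.measurable_rnDeriv _ _), ← this] at hCeq
    filter_upwards [hCeq] with x hx h0
    exact hx fun h1 => h0 (by simp [density, h1])
  have heq : ∀ᵐ x, density μV x ≠ 0 →
      density μ x = κ * Real.exp (-θ * C) * Real.exp (θ * u x) := by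
    filter_upwards [hgibbs, hCeq'] with x h1 h2 h3
    rw [h1, mul_assoc, ← Real.exp_add]
    congr 2
    simp only [hu]
    rw [← h2 h3]
    ring
  set D := κ * Real.exp (-θ * C) with hD
  have hD0 : 0 < D := mul_pos hκ (Real.exp_pos _)
  have hpos : ∀ᵐ x, 0 < density μ x := by
    filter_upwards [hgibbs] with x hx
    rw [hx]
    exact mul_pos hκ (Real.exp_pos _)
  -- a level `k ≠ 0` at which the Gibbs density is between `M + 1` and `M + 2`
  obtain ⟨k, hk0, hk1, hk2⟩ : ∃ k : ℝ, k ≠ 0 ∧ M < D * Real.exp (θ * k) ∧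
      D * Real.exp (θ * k) ≤ M + 2 := by
    have hlev : ∀ L : ℝ, 0 < L → D * Real.exp (θ * (Real.log (L / D) / θ)) = L := by
      intro L hL
      rw [mul_div_cancel₀ _ hθ.ne', Real.exp_log (by positivity)]
      field_simp
    -- The mass comparison requires a strictly positive level for `u` or for `-u`, so `k = 0` has to
    -- be avoided. If the value `M + 1` is reached at level zero, the value `M + 2` is not; this
    -- explains the constant `M + 2`.
    by_cases h1 : Real.log ((M + 1) / D) / θ = 0
    · refine ⟨Real.log ((M + 2) / D) / θ, ?_, ?_, ?_⟩
      · intro h2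
        have e1 := hlev (M + 1) (by linarith)
        have e2 := hlev (M + 2) (by linarith)
        rw [h1] at e1
        rw [h2] at e2
        linarith
      · rw [hlev _ (by linarith)]; linarith
      · rw [hlev _ (by linarith)]
    · refine ⟨_, h1, ?_, ?_⟩ <;> rw [hlev _ (by linarith)] <;> linarith
  -- sets where the first density is smaller are null as soon as they are charged more
  have hnull : ∀ O : Set (Rd d), MeasurableSet O → (∀ x ∈ O, k ≤ u x) → μ.real O ≤ μV.real O →
      volume O = 0 := by
    intro O hO hOk hle
    -- Where `μV` has density, equality in the Gibbs bound gives `density μ ≥ D exp(θ k) > M ≥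
    -- density μV`; elsewhere positivity of the Gibbs density suffices.
    have hlt : ∀ᵐ x, x ∈ O → 0 < density μ x - density μV x := by
      filter_upwards [hpos, heq, hM] with x h1 h2 h3 hx
      by_cases h0 : density μV x = 0
      · rw [h0, sub_zero]; exact h1
      · rw [h2 h0]
        have : D * Real.exp (θ * k) ≤ D * Real.exp (θ * u x) := by
          have := hOk x hx
          gcongr
        linarith
    have hi : Integrable fun x => density μ x - density μV x :=
      (integrable_density μ).sub (integrable_density μV)
    have hmass : ∀ (m : Measure (Rd d)) [IsFiniteMeasure m], m ≪ volume →
        ∫ x in O, density m x = m.real O := by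
      intro m _ hm
      have := setIntegral_density_mul hm (fun _ => (1 : ℝ)) hO
      simpa using this
    have h1 : ∫ x in O, (density μ x - density μV x) ≤ 0 := by
      rw [integral_sub (integrable_density μ).integrableOn (integrable_density μV).integrableOn,
        hmass μ h.1.ac, hmass μV hac]
      linarith
    have hae := (ae_restrict_iff' hO).2 hlt
    have hnn : 0 ≤ᵐ[volume.restrict O] fun x => density μ x - density μV x := by
      filter_upwards [hae] with x hx using hx.le
    have h2 := le_antisymm h1 (integral_nonneg_of_ae hnn)
    rw [integral_eq_zero_iff_of_nonneg_ae hnn hi.integrableOn] at h2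
    have h3 : ∀ᵐ _x ∂(volume.restrict O), False := by
      filter_upwards [hae, h2] with x hx hx2
      exact hx.ne' hx2
    rw [ae_iff] at h3
    simpa using h3
  have hfin : ∀ᵐ x, u x ≤ k := by
    -- For `k < 0` the mass comparison is applied to `-u` at level `-k`, and passing to complements
    -- of probability measures reverses it.
    rcases lt_or_gt_of_ne hk0 with hk | hk
    · have hm : MeasurableSet {x | k ≤ u x} := measurableSet_le measurable_const hum
      have hle := measureReal_potential_gt_le hd hc hlw hlw' h.1.ac hac (neg_pos.2 hk)
      have hset : {x | -k < potential d c μ x - potential d c μV x} = {x | k ≤ u x}ᶜ := by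
        ext x
        simp only [hu, Set.mem_ofPred_eq, Set.mem_compl_iff, not_le]
        constructor <;> intro h <;> linarith
      rw [hset, probReal_compl_eq_one_sub hm, probReal_compl_eq_one_sub hm] at hle
      have h0 := hnull _ hm (fun x hx => hx) (by linarith)
      have : ∀ᵐ x, ¬ k ≤ u x := by rw [ae_iff]; simpa using h0
      filter_upwards [this] with x hx using (not_le.1 hx).le
    · have hm : MeasurableSet {x | k < u x} := measurableSet_lt measurable_const hum
      have hle := measureReal_potential_gt_le hd hc hlw' hlw hac h.1.ac hk
      have h0 := hnull _ hm (fun x hx => (show k < u x from hx).le) hle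
      have : ∀ᵐ x, ¬ k < u x := by rw [ae_iff]; simpa using h0
      filter_upwards [this] with x hx using not_lt.1 hx
  filter_upwards [hup, hfin] with x h1 h2
  refine h1.trans (le_trans ?_ hk2)
  gcongr

end Thermal

/-! ### The quadratic form `G` in terms of mutual energies -/

section CoulombG

variable {d : ℕ} {c : ℝ} {μ ν : Measure (Rd d)}

/-- A consequence of the conventions `log 0 = 0` and `c / 0 = 0`. It makes the exclusion of the
diagonal automatic in every integral of the kernel. -/
theorem coulombKernel_zero (hd : 2 ≤ d) (c : ℝ) : coulombKernel d c 0 = 0 := by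
  unfold coulombKernel
  split_ifs with h
  · simp
  · simp [show d - 2 ≠ 0 by omega]

theorem setLIntegral_diagonal_compl {f : Rd d → ℝ} (hf : f 0 = 0) (m : Measure (Rd d × Rd d)) :
    ∫⁻ z in (Set.diagonal (Rd d))ᶜ, ENNReal.ofReal (f (z.1 - z.2)) ∂m =
      ∫⁻ z, ENNReal.ofReal (f (z.1 - z.2)) ∂m := by
  rw [← lintegral_indicator isClosed_diagonal.measurableSet.compl]
  congr 1; ext z
  by_cases hz : z ∈ Set.diagonal (Rd d)
  · have : z.1 - z.2 = 0 := sub_eq_zero.2 hz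
    rw [Set.indicator_of_notMem (by simpa using hz), this, hf, ENNReal.ofReal_zero]
  · rw [Set.indicator_of_mem hz]

theorem lintegral_ofReal_lt_top {α : Type*} [MeasurableSpace α] {m : Measure α} {f : α → ℝ}
    (hf : Integrable f m) : ∫⁻ z, ENNReal.ofReal (f z) ∂m < ⊤ :=
  (lintegral_mono fun z => Real.ofReal_le_enorm (f z)).trans_lt hf.2

/-- If the Coulomb kernel is integrable against all four products, then `coulombG` is a real
number. -/
theorem coulombG_eq (hd : 2 ≤ d) [SFinite μ] [SFinite ν]
    (h1 : Integrable (fun z : Rd d × Rd d => coulombKernel d c (z.1 - z.2)) (μ.prod μ))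
    (h2 : Integrable (fun z : Rd d × Rd d => coulombKernel d c (z.1 - z.2)) (ν.prod ν))
    (h3 : Integrable (fun z : Rd d × Rd d => coulombKernel d c (z.1 - z.2)) (μ.prod ν)) :
    coulombG d c μ ν =
      ((mutualEnergy d c μ μ + mutualEnergy d c ν ν - 2 * mutualEnergy d c μ ν : ℝ) : EReal) := by
  have h4 := integrable_coulombKernel_prod_comm h3
  have hp := h1.add_measure h2
  have hq := h3.add_measure h4
  have e1 : offDiagPos (coulombKernel d c) μ ν =
      (∫⁻ z, ENNReal.ofReal (coulombKernel d c (z.1 - z.2)) ∂(μ.prod μ + ν.prod ν)) +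
        ∫⁻ z, ENNReal.ofReal (-coulombKernel d c (z.1 - z.2)) ∂(μ.prod ν + ν.prod μ) := by
    unfold offDiagPos
    rw [setLIntegral_diagonal_compl (coulombKernel_zero hd c),
      setLIntegral_diagonal_compl (f := fun x => -coulombKernel d c x)
        (by simp [coulombKernel_zero hd c])]
  have e2 : offDiagPos (fun x => -coulombKernel d c x) μ ν =
      (∫⁻ z, ENNReal.ofReal (-coulombKernel d c (z.1 - z.2)) ∂(μ.prod μ + ν.prod ν)) +
        ∫⁻ z, ENNReal.ofReal (coulombKernel d c (z.1 - z.2)) ∂(μ.prod ν + ν.prod μ) := by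
    unfold offDiagPos
    simp only [neg_neg]
    rw [setLIntegral_diagonal_compl (coulombKernel_zero hd c),
      setLIntegral_diagonal_compl (f := fun x => -coulombKernel d c x)
        (by simp [coulombKernel_zero hd c])]
  have f1 := (lintegral_ofReal_lt_top hp).ne
  have f2 := (lintegral_ofReal_lt_top hp.neg).ne
  have f3 := (lintegral_ofReal_lt_top hq).ne
  have f4 := (lintegral_ofReal_lt_top hq.neg).ne
  simp only [Pi.neg_apply] at f2 f4
  have g1 : offDiagPos (coulombKernel d c) μ ν ≠ ⊤ := by
    rw [e1]; exact ENNReal.add_ne_top.2 ⟨f1, f4⟩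
  have g2 : offDiagPos (fun x => -coulombKernel d c x) μ ν ≠ ⊤ := by
    rw [e2]; exact ENNReal.add_ne_top.2 ⟨f2, f3⟩
  unfold coulombG
  rw [if_neg (fun h => g1 h.1), ← EReal.coe_ennreal_toReal g1, ← EReal.coe_ennreal_toReal g2,
    ← EReal.coe_sub, e1, e2, ENNReal.toReal_add f1 f4, ENNReal.toReal_add f2 f3]
  have i1 := integral_eq_lintegral_pos_part_sub_lintegral_neg_part hp
  have i2 := integral_eq_lintegral_pos_part_sub_lintegral_neg_part hq
  rw [integral_add_measure h1 h2] at i1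
  rw [integral_add_measure h3 h4] at i2
  have hcomm := mutualEnergy_comm (d := d) (c := c) (μ := ν) (ν := μ)
  unfold mutualEnergy at hcomm ⊢
  congr 1
  linarith

end CoulombG

/-! ### Averages of `N` measures -/

section Average

variable {d : ℕ} {c : ℝ} {N : ℕ}

/-- The average of `N` measures. -/
noncomputable def averageMeasure (m : Fin N → Measure (Rd d)) : Measure (Rd d) :=
  (N : ℝ≥0∞)⁻¹ • ∑ i, m i

theorem isProbabilityMeasure_averageMeasure (hN : N ≠ 0) (m : Fin N → Measure (Rd d))
    [∀ i, IsProbabilityMeasure (m i)] : IsProbabilityMeasure (averageMeasure m) := by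
  refine ⟨?_⟩
  simp only [averageMeasure, Measure.smul_apply, Measure.finsetSum_apply, measure_univ,
    Finset.sum_const, Finset.card_univ, Fintype.card_fin, nsmul_eq_mul, mul_one, smul_eq_mul]
  exact ENNReal.inv_mul_cancel (by simpa using hN) (ENNReal.natCast_ne_top N)

theorem integral_averageMeasure {m : Fin N → Measure (Rd d)} {f : Rd d → ℝ}
    (hf : ∀ i, Integrable f (m i)) :
    ∫ x, f x ∂averageMeasure m = (N : ℝ)⁻¹ * ∑ i, ∫ x, f x ∂m i := by
  rw [averageMeasure, integral_smul_measure, integral_finsetSum_measure fun i _ => hf i]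
  simp

theorem finset_sum_measure_prod {ι : Type*} (s : Finset ι) (m : ι → Measure (Rd d))
    [∀ i, IsFiniteMeasure (m i)] (ν : Measure (Rd d)) [SFinite ν] :
    (∑ i ∈ s, m i).prod ν = ∑ i ∈ s, (m i).prod ν := by
  classical
  induction s using Finset.induction_on with
  | empty => simp
  | insert a s ha ih => rw [Finset.sum_insert ha, Finset.sum_insert ha, Measure.add_prod, ih]

theorem integrable_averageMeasure_prod (hN : N ≠ 0) {m : Fin N → Measure (Rd d)}
    [∀ i, IsFiniteMeasure (m i)] {ν : Measure (Rd d)} [SFinite ν] {f : Rd d × Rd d → ℝ}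
    (hf : ∀ i, Integrable f ((m i).prod ν)) : Integrable f ((averageMeasure m).prod ν) := by
  rw [averageMeasure, Measure.prod_smul_left, finset_sum_measure_prod]
  exact (integrable_finsetSum_measure.2 fun i _ => hf i).smul_measure (by simpa using hN)

theorem mutualEnergy_averageMeasure (hN : N ≠ 0) {m : Fin N → Measure (Rd d)}
    [∀ i, IsProbabilityMeasure (m i)] {ν : Measure (Rd d)} [IsFiniteMeasure ν]
    (hf : ∀ i, Integrable (fun z : Rd d × Rd d => coulombKernel d c (z.1 - z.2)) ((m i).prod ν)) :
    mutualEnergy d c (averageMeasure m) ν = (N : ℝ)⁻¹ * ∑ i, mutualEnergy d c (m i) ν := by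
  have := isProbabilityMeasure_averageMeasure hN m
  have h1 := integrable_averageMeasure_prod hN hf
  rw [mutualEnergy_comm, mutualEnergy_eq_integral_potential (integrable_coulombKernel_prod_comm h1),
    integral_averageMeasure fun i =>
      integrable_potential_of_prod (integrable_coulombKernel_prod_comm (hf i))]
  congr 1
  refine Finset.sum_congr rfl fun i _ => ?_
  rw [mutualEnergy_comm, mutualEnergy_eq_integral_potential (integrable_coulombKernel_prod_comm (hf i))]

/-- `coulombG` for an average of probability measures. -/
theorem coulombG_averageMeasure (hd : 2 ≤ d) (hN : N ≠ 0) {m : Fin N → Measure (Rd d)}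
    [∀ i, IsProbabilityMeasure (m i)] {ν : Measure (Rd d)} [IsFiniteMeasure ν]
    (hm : ∀ i j, Integrable (fun z : Rd d × Rd d => coulombKernel d c (z.1 - z.2)) ((m i).prod (m j)))
    (hν : Integrable (fun z : Rd d × Rd d => coulombKernel d c (z.1 - z.2)) (ν.prod ν))
    (hmν : ∀ i, Integrable (fun z : Rd d × Rd d => coulombKernel d c (z.1 - z.2)) ((m i).prod ν)) :
    coulombG d c (averageMeasure m) ν =
      (((N : ℝ)⁻¹ * (∑ i, (N : ℝ)⁻¹ * ∑ j, mutualEnergy d c (m i) (m j)) + mutualEnergy d c ν ν -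
        2 * ((N : ℝ)⁻¹ * ∑ i, mutualEnergy d c (m i) ν) : ℝ) : EReal) := by
  have := isProbabilityMeasure_averageMeasure hN m
  have h1 : ∀ i, Integrable (fun z : Rd d × Rd d => coulombKernel d c (z.1 - z.2))
      ((m i).prod (averageMeasure m)) := fun i =>
    integrable_coulombKernel_prod_comm (integrable_averageMeasure_prod hN fun j => hm j i)
  rw [coulombG_eq hd (integrable_averageMeasure_prod hN h1) hν (integrable_averageMeasure_prod hN hmν),
    mutualEnergy_averageMeasure hN h1, mutualEnergy_averageMeasure hN hmν]
  have h2 : ∀ i, mutualEnergy d c (m i) (averageMeasure m) =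
      (N : ℝ)⁻¹ * ∑ j, mutualEnergy d c (m i) (m j) := by
    intro i
    rw [mutualEnergy_comm, mutualEnergy_averageMeasure hN fun j => hm j i]
    congr 1
    exact Finset.sum_congr rfl fun j _ => mutualEnergy_comm
  simp_rw [h2]

end Average

/-! ### Gaussian charges and their interaction -/

section Smear

variable {d : ℕ} {c t : ℝ}

/-- The Gaussian measure centred at `x`. -/
noncomputable def heatAt (d : ℕ) (t : ℝ) (x : Rd d) : Measure (Rd d) :=
  (heatMeasure d t).map fun z => x - z

theorem measurable_const_sub_id (x : Rd d) : Measurable fun z : Rd d => x - z := by fun_prop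

theorem isProbabilityMeasure_heatAt (ht : 0 < t) (x : Rd d) : IsProbabilityMeasure (heatAt d t x) :=
  have := isProbabilityMeasure_heatMeasure (d := d) ht
  Measure.isProbabilityMeasure_map (measurable_const_sub_id x).aemeasurable

theorem map_const_sub_volume (x : Rd d) :
    (volume : Measure (Rd d)).map (fun z => x - z) = volume :=
  (Measure.measurePreserving_sub_left volume x).map_eq

theorem heatAt_absolutelyContinuous (x : Rd d) : heatAt d t x ≪ volume := by
  have h := (heatMeasure_absolutelyContinuous d t).map (measurable_const_sub_id x)
  rwa [map_const_sub_volume] at h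

theorem heatAt_le (ht : 0 < t) (x : Rd d) :
    heatAt d t x ≤ ((4 * Real.pi * t) ^ (-(d / 2 : ℝ))).toNNReal • (volume : Measure (Rd d)) := by
  have h := Measure.map_mono (heatMeasure_le (d := d) ht) (measurable_const_sub_id x)
  rwa [Measure.map_smul, map_const_sub_volume] at h

theorem integral_heatAt {f : Rd d → ℝ} (hf : Measurable f) (x : Rd d) :
    ∫ w, f w ∂heatAt d t x = ∫ z, f (x - z) ∂heatMeasure d t :=
  integral_map (measurable_const_sub_id x).aemeasurable hf.aestronglyMeasurable

theorem integrable_heatAt_iff {f : Rd d → ℝ} (hf : Measurable f) (x : Rd d) :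
    Integrable f (heatAt d t x) ↔ Integrable (fun z => f (x - z)) (heatMeasure d t) :=
  integrable_map_measure hf.aestronglyMeasurable (measurable_const_sub_id x).aemeasurable

theorem integrable_logWeight_heatAt (hc : 0 < c) (ht : 0 < t) (x : Rd d) :
    Integrable (logWeight d c) (heatAt d t x) := by
  have := isProbabilityMeasure_heatMeasure (d := d) ht
  rw [integrable_heatAt_iff (measurable_logWeight d c)]
  refine ((integrable_const (logWeight d c x)).add (integrable_logWeight_heatMeasure hc ht)).mono'
    ((measurable_logWeight d c).comp (measurable_const_sub_id x)).aestronglyMeasurable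
    (Eventually.of_forall fun z => ?_)
  rw [Real.norm_of_nonneg (logWeight_nonneg hc _)]
  exact logWeight_sub_le hc x z

theorem integrable_heatAt_prod (hd : 2 ≤ d) (hc : 0 < c) (ht : 0 < t) (x : Rd d)
    {ν : Measure (Rd d)} [IsFiniteMeasure ν] (hν : Integrable (logWeight d c) ν) :
    Integrable (fun z : Rd d × Rd d => coulombKernel d c (z.1 - z.2)) ((heatAt d t x).prod ν) :=
  have := isProbabilityMeasure_heatAt (d := d) ht x
  integrable_coulombKernel_prod hd hc (heatAt_le ht x) (integrable_logWeight_heatAt hc ht x) hν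

theorem potential_heatAt (x w : Rd d) :
    potential d c (heatAt d t x) w = ∫ z, coulombKernel d c ((x - w) - z) ∂heatMeasure d t := by
  unfold potential
  rw [integral_heatAt (f := fun y => coulombKernel d c (w - y))
    ((measurable_coulombKernel d c).comp (measurable_const_sub_id w))]
  congr 1; ext z
  rw [coulombKernel_sub_comm]
  congr 1
  abel

/-- The self-energy scale of the Gaussian measure. -/
noncomputable def heatSelf (d : ℕ) (c t : ℝ) : ℝ := ∫ z, coulombKernel d c z ∂heatMeasure d t

theorem integral_coulombKernel_heatMeasure_le (hd : 2 ≤ d) (hc : 0 < c) (ht : 0 < t) {x : Rd d}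
    (hx : x ≠ 0) : ∫ z, coulombKernel d c (x - z) ∂heatMeasure d t ≤ coulombKernel d c x := by
  obtain ⟨κ, hκ, h⟩ := exists_integral_coulombKernel_heatMeasure hd hc
  rw [h t ht x hx]
  have : 0 ≤ heatTime d t x := heatTime_nonneg d t x
  unfold heatTime at this
  nlinarith

/-- Concentrating one of the two Gaussians at its centre can only raise the energy. The other stays
smeared, so that `x = y` is allowed and then yields `heatSelf`. -/
theorem mutualEnergy_heatAt_le (hd : 2 ≤ d) (hc : 0 < c) (ht : 0 < t) (x y : Rd d) :
    mutualEnergy d c (heatAt d t x) (heatAt d t y) ≤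
      ∫ z, coulombKernel d c ((y - x) - z) ∂heatMeasure d t := by
  have := isProbabilityMeasure_heatAt (d := d) ht x
  have := isProbabilityMeasure_heatAt (d := d) ht y
  have := isProbabilityMeasure_heatMeasure (d := d) ht
  have := nontrivial_Rd hd
  have hi := integrable_heatAt_prod hd hc ht x (integrable_logWeight_heatAt hc ht y)
  have hpi := integrable_potential_of_prod hi
  rw [mutualEnergy_eq_integral_potential hi]
  have hm' : Integrable (fun w => coulombKernel d c (x - w)) (heatAt d t y) :=
    integrable_coulombKernel_sub hd hc (heatAt_le ht y) (integrable_logWeight_heatAt hc ht y) x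
  have h1 : ∫ w, potential d c (heatAt d t x) w ∂heatAt d t y ≤
      ∫ w, coulombKernel d c (x - w) ∂heatAt d t y := by
    refine integral_mono_ae hpi hm' ?_
    refine (heatAt_absolutelyContinuous y).ae_le ?_
    filter_upwards [Measure.ae_ne volume x] with w hw
    rw [potential_heatAt]
    exact integral_coulombKernel_heatMeasure_le hd hc ht (sub_ne_zero.2 hw.symm)
  have h2 : ∫ w, coulombKernel d c (x - w) ∂heatAt d t y = potential d c (heatAt d t y) x := rfl
  rw [h2, potential_heatAt] at h1
  exact h1

end Smear

/-! ### Energies of point charges -/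

section Dirac

variable {d : ℕ} {c : ℝ}

theorem integrable_dirac_prod {ν : Measure (Rd d)} [SFinite ν] {x : Rd d}
    (h : Integrable (fun y => coulombKernel d c (x - y)) ν) :
    Integrable (fun z : Rd d × Rd d => coulombKernel d c (z.1 - z.2)) ((Measure.dirac x).prod ν) := by
  rw [Measure.dirac_prod, integrable_map_measure (measurable_coulombKernel_sub d c).aestronglyMeasurable
    (by fun_prop)]
  exact h

theorem mutualEnergy_dirac {ν : Measure (Rd d)} [SFinite ν] {x : Rd d}
    (h : Integrable (fun y => coulombKernel d c (x - y)) ν) :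
    mutualEnergy d c (Measure.dirac x) ν = potential d c ν x := by
  rw [mutualEnergy_comm, mutualEnergy_eq_integral_potential
    (integrable_coulombKernel_prod_comm (integrable_dirac_prod h)), integral_dirac]

/-- For `x = y` and `2 ≤ d` this is the default value `0`, so double sums over point charges omit
self-interaction by themselves. -/
theorem mutualEnergy_dirac_dirac (x y : Rd d) :
    mutualEnergy d c (Measure.dirac x) (Measure.dirac y) = coulombKernel d c (x - y) := by
  rw [mutualEnergy_dirac (integrable_dirac (by finiteness)), potential, integral_dirac]

end Dirac

/-! ### Energy comparison between point charges and Gaussian charges -/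

section Comparison

variable {d : ℕ} {c t : ℝ} {N : ℕ}

/-- Smearing lowers the interaction by `κ ∫ heatTime d t (x - y) dν(y)`, and the density bound `L`
together with `∫ heatTime = t` controls this loss. Here the boundedness of the thermal equilibrium
density becomes quantitative. -/
theorem le_mutualEnergy_heatAt (hd : 2 ≤ d) (hc : 0 < c) (ht : 0 < t) {κ : ℝ} (hκ : 0 < κ)
    (hκt : ∀ x : Rd d, x ≠ 0 → ∫ z, coulombKernel d c (x - z) ∂heatMeasure d t =
      coulombKernel d c x - κ * heatTime d t x)
    {ν : Measure (Rd d)} [IsFiniteMeasure ν] (hν : Integrable (logWeight d c) ν) {L : ℝ≥0}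
    (hL : ν ≤ L • (volume : Measure (Rd d))) (x : Rd d) :
    potential d c ν x - κ * (L * t) ≤ mutualEnergy d c (heatAt d t x) ν := by
  have := isProbabilityMeasure_heatAt (d := d) ht x
  have hac : ν ≪ volume := (Measure.absolutelyContinuous_of_le hL).trans
    (Measure.AbsolutelyContinuous.rfl.smul_left L)
  have hi := integrable_coulombKernel_prod_comm (integrable_heatAt_prod hd hc ht x hν)
  rw [mutualEnergy_comm, mutualEnergy_eq_integral_potential hi,
    integral_heatAt (measurable_potential d c ν),
    (integral_potential_heatMeasure hd hc hκ ht hκt hν hac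
      (integrable_coulombKernel_sub hd hc hL hν x)).2]
  have h1 : ∫ y, heatTime d t (x - y) ∂ν ≤ L * t := by
    have h2 : Integrable (fun y => heatTime d t (x - y)) (L • (volume : Measure (Rd d))) :=
      ((integrable_heatTime d t).comp_sub_left x).smul_measure_nnreal
    refine (integral_mono_measure hL (Eventually.of_forall fun _ => heatTime_nonneg _ _ _) h2).trans
      (le_of_eq ?_)
    rw [integral_smul_nnreal_measure, integral_sub_left_eq_self (heatTime d t), integral_heatTime ht]
    rfl
  have h3 := mul_le_mul_of_nonneg_left h1 hκ.le
  linarith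

theorem average_const (hN : N ≠ 0) (a : ℝ) : (N : ℝ)⁻¹ * ∑ _i : Fin N, a = a := by
  have : (N : ℝ) ≠ 0 := by exact_mod_cast hN
  simp [this]

/-- Replacing point charges by Gaussian charges raises the energy by little. -/
theorem coulombG_heatAt_le (hd : 2 ≤ d) (hc : 0 < c) (ht : 0 < t) (hN : N ≠ 0) {κ : ℝ} (hκ : 0 < κ)
    (hκt : ∀ x : Rd d, x ≠ 0 → ∫ z, coulombKernel d c (x - z) ∂heatMeasure d t =
      coulombKernel d c x - κ * heatTime d t x)
    {ν : Measure (Rd d)} [IsFiniteMeasure ν] (hν : Integrable (logWeight d c) ν) {L : ℝ≥0}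
    (hL : ν ≤ L • (volume : Measure (Rd d))) {x : Fin N → Rd d} (hx : Function.Injective x) :
    ∃ a b : ℝ, coulombG d c (averageMeasure fun i => heatAt d t (x i)) ν = a ∧
      coulombG d c (averageMeasure fun i => Measure.dirac (x i)) ν = b ∧
      a ≤ b + ((N : ℝ)⁻¹ * heatSelf d c t + 2 * (κ * (L * t))) := by
  have hp : ∀ i, IsProbabilityMeasure (heatAt d t (x i)) := fun i => isProbabilityMeasure_heatAt ht _
  have hνν := integrable_coulombKernel_prod hd hc hL hν hν
  have hdir : ∀ y : Rd d, Integrable (fun w => coulombKernel d c (y - w)) ν :=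
    integrable_coulombKernel_sub hd hc hL hν
  refine ⟨_, _, coulombG_averageMeasure hd hN
      (fun i j => integrable_heatAt_prod hd hc ht (x i) (integrable_logWeight_heatAt hc ht (x j))) hνν
      (fun i => integrable_heatAt_prod hd hc ht (x i) hν),
    coulombG_averageMeasure hd hN
      (fun i j => integrable_dirac_prod (integrable_dirac (by finiteness))) hνν
      (fun i => integrable_dirac_prod (hdir _)), ?_⟩
  have hN0 : (0 : ℝ) ≤ (N : ℝ)⁻¹ := by positivity
  have e1 : ∀ i, mutualEnergy d c (Measure.dirac (x i)) ν = potential d c ν (x i) := fun i =>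
    mutualEnergy_dirac (hdir _)
  simp_rw [e1, mutualEnergy_dirac_dirac]
  -- Off-diagonal pairs, at distinct points, do not gain energy; each of the `N` diagonal pairs
  -- costs at most `heatSelf`, which after the weight `N⁻²` gives `N⁻¹ * heatSelf`.
  have h1 : ∀ i j, mutualEnergy d c (heatAt d t (x i)) (heatAt d t (x j)) ≤
      coulombKernel d c (x i - x j) + if i = j then heatSelf d c t else 0 := by
    intro i j
    refine (mutualEnergy_heatAt_le hd hc ht (x i) (x j)).trans ?_
    by_cases hij : i = j
    · subst hij
      simp only [sub_self, zero_sub, if_true, coulombKernel_neg, coulombKernel_zero hd, zero_add]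
      exact le_rfl
    · rw [if_neg hij, add_zero, coulombKernel_sub_comm d c (x i)]
      exact integral_coulombKernel_heatMeasure_le hd hc ht
        (sub_ne_zero.2 fun h => hij (hx h).symm)
  have h2 : (N : ℝ)⁻¹ * (∑ i, (N : ℝ)⁻¹ *
        ∑ j, mutualEnergy d c (heatAt d t (x i)) (heatAt d t (x j))) ≤
      (N : ℝ)⁻¹ * (∑ i, (N : ℝ)⁻¹ * ∑ j, coulombKernel d c (x i - x j)) +
        (N : ℝ)⁻¹ * heatSelf d c t := by
    calc _ ≤ (N : ℝ)⁻¹ * (∑ i, (N : ℝ)⁻¹ * ∑ j, (coulombKernel d c (x i - x j) +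
          if i = j then heatSelf d c t else 0)) := by
          gcongr with i _ j _
          exact h1 i j
      _ = (N : ℝ)⁻¹ * (∑ i, (N : ℝ)⁻¹ * ∑ j, coulombKernel d c (x i - x j)) +
          (N : ℝ)⁻¹ * ∑ _i : Fin N, (N : ℝ)⁻¹ * heatSelf d c t := by
          simp only [Finset.sum_add_distrib, Finset.sum_ite_eq, Finset.mem_univ, if_true, mul_add]
      _ = _ := by rw [average_const hN]
  have h3 : (N : ℝ)⁻¹ * (∑ i, potential d c ν (x i)) - κ * (L * t) ≤
      (N : ℝ)⁻¹ * ∑ i, mutualEnergy d c (heatAt d t (x i)) ν := by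
    calc _ = (N : ℝ)⁻¹ * ∑ i, (potential d c ν (x i) - κ * (L * t)) := by
          rw [Finset.sum_sub_distrib, mul_sub, average_const hN]
      _ ≤ _ := by
          gcongr with i _
          exact le_mutualEnergy_heatAt hd hc ht hκ hκt hν hL (x i)
  linarith

end Comparison

/-! ### Effect of smearing on the bounded Lipschitz distance -/

section BoundedLipschitz

variable {d : ℕ} {t : ℝ} {N : ℕ}

theorem integrable_of_abs_le_one {μ : Measure (Rd d)} [IsFiniteMeasure μ] {f : Rd d → ℝ}
    (hf : ∀ x, |f x| ≤ 1) (hL : LipschitzWith 1 f) : Integrable f μ :=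
  (integrable_const (1 : ℝ)).mono' hL.continuous.aestronglyMeasurable (Eventually.of_forall hf)

theorem abs_integral_le_one {μ : Measure (Rd d)} [IsProbabilityMeasure μ] {f : Rd d → ℝ}
    (hf : ∀ x, |f x| ≤ 1) : |∫ x, f x ∂μ| ≤ 1 := by
  simpa using norm_integral_le_of_norm_le_const (μ := μ) (f := f) (C := 1) (Eventually.of_forall hf)

theorem le_blDist {μ ν : Measure (Rd d)} [IsProbabilityMeasure μ] [IsProbabilityMeasure ν]
    {f : Rd d → ℝ} (hf : ∀ x, |f x| ≤ 1) (hL : LipschitzWith 1 f) :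
    (∫ x, f x ∂μ) - ∫ x, f x ∂ν ≤ blDist μ ν := by
  refine le_csSup ⟨2, ?_⟩ ⟨f, hf, hL, rfl⟩
  rintro r ⟨g, hg, -, rfl⟩
  have h1 := abs_le.1 (abs_integral_le_one (μ := μ) hg)
  have h2 := abs_le.1 (abs_integral_le_one (μ := ν) hg)
  linarith

theorem blDist_nonneg {μ ν : Measure (Rd d)} [IsProbabilityMeasure μ] [IsProbabilityMeasure ν] :
    0 ≤ blDist μ ν := by
  have := le_blDist (μ := μ) (ν := ν) (f := fun _ => 0) (by simp) (LipschitzWith.const' 0)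
  simpa using this

/-- Coupling each Gaussian with its centre, a test function with Lipschitz constant one changes its
average by at most the mean displacement. -/
theorem blDist_heatAt (hN : N ≠ 0) (ht : 0 < t) (hm : Integrable (fun z => ‖z‖) (heatMeasure d t))
    {μ : Measure (Rd d)} [IsProbabilityMeasure μ] (x : Fin N → Rd d) :
    blDist μ (averageMeasure fun i => Measure.dirac (x i)) ≤
      blDist μ (averageMeasure fun i => heatAt d t (x i)) + ∫ z, ‖z‖ ∂heatMeasure d t := by
  have hp : ∀ i, IsProbabilityMeasure (heatAt d t (x i)) := fun i => isProbabilityMeasure_heatAt ht _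
  have hp' := isProbabilityMeasure_averageMeasure hN fun i => heatAt d t (x i)
  have hpm := isProbabilityMeasure_heatMeasure (d := d) ht
  refine csSup_le ⟨_, fun _ => 0, by simp, LipschitzWith.const' 0, rfl⟩ ?_
  rintro r ⟨f, hf, hL, rfl⟩
  have h1 := le_blDist (μ := μ) (ν := averageMeasure fun i => heatAt d t (x i)) hf hL
  have h2 : ∀ i, ∫ w, f w ∂heatAt d t (x i) ≤ f (x i) + ∫ z, ‖z‖ ∂heatMeasure d t := by
    intro i
    have hi : Integrable (fun z => f (x i - z)) (heatMeasure d t) :=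
      (integrable_heatAt_iff hL.continuous.measurable (x i)).1 (integrable_of_abs_le_one hf hL)
    have e : f (x i) + ∫ z, ‖z‖ ∂heatMeasure d t = ∫ z, (f (x i) + ‖z‖) ∂heatMeasure d t := by
      rw [integral_add (integrable_const _) hm, integral_const, probReal_univ, one_smul]
    rw [integral_heatAt hL.continuous.measurable, e]
    refine integral_mono hi ((integrable_const _).add hm) fun z => ?_
    have h := hL.dist_le_mul (x i - z) (x i)
    rw [Real.dist_eq, dist_eq_norm] at h
    simp only [NNReal.coe_one, one_mul, sub_sub_cancel_left, norm_neg] at h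
    have := (abs_le.1 h).2
    linarith
  rw [integral_averageMeasure fun i => integrable_of_abs_le_one hf hL] at h1 ⊢
  simp only [integral_dirac]
  have h3 : (N : ℝ)⁻¹ * (∑ i, ∫ w, f w ∂heatAt d t (x i)) ≤
      (N : ℝ)⁻¹ * (∑ i, f (x i)) + ∫ z, ‖z‖ ∂heatMeasure d t := by
    calc _ ≤ (N : ℝ)⁻¹ * ∑ i, (f (x i) + ∫ z, ‖z‖ ∂heatMeasure d t) := by
          gcongr with i _
          exact h2 i
      _ = _ := by rw [Finset.sum_add_distrib, mul_add, average_const hN]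
  linarith

end BoundedLipschitz

/-! ### Scaling of the Gaussian self-energy and first moment -/

section Scaling

variable {d : ℕ} {c r : ℝ}

/-- The logarithm turns scaling into an additive term; for `r` of order `N^{-1/2}` it is the source
of the logarithmic error in dimension two. -/
theorem heatSelf_two (hc : 0 < c) (hr : 0 < r) :
    heatSelf 2 c (r ^ 2) = -c * Real.log r + heatSelf 2 c 1 := by
  have hp := isProbabilityMeasure_heatMeasure (d := 2) one_pos
  have hi : Integrable (coulombKernel 2 c) (heatMeasure 2 1) := by
    have := integrable_coulombKernel_sub_heatMeasure le_rfl hc one_pos (0 : Rd 2)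
    simpa [coulombKernel_neg] using this
  unfold heatSelf
  rw [integral_heatMeasure_scale hr]
  have h : ∀ᵐ z ∂heatMeasure 2 1, coulombKernel 2 c (r • z) = -c * Real.log r + coulombKernel 2 c z := by
    refine (heatMeasure_absolutelyContinuous 2 1).ae_le ?_
    filter_upwards [Measure.ae_ne volume (0 : Rd 2)] with z hz
    simp only [coulombKernel, if_true, norm_smul, Real.norm_of_nonneg hr.le]
    rw [Real.log_mul hr.ne' (norm_ne_zero_iff.2 hz)]
    ring
  rw [integral_congr_ae h, integral_add (integrable_const _) hi, integral_const, probReal_univ, one_smul]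

theorem heatSelf_of_ne_two (h2 : d ≠ 2) (hr : 0 < r) :
    heatSelf d c (r ^ 2) = (r ^ (d - 2))⁻¹ * heatSelf d c 1 := by
  unfold heatSelf
  rw [integral_heatMeasure_scale hr, ← integral_const_mul]
  congr 1; ext z
  simp only [coulombKernel, if_neg h2, norm_smul, Real.norm_of_nonneg hr.le, mul_pow]
  rw [div_mul_eq_div_div_swap, div_eq_inv_mul (c / ‖z‖ ^ (d - 2))]

theorem integral_norm_heatMeasure_scale (hr : 0 < r) :
    Integrable (fun z => ‖z‖) (heatMeasure d (r ^ 2)) ∧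
      ∫ z, ‖z‖ ∂heatMeasure d (r ^ 2) = r * ∫ z, ‖z‖ ∂heatMeasure d 1 := by
  rw [integrable_heatMeasure_scale hr, integral_heatMeasure_scale hr, ← integral_const_mul]
  simp only [norm_smul, Real.norm_of_nonneg hr.le]
  exact ⟨(integrable_norm_heatMeasure d).const_mul r, trivial⟩

end Scaling

/-! ### From the smeared competitor to the inequality of infima -/

section Main

variable {d : ℕ} {c : ℝ}

theorem le_smul_volume_of_density_le {μ : Measure (Rd d)} [IsFiniteMeasure μ] (hac : μ ≪ volume)
    {L : ℝ} (hL : ∀ᵐ x, density μ x ≤ L) : μ ≤ L.toNNReal • (volume : Measure (Rd d)) := by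
  rw [← Measure.withDensity_rnDeriv_eq μ volume hac]
  have : L.toNNReal • (volume : Measure (Rd d)) = volume.withDensity fun _ => (L.toNNReal : ℝ≥0∞) := by
    rw [withDensity_const]; rfl
  rw [this]
  refine withDensity_mono ?_
  filter_upwards [hL, Measure.rnDeriv_lt_top μ volume] with x hx hx'
  rw [← ENNReal.ofReal_toReal hx'.ne]
  exact ENNReal.ofReal_le_ofReal hx

theorem density_le_of_essSup_le {μ : Measure (Rd d)} {M : ℝ≥0}
    (h : essSup (μ.rnDeriv volume) volume ≤ (M : ℝ≥0∞)) : ∀ᵐ x, density μ x ≤ M := by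
  filter_upwards [ENNReal.ae_le_essSup (μ.rnDeriv volume)] with x hx
  exact ENNReal.toReal_le_coe_of_le_coe (hx.trans h)

/-- The absolutely continuous competitor built from an empirical measure. -/
theorem iInf_acMeasures_sub_le (hd : 2 ≤ d) (hc : 0 < c) {N : ℕ} (hN : N ≠ 0) {κ : ℝ} (hκ : 0 < κ)
    (hκt : ∀ t, 0 < t → ∀ x : Rd d, x ≠ 0 → ∫ z, coulombKernel d c (x - z) ∂heatMeasure d t =
      coulombKernel d c x - κ * heatTime d t x)
    {ν : Measure (Rd d)} [IsProbabilityMeasure ν] (hν : Integrable (logWeight d c) ν) {L : ℝ≥0}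
    (hL : ν ≤ L • (volume : Measure (Rd d))) {r k₁ ρ err : ℝ} (hr : 0 < r)
    (hrρ : r * ∫ z, ‖z‖ ∂heatMeasure d 1 ≤ 1 / ρ)
    (herr : (N : ℝ)⁻¹ * heatSelf d c (r ^ 2) + 2 * (κ * (L * r ^ 2)) ≤ err) :
    (⨅ μ ∈ (probMeasures d \ blBall ν (max (k₁ - 1) 0 / ρ)) ∩ acMeasures d, coulombG d c μ ν)
        - (err : EReal) ≤
      ⨅ μ ∈ (probMeasures d \ blBall ν (k₁ / ρ)) ∩ empiricalMeasures d N, coulombG d c μ ν := by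
  have hr2 : 0 < r ^ 2 := by positivity
  refine le_iInf₂ ?_
  rintro μ ⟨⟨hμp, hμb⟩, x, hx, rfl⟩
  have hp : ∀ i, IsProbabilityMeasure (heatAt d (r ^ 2) (x i)) :=
    fun i => isProbabilityMeasure_heatAt hr2 _
  have hpa := isProbabilityMeasure_averageMeasure hN fun i => heatAt d (r ^ 2) (x i)
  have hns := integral_norm_heatMeasure_scale (d := d) hr
  have hdist := blDist_heatAt hN hr2 hns.1 (μ := ν) x
  have hge : k₁ / ρ ≤ blDist ν (averageMeasure fun i => Measure.dirac (x i)) := by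
    by_contra! hlt
    exact hμb ⟨hμp, hlt⟩
  obtain ⟨a, b, ha, hb, hab⟩ := coulombG_heatAt_le hd hc hr2 hN hκ (hκt _ hr2) hν hL hx
  have hac : (averageMeasure fun i => heatAt d (r ^ 2) (x i)) ≪ volume := by
    refine Measure.AbsolutelyContinuous.smul_left ?_ _
    intro s hs
    rw [Measure.finsetSum_apply]
    exact Finset.sum_eq_zero fun i _ => heatAt_absolutelyContinuous (x i) hs
  have hmem : (averageMeasure fun i => heatAt d (r ^ 2) (x i)) ∈
      (probMeasures d \ blBall ν (max (k₁ - 1) 0 / ρ)) ∩ acMeasures d := by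
    refine ⟨⟨hpa, fun hball => ?_⟩, hpa, hac⟩
    refine absurd hball.2 (not_lt.2 ?_)
    -- Smearing moves the measure by at most `1/ρ`, which is the difference of the radii. If the
    -- radius is cut off at zero, the open ball contains no probability measure.
    rcases max_cases (k₁ - 1) 0 with h | h
    · rw [h.1, sub_div]
      rw [hns.2] at hdist
      linarith
    · rw [h.1, zero_div]
      exact blDist_nonneg
  change _ ≤ coulombG d c (averageMeasure fun i => Measure.dirac (x i)) ν
  rw [hb]
  calc _ ≤ (a : EReal) - (err : EReal) := by
        refine EReal.sub_le_sub ?_ le_rfl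
        rw [← ha]
        exact iInf₂_le _ hmem
    _ = ((a - err : ℝ) : EReal) := (EReal.coe_sub _ _).symm
    _ ≤ _ := EReal.coe_le_coe_iff.2 (by linarith)

end Main

theorem mainTheorem7 :
    ∃ k₂ : ℝ, 0 < k₂ ∧
      ∀ (d : ℕ), 2 ≤ d → ∀ (c : ℝ), 0 < c → ∀ (M : ℝ≥0), ∃ C : ℝ, 0 < C ∧
        ∀ (V : Rd d → ℝ) (μV : Measure (Rd d)),
          IsConfining d c V → IsEquilibriumMeasure d c V μV →
          IsCompact μV.support → μV ≪ volume → essSup (μV.rnDeriv volume) volume ≤ (M : ℝ≥0∞) →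
        ∀ (N : ℕ) (β : ℝ) (μβ : Measure (Rd d)),
          1 ≤ N → 0 < β → IsThermalEquilibrium d c V (N * β) μβ →
        ∀ k₁ : ℝ,
          (3 ≤ d →
            (⨅ μ ∈ (probMeasures d \ blBall μβ (max (k₁ - k₂) 0 / (N : ℝ) ^ (1 / (d : ℝ)))) ∩
                acMeasures d, coulombG d c μ μβ)
                - ((C / (N : ℝ) ^ (2 / (d : ℝ)) : ℝ) : EReal)
              ≤ ⨅ μ ∈ (probMeasures d \ blBall μβ (k₁ / (N : ℝ) ^ (1 / (d : ℝ)))) ∩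
                empiricalMeasures d N, coulombG d c μ μβ) ∧
          (d = 2 →
            (⨅ μ ∈ (probMeasures d \ blBall μβ (max (k₁ - k₂) 0 / (N : ℝ) ^ (1 / (d : ℝ)))) ∩
                acMeasures d, coulombG d c μ μβ)
                - ((C / N + c * Real.log N / (2 * N) : ℝ) : EReal)
              ≤ ⨅ μ ∈ (probMeasures d \ blBall μβ (k₁ / (N : ℝ) ^ (1 / (d : ℝ)))) ∩
                empiricalMeasures d N, coulombG d c μ μβ) := by
  refine ⟨1, one_pos, fun d hd c hc M => ?_⟩
  -- `κ`, the Gaussian moment `m` and the density bound `L` are fixed before `V`, `N` and `β`, so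
  -- the final constant depends only on `d`, `c` and `M`.
  obtain ⟨κ, hκ, hκt⟩ := exists_integral_coulombKernel_heatMeasure hd hc
  set m := ∫ z, ‖z‖ ∂heatMeasure d 1 with hm
  have hm0 : 0 ≤ m := integral_nonneg fun _ => norm_nonneg _
  have hlog : 0 ≤ Real.log (m + 1) := Real.log_nonneg (by linarith)
  set L : ℝ≥0 := ((M : ℝ) + 2).toNNReal with hL
  have hM : (0 : ℝ) ≤ M := M.2
  -- The summands account for the self-energy, for the factor `m + 1` inside `log r` when `d = 2`,
  -- and for the interaction with the background; the final `1` ensures positivity.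
  refine ⟨(m + 1) ^ (d - 2) * |heatSelf d c 1| + c * Real.log (m + 1) + 2 * (κ * L) + 1,
    by positivity, ?_⟩
  set C := (m + 1) ^ (d - 2) * |heatSelf d c 1| + c * Real.log (m + 1) + 2 * (κ * L) + 1 with hC
  intro V μV hV hμV _ hμVac hμVM N β μβ hN hβ hμβ k₁
  have hN0 : N ≠ 0 := by omega
  have hNpos : (0 : ℝ) < N := by exact_mod_cast hN
  have hp := hμβ.1.meanField.prob
  have hlw := integrable_logWeight hc hμβ.1.meanField.kernel
  have hdens := hμβ.density_le hd hc hV.contDiff.continuous (mul_pos hNpos hβ) hμV hμVac hM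
    (density_le_of_essSup_le hμVM)
  have hle := le_smul_volume_of_density_le hμβ.1.ac hdens
  set ρ : ℝ := (N : ℝ) ^ (1 / (d : ℝ)) with hρ
  have hρ0 : 0 < ρ := by positivity
  have hd0 : (d : ℝ) ≠ 0 := by exact_mod_cast (by omega : d ≠ 0)
  have hρd : ρ ^ d = N := by
    rw [hρ, ← Real.rpow_natCast, ← Real.rpow_mul hNpos.le, one_div_mul_cancel hd0, Real.rpow_one]
  have hρ2 : (N : ℝ) ^ (2 / (d : ℝ)) = ρ ^ 2 := by
    rw [hρ, ← Real.rpow_natCast, ← Real.rpow_mul hNpos.le]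
    congr 1
    push_cast
    ring
  -- With this width the mean displacement `r * m` is at most `1/ρ`, which permits `k₂ = 1`; the
  -- added `1` also gives `r ≤ 1/ρ` and avoids dividing by `m`.
  set r := 1 / (ρ * (m + 1)) with hr
  have hr0 : 0 < r := by positivity
  have hrm : r * m ≤ 1 / ρ := by
    rw [hr, div_mul_eq_mul_div, one_mul, div_le_div_iff₀ (by positivity) hρ0]
    nlinarith
  have hr2 : r ^ 2 ≤ 1 / ρ ^ 2 := by
    rw [hr, div_pow, one_pow, mul_pow]
    have : (1 : ℝ) ≤ (m + 1) ^ 2 := one_le_pow₀ (by linarith)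
    exact one_div_le_one_div_of_le (by positivity) (by nlinarith [sq_nonneg ρ])
  have hcross : 2 * (κ * (L * r ^ 2)) ≤ 2 * (κ * L) / ρ ^ 2 := by
    calc 2 * (κ * (L * r ^ 2)) = 2 * (κ * L) * r ^ 2 := by ring
      _ ≤ 2 * (κ * L) * (1 / ρ ^ 2) := by gcongr
      _ = _ := by ring
  constructor
  · intro hd3
    refine iInf_acMeasures_sub_le hd hc hN0 hκ hκt hlw hle hr0 hrm ?_
    rw [heatSelf_of_ne_two (by omega) hr0, hρ2]
    -- Since `N = ρ^d`, the self-energy scale `N⁻¹ r^{2-d}` is exactly `(m + 1)^{d-2} ρ⁻²`, the same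
    -- order as the background error `r²`.
    have e1 : (N : ℝ)⁻¹ * ((r ^ (d - 2))⁻¹ * heatSelf d c 1) =
        (m + 1) ^ (d - 2) * heatSelf d c 1 / ρ ^ 2 := by
      have e2 : ρ ^ d = ρ ^ 2 * ρ ^ (d - 2) := by rw [← pow_add]; congr 1; omega
      rw [← hρd, e2, hr, div_pow, one_pow, mul_pow]
      field_simp
    have e3 : (m + 1) ^ (d - 2) * heatSelf d c 1 ≤ (m + 1) ^ (d - 2) * |heatSelf d c 1| := by
      gcongr
      exact le_abs_self _
    rw [e1]
    calc _ ≤ (m + 1) ^ (d - 2) * heatSelf d c 1 / ρ ^ 2 + 2 * (κ * L) / ρ ^ 2 := by gcongr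
      _ = ((m + 1) ^ (d - 2) * heatSelf d c 1 + 2 * (κ * L)) / ρ ^ 2 := by ring
      _ ≤ C / ρ ^ 2 := by
        gcongr
        have : 0 ≤ c * Real.log (m + 1) := by positivity
        linarith
  · intro h2
    refine iInf_acMeasures_sub_le hd hc hN0 hκ hκt hlw hle hr0 hrm ?_
    subst h2
    -- In the plane `ρ² = N`, so `-c log r / N` produces exactly `c log N / (2N)` plus a term of
    -- order `1/N`.
    have hlr : Real.log r = -(Real.log N / 2) - Real.log (m + 1) := by
      rw [hr, one_div, Real.log_inv, Real.log_mul hρ0.ne' (by positivity), ← hρd, Real.log_pow]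
      push_cast
      ring
    rw [heatSelf_two hc hr0, hlr]
    rw [hρd] at hcross
    have e1 : heatSelf 2 c 1 ≤ (m + 1) ^ (2 - 2) * |heatSelf 2 c 1| := by
      simpa using le_abs_self (heatSelf 2 c 1)
    calc _ ≤ (N : ℝ)⁻¹ * (-c * (-(Real.log N / 2) - Real.log (m + 1)) + heatSelf 2 c 1) +
          2 * (κ * L) / N := by gcongr
      _ = (heatSelf 2 c 1 + c * Real.log (m + 1) + 2 * (κ * L)) / N + c * Real.log N / (2 * N) := by
          field_simp
          ring
      _ ≤ _ := by
          gcongr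
          linarith
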